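/- Let $\mathbb H,\mathbb U$ be Hilbert spaces, let $(S(t))_{t\in\mathbb R}\subset\mathcal L(\mathbb H)$ be a strongly continuous group with generator $(A,\mathcal D(A))$, and equip $\mathcal D(A^*)$ with the graph scalar product $\langle z_1,z_2\rangle_{\mathbb H}+\langle A^*z_1,A^*z_2\rangle_{\mathbb H}$; let $\mathcal D(A^*)'$ be its dual with pivot space $\mathbb H$. Let $B\in\mathcal L(\mathbb U,\mathcal D(A^*)')$ be admissible: for all $T>0$ and $u\in L^2((0,T);\mathbb U)$, the function $t\mapsto\int_0^tS(t-s)Bu(s)\,ds$ belongs to $C([0,T];\mathbb H)$. Let $B^*\in\mathcal L(\mathcal D(A^*),\mathbb U)$ be the adjoint of $B$. Let $\lambda\in\mathbb R$, let $Q\in\mathcal L(\mathbb H)$ be symmetric, invertible and coercive ($\langle Qx,x\rangle\ge C\|x\|^2$ for some $C>0$), and let $R\in\mathcal L(\mathbb H)$ and $W\in\mathcal L(\mathbb U)$ be symmetric and non-negative, such that $AQ+QA^*-BWB^*+QRQ+2\lambda Q=0$ in the sense that $$\langle Qx,A^*y\rangle_{\mathbb H}+\langle A^*x,Qy\rangle_{\mathbb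 H}-\langle WB^*x,B^*y\rangle_{\mathbb U}+\langle RQx,Qy\rangle_{\mathbb H}+2\lambda\langle Qx,y\rangle_{\mathbb H}=0\qquad\forall\,x,y\in\mathcal D(A^*).$$ For $y_0\in\mathbb H$ consider the system $$y'=Ay-BWB^*\widetilde y,\qquad \widetilde y'=-A^*\widetilde y-2\lambda\widetilde y-RQ\widetilde y\quad\text{in }(0,+\infty),\qquad y(0)=y_0,\quad \widetilde y(0)=Q^{-1}y_0. \tag{1}$$ A weak solution on $(0,T)$ is a pair $(y,\widetilde y)\in C([0,T];\mathbb H)^2$ with these initial values such that, in the sense of distributions on $(0,T)$, $\frac{d}{dt}\langle y,\varphi\rangle=\langle y,A^*\varphi\rangle-\langle WB^*\widetilde y,B^*\varphi\rangle$ for all $\varphi\in\mathcal D(A^*)$ and $\frac{d}{dt}\langle\widetilde y,\psi\rangle=-\langle\widetilde y,A\psi\rangle-\langle2\lambda\widetilde y+RQ\widetilde y,\psi\rangle$ for all $\psi\in\mathcal D(A)$. Here $B^*\widetilde y\in L^2((0,T);\mathbb U)$ is defined by density: it is the $L^2$-limit of $B^*\zeta_n$ for weak solutions $\zeta_n\in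 C([0,T];\mathcal D(A^*))$ of $\zeta_n'=-A^*\zeta_n-\gamma_n$ with $\gamma_n\in C([0,T];\mathcal D(A^*))$, $\zeta_n(T)\to\widetilde y(T)$ in $\mathbb H$ and $\gamma_n\to2\lambda\widetilde y+RQ\widetilde y$ in $L^1((0,T);\mathbb H)$. A weak solution on $(0,+\infty)$ is one on $(0,T)$ for every $T>0$. Then system (1) has a weak solution $(y,\widetilde y)$ on $(0,+\infty)$; for every $T>0$ weak solutions on $(0,T)$, and the function $B^*\widetilde y\in L^2((0,T);\mathbb U)$, are unique; and the weak solution on $(0,+\infty)$ satisfies $$\widetilde y(t)=Q^{-1}y(t)\quad\text{for }t\ge0,$$ $$\|Q^{-1/2}y(t)\|_{\mathbb H}^2-\|Q^{-1/2}y(\tau)\|_{\mathbb H}^2=-2\lambda\int_\tau^t\|Q^{-1/2}y(s)\|_{\mathbb H}^2\,ds-\int_\tau^t\Big(\|W^{1/2}B^*\widetilde y(s)\|_{\mathbb U}^2+\|R^{1/2}y(s)\|_{\mathbb H}^2\Big)ds\quad\text{for }t\ge\tau\ge0,$$ and consequently $$\|Q^{-1/2}y(t)\|_{\mathbb H}\le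 e^{-\lambda t}\|Q^{-1/2}y(0)\|_{\mathbb H}\quad\text{for }t\ge0.$$ -/

import Mathlib

open MeasureTheory Filter Topology
open scoped ENNReal ContDiff LinearPMap

noncomputable section

/-! ### Square roots of non-negative symmetric operators -/

set_option linter.unusedSectionVars false

section SquareRoot

open scoped ComplexOrder

variable {𝕜 E : Type*} [RCLike 𝕜] [NormedAddCommGroup E] [InnerProductSpace 𝕜 E]
  [CompleteSpace E]

/-- The Taylor coefficients of `1 - √(1 - x) = ∑ n, sqrtCoeff n * x ^ (n + 1)`. -/
def sqrtCoeff (n : ℕ) : ℝ := catalan n / (2 * 4 ^ n)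

theorem sqrtCoeff_nonneg (n : ℕ) : 0 ≤ sqrtCoeff n := by
  unfold sqrtCoeff; positivity

theorem sqrtCoeff_conv (n : ℕ) :
    ∑ p ∈ Finset.HasAntidiagonal.antidiagonal n, sqrtCoeff p.1 * sqrtCoeff p.2 = 2 * sqrtCoeff (n + 1) := by
  have h : ∀ p ∈ Finset.HasAntidiagonal.antidiagonal n, sqrtCoeff p.1 * sqrtCoeff p.2
      = ((catalan p.1 * catalan p.2 : ℕ) : ℝ) * (1 / (4 * 4 ^ n)) := by
    intro p hp
    rw [Finset.HasAntidiagonal.mem_antidiagonal] at hp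
    unfold sqrtCoeff
    rw [← hp, pow_add]
    push_cast
    field_simp
    ring
  rw [Finset.sum_congr rfl h, ← Finset.sum_mul, ← Nat.cast_sum, ← catalan_succ']
  unfold sqrtCoeff
  field_simp
  ring

theorem sqrtCoeff_sum_le (N : ℕ) : ∑ n ∈ Finset.range N, sqrtCoeff n ≤ 1 := by
  induction N with
  | zero => simp
  | succ N ih =>
    have h0 : sqrtCoeff 0 = 1 / 2 := by simp [sqrtCoeff]
    have h1 : ∑ n ∈ Finset.range N, 2 * sqrtCoeff (n + 1)
        ≤ (∑ n ∈ Finset.range N, sqrtCoeff n) * ∑ n ∈ Finset.range N, sqrtCoeff n := by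
      simp_rw [← sqrtCoeff_conv]
      rw [Finset.sum_mul_sum, ← Finset.sum_product', Finset.sum_sigma']
      refine le_trans (le_of_eq ?_) (Finset.sum_le_sum_of_subset_of_nonneg
        (s := (((Finset.range N).sigma fun n => Finset.HasAntidiagonal.antidiagonal n).image
          fun p => p.2)) ?_ ?_)
      · rw [Finset.sum_image]
        rintro ⟨a, p⟩ hp ⟨b, q⟩ hq hpq
        simp only [Finset.coe_sigma, Set.mem_sigma_iff, Finset.mem_coe,
          Finset.HasAntidiagonal.mem_antidiagonal] at hp hq hpq
        obtain ⟨-, hp⟩ := hp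
        obtain ⟨-, hq⟩ := hq
        subst hpq hp hq
        rfl
      · intro p hp
        simp only [Finset.mem_image, Finset.mem_sigma, Finset.mem_range,
          Finset.HasAntidiagonal.mem_antidiagonal, Sigma.exists, Finset.mem_product] at hp ⊢
        obtain ⟨a, b, ⟨h, h'⟩, rfl⟩ := hp
        omega
      · intro p _ _
        exact mul_nonneg (sqrtCoeff_nonneg _) (sqrtCoeff_nonneg _)
    have h2 : 0 ≤ ∑ n ∈ Finset.range N, sqrtCoeff n :=
      Finset.sum_nonneg fun n _ => sqrtCoeff_nonneg n
    rw [Finset.sum_range_succ', h0]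
    rw [← Finset.mul_sum] at h1
    nlinarith

theorem sqrtCoeff_summable : Summable sqrtCoeff :=
  summable_of_sum_range_le sqrtCoeff_nonneg sqrtCoeff_sum_le

theorem sqrtCoeff_tsum_le : ∑' n, sqrtCoeff n ≤ 1 :=
  Real.tsum_le_of_sum_range_le sqrtCoeff_nonneg sqrtCoeff_sum_le

theorem norm_le_one_of_isPositive {X : E →L[𝕜] E} (h0 : X.IsPositive)
    (h1 : (1 - X).IsPositive) : ‖X‖ ≤ 1 := by
  refine ContinuousLinearMap.opNorm_le_bound _ zero_le_one fun x => ?_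
  have a1 := h1.re_inner_nonneg_left (X x)
  have a2 := h0.re_inner_nonneg_left ((1 - X) x)
  have a3 := h1.re_inner_nonneg_left x
  have e1 := h0.inner_left_eq_inner_right (X x) x
  have e2 := h0.inner_left_eq_inner_right x (X x)
  simp only [sub_apply, one_apply_eq_self, map_sub,
    inner_sub_left, inner_sub_right] at a1 a2 a3
  rw [e1] at a2
  have n1 : RCLike.re (inner 𝕜 (X x) (X x)) = ‖X x‖ ^ 2 := inner_self_eq_norm_sq _
  have n2 : RCLike.re (inner 𝕜 x x) = ‖x‖ ^ 2 := inner_self_eq_norm_sq _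
  rw [n1] at a1 a2
  rw [n2] at a3
  have : ‖X x‖ ^ 2 ≤ ‖x‖ ^ 2 := by linarith
  rw [one_mul]
  exact (sq_le_sq₀ (norm_nonneg _) (norm_nonneg _)).1 this

theorem exists_sqrt_one_sub {X : E →L[𝕜] E} (h0 : X.IsPositive) (h1 : (1 - X).IsPositive) :
    ∃ S : E →L[𝕜] E, S.IsPositive ∧ S * S = 1 - X := by
  have hX := norm_le_one_of_isPositive h0 h1
  have hpow : ∀ n, ‖X ^ n‖ ≤ 1 := by
    intro n
    induction n with
    | zero =>
      rw [pow_zero]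
      exact ContinuousLinearMap.norm_id_le
    | succ n ih =>
      rw [pow_succ]
      exact (norm_mul_le _ _).trans (mul_le_one₀ ih (norm_nonneg _) hX)
  let a : ℕ → E →L[𝕜] E := fun n => (sqrtCoeff n : 𝕜) • X ^ (n + 1)
  have ha : ∀ n, ‖a n‖ ≤ sqrtCoeff n := by
    intro n
    simp only [a, norm_smul, RCLike.norm_ofReal, abs_of_nonneg (sqrtCoeff_nonneg n)]
    exact mul_le_of_le_one_right (sqrtCoeff_nonneg n) (hpow _)
  have hsn : Summable fun n => ‖a n‖ :=
    Summable.of_nonneg_of_le (fun _ => norm_nonneg _) ha sqrtCoeff_summable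
  have hs : Summable a := hsn.of_norm
  set Y := ∑' n, a n with hY
  have hYn : ‖Y‖ ≤ 1 :=
    (norm_tsum_le_tsum_norm hsn).trans
      ((hsn.tsum_le_tsum ha sqrtCoeff_summable).trans sqrtCoeff_tsum_le)
  have hYY : Y * Y = (2 : 𝕜) • Y - X := by
    rw [hY, tsum_mul_tsum_eq_tsum_sum_antidiagonal_of_summable_norm hsn hsn]
    have : ∀ n, ∑ p ∈ Finset.HasAntidiagonal.antidiagonal n, a p.1 * a p.2 = (2 : 𝕜) • a (n + 1) := by
      intro n
      have e : ∀ p ∈ Finset.HasAntidiagonal.antidiagonal n, a p.1 * a p.2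
          = ((sqrtCoeff p.1 * sqrtCoeff p.2 : ℝ) : 𝕜) • X ^ (n + 2) := by
        intro p hp
        rw [Finset.HasAntidiagonal.mem_antidiagonal] at hp
        simp only [a, smul_mul_smul_comm, ← pow_add]
        rw [RCLike.ofReal_mul]
        congr 2
        omega
      rw [Finset.sum_congr rfl e, ← Finset.sum_smul, ← RCLike.ofReal_sum, sqrtCoeff_conv]
      rw [RCLike.ofReal_mul, RCLike.ofReal_ofNat, ← smul_smul]
    simp_rw [this]
    rw [((summable_nat_add_iff 1).2 hs).tsum_const_smul, hs.tsum_eq_zero_add, smul_add]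
    have h0' : (2 : 𝕜) • a 0 = X := by
      have : sqrtCoeff 0 = 2⁻¹ := by simp [sqrtCoeff]
      simp only [a, this, smul_smul, zero_add, pow_one]
      rw [RCLike.ofReal_inv, RCLike.ofReal_ofNat, mul_inv_cancel₀ two_ne_zero, one_smul]
    rw [h0']
    abel
  have hstar : star Y = Y := by
    rw [hY, tsum_star]
    refine tsum_congr fun n => ?_
    simp [a, star_smul, star_pow, h0.isSelfAdjoint.star_eq]
  refine ⟨1 - Y, ?_, ?_⟩
  · rw [ContinuousLinearMap.isPositive_def']
    refine ⟨?_, fun x => ?_⟩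
    · rw [IsSelfAdjoint, star_sub, star_one, hstar]
    · have e : (1 - Y).reApplyInnerSelf x = ‖x‖ ^ 2 - RCLike.re (inner 𝕜 (Y x) x) := by
        rw [ContinuousLinearMap.reApplyInnerSelf_apply, sub_apply,
          inner_sub_left, map_sub, one_apply_eq_self, inner_self_eq_norm_sq]
      rw [e]
      have b1 : RCLike.re (inner 𝕜 (Y x) x) ≤ ‖Y x‖ * ‖x‖ := re_inner_le_norm _ _
      have b2 : ‖Y x‖ ≤ 1 * ‖x‖ := Y.le_of_opNorm_le hYn x
      nlinarith [norm_nonneg x]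
  · have : (1 - Y) * (1 - Y) = 1 - (2 : 𝕜) • Y + Y * Y := by
      rw [two_smul]; noncomm_ring
    rw [this, hYY]
    abel

theorem exists_sqrt {T : E →L[𝕜] E} (hT : T.IsPositive) :
    ∃ S : E →L[𝕜] E, S.IsPositive ∧ S * S = T := by
  set M : ℝ := ‖T‖ + 1 with hM
  have hM0 : 0 < M := by positivity
  have hinv : (0 : 𝕜) ≤ ((M⁻¹ : ℝ) : 𝕜) := RCLike.ofReal_nonneg.2 (by positivity)
  have h1 : (1 - (1 - ((M⁻¹ : ℝ) : 𝕜) • T)).IsPositive := by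
    rw [sub_sub_cancel]
    exact hT.smul_of_nonneg hinv
  have h0 : (1 - ((M⁻¹ : ℝ) : 𝕜) • T).IsPositive := by
    rw [ContinuousLinearMap.isPositive_def']
    refine ⟨?_, fun x => ?_⟩
    · exact (IsSelfAdjoint.one _).sub (hT.smul_of_nonneg hinv).isSelfAdjoint
    · rw [ContinuousLinearMap.reApplyInnerSelf_apply, sub_apply,
        inner_sub_left, map_sub, one_apply_eq_self, inner_self_eq_norm_sq,
        smul_apply, inner_smul_left, RCLike.conj_ofReal,
        RCLike.re_ofReal_mul]
      have b1 : RCLike.re (inner 𝕜 (T x) x) ≤ ‖T x‖ * ‖x‖ := re_inner_le_norm _ _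
      have b2 : ‖T x‖ ≤ ‖T‖ * ‖x‖ := T.le_opNorm x
      have b3 : RCLike.re (inner 𝕜 (T x) x) ≤ M * ‖x‖ ^ 2 := by
        nlinarith [norm_nonneg x, sq_nonneg ‖x‖]
      have b4 : M⁻¹ * RCLike.re (inner 𝕜 (T x) x) ≤ M⁻¹ * (M * ‖x‖ ^ 2) :=
        mul_le_mul_of_nonneg_left b3 (by positivity)
      rw [inv_mul_cancel_left₀ hM0.ne'] at b4
      linarith
  obtain ⟨S, hS, hSS⟩ := exists_sqrt_one_sub h0 h1
  refine ⟨((√M : ℝ) : 𝕜) • S, hS.smul_of_nonneg (RCLike.ofReal_nonneg.2 (by positivity)), ?_⟩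
  rw [smul_mul_smul_comm, hSS, sub_sub_cancel, smul_smul, ← RCLike.ofReal_mul,
    ← RCLike.ofReal_mul, Real.mul_self_sqrt hM0.le, mul_inv_cancel₀ hM0.ne']
  simp

open Classical in
/-- The square root `T^{1/2}` of a non-negative symmetric bounded operator `T`: the non-negative
symmetric bounded operator whose square is `T` (and `0` if `T` is not non-negative symmetric). -/
def opSqrt (T : E →L[𝕜] E) : E →L[𝕜] E :=
  if hT : T.IsPositive then (exists_sqrt hT).choose else 0

theorem opSqrt_isPositive {T : E →L[𝕜] E} (hT : T.IsPositive) : (opSqrt T).IsPositive := by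
  rw [opSqrt, dif_pos hT]
  exact (exists_sqrt hT).choose_spec.1

theorem opSqrt_mul_self {T : E →L[𝕜] E} (hT : T.IsPositive) : opSqrt T * opSqrt T = T := by
  rw [opSqrt, dif_pos hT]
  exact (exists_sqrt hT).choose_spec.2

end SquareRoot

/-! ### Strongly continuous groups, their generators and the space `D(A*)` -/

/-- A strongly continuous group of bounded operators on `H`. -/
structure C0Group (𝕜 H : Type*) [RCLike 𝕜] [NormedAddCommGroup H] [InnerProductSpace 𝕜 H] where
  /-- The operators `S t`, `t ∈ ℝ`. -/
  S : ℝ → H →L[𝕜] H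
  map_zero : S 0 = ContinuousLinearMap.id 𝕜 H
  map_add : ∀ t₁ t₂ : ℝ, S (t₁ + t₂) = (S t₁).comp (S t₂)
  tendsto_zero : ∀ x : H, Tendsto (fun t => S t x) (𝓝 0) (𝓝 x)

namespace C0Group

variable {𝕜 H U : Type*} [RCLike 𝕜]
  [NormedAddCommGroup H] [InnerProductSpace 𝕜 H] [CompleteSpace H]
  [NormedAddCommGroup U] [InnerProductSpace 𝕜 U] [CompleteSpace U]

/-- The graph of the infinitesimal generator: the pairs `(x, z)` with
`(S t x - x) / t → z` as `t → 0`. -/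
def generatorGraph (𝒮 : C0Group 𝕜 H) : Submodule 𝕜 (H × H) where
  carrier := {p | Tendsto (fun t : ℝ => ((t⁻¹ : ℝ) : 𝕜) • (𝒮.S t p.1 - p.1)) (𝓝[≠] 0) (𝓝 p.2)}
  zero_mem' := by simp
  add_mem' {p q} hp hq := by
    have h := Tendsto.add hp hq
    refine h.congr fun t => ?_
    simp only [Prod.fst_add, _root_.map_add, ← smul_add]
    congr 1
    abel
  smul_mem' c p hp := by
    have h := Tendsto.const_smul hp c
    refine h.congr fun t => ?_
    simp only [Prod.smul_fst, map_smul, ← smul_sub]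
    rw [smul_comm]

theorem mem_generatorGraph {𝒮 : C0Group 𝕜 H} {p : H × H} : p ∈ 𝒮.generatorGraph ↔
    Tendsto (fun t : ℝ => ((t⁻¹ : ℝ) : 𝕜) • (𝒮.S t p.1 - p.1)) (𝓝[≠] 0) (𝓝 p.2) :=
  Iff.rfl

/-- The infinitesimal generator `(A, D(A))` of a strongly continuous group. -/
def generator (𝒮 : C0Group 𝕜 H) : H →ₗ.[𝕜] H := 𝒮.generatorGraph.toLinearPMap

theorem generator_graph (𝒮 : C0Group 𝕜 H) : 𝒮.generator.graph = 𝒮.generatorGraph := by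
  refine Submodule.toLinearPMap_graph_eq _ fun p hp h0 => ?_
  have h : Tendsto (fun _ : ℝ => (0 : H)) (𝓝[≠] 0) (𝓝 p.2) := by
    refine (mem_generatorGraph.1 hp).congr fun t => ?_
    simp [h0]
  exact tendsto_nhds_unique h tendsto_const_nhds

/-- The domain `D(A*)` of the adjoint of the generator. Its elements are the pairs `(z, A* z)`,
as a subspace of the Hilbert space sum `H ⊕ H`, so that the scalar product is
`⟨z₁, z₂⟩ + ⟨A* z₁, A* z₂⟩`. -/
abbrev adjGraph (𝒮 : C0Group 𝕜 H) : Submodule 𝕜 (WithLp 2 (H × H)) :=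
  (𝒮.generator†.graph).comap (WithLp.linearEquiv 2 𝕜 (H × H)).toLinearMap

/-- `D(A*)` with its graph scalar product. -/
abbrev DAdj (𝒮 : C0Group 𝕜 H) : Type _ := 𝒮.adjGraph

/-- The dual space `D(A*)'` with respect to the pivot space `H`: the bounded antilinear functionals
on `D(A*)`. A vector `x` of `H` is identified with the functional `z ↦ ⟨x, z⟩` (which is
`inner 𝕜 z x` in Mathlib's convention, in which inner products are antilinear on the left). -/
abbrev DAdjDual (𝒮 : C0Group 𝕜 H) : Type _ := 𝒮.DAdj →L⋆[𝕜] 𝕜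

/-- The inclusion `D(A*) ⊂ H`. -/
def incl {𝒮 : C0Group 𝕜 H} (z : 𝒮.DAdj) : H := z.1.fst

/-- The operator `A* : D(A*) → H`. -/
def adj {𝒮 : C0Group 𝕜 H} (z : 𝒮.DAdj) : H := z.1.snd

theorem incl_mem {𝒮 : C0Group 𝕜 H} (z : 𝒮.DAdj) : incl z ∈ 𝒮.generator†.domain :=
  LinearPMap.mem_domain_of_mem_graph z.2

theorem adj_eq {𝒮 : C0Group 𝕜 H} (z : 𝒮.DAdj) : adj z = 𝒮.generator† ⟨incl z, incl_mem z⟩ := by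
  have h : (incl z, adj z) ∈ 𝒮.generator†.graph := z.2
  exact ((LinearPMap.mem_graph_snd_inj _ h (LinearPMap.mem_graph _ ⟨incl z, incl_mem z⟩)) rfl)

theorem inner_DAdj {𝒮 : C0Group 𝕜 H} (z₁ z₂ : 𝒮.DAdj) :
    inner 𝕜 z₁ z₂ = inner 𝕜 (incl z₁) (incl z₂) + inner 𝕜 (adj z₁) (adj z₂) := by
  rw [Submodule.coe_inner, WithLp.prod_inner_apply]; rfl

/-- The domain of the generator is invariant under the group, which commutes with `A` there. -/
theorem generator_comm (𝒮 : C0Group 𝕜 H) (t : ℝ) (x : 𝒮.generator.domain) :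
    (𝒮.S t x, 𝒮.S t (𝒮.generator x)) ∈ 𝒮.generator.graph := by
  have h := LinearPMap.mem_graph 𝒮.generator x
  rw [generator_graph, mem_generatorGraph] at h ⊢
  refine (((𝒮.S t).continuous.tendsto _).comp h).congr fun s => ?_
  have e : 𝒮.S t (𝒮.S s x) = 𝒮.S s (𝒮.S t x) := by
    rw [← ContinuousLinearMap.comp_apply, ← ContinuousLinearMap.comp_apply, ← 𝒮.map_add,
      ← 𝒮.map_add, add_comm]
  simp [e]

theorem adjoint_mem (𝒮 : C0Group 𝕜 H) (t : ℝ) (z : 𝒮.DAdj) :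
    ((𝒮.S t).adjoint (incl z), (𝒮.S t).adjoint (adj z)) ∈ 𝒮.generator†.graph := by
  have key : ∀ x : 𝒮.generator.domain, ∃ x' : 𝒮.generator.domain,
      (x' : H) = 𝒮.S t x ∧ 𝒮.generator x' = 𝒮.S t (𝒮.generator x) := by
    intro x
    have h := 𝒮.generator_comm t x
    rw [LinearPMap.mem_graph_iff] at h
    exact h
  choose x' hx' hAx' using key
  have hcont : Continuous x' := by
    rw [continuous_induced_rng]
    have : (Subtype.val ∘ x') = fun x : 𝒮.generator.domain => 𝒮.S t x := funext hx'
    rw [this]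
    fun_prop
  have hdom : (𝒮.S t).adjoint (incl z) ∈ 𝒮.generator†.domain := by
    have h := incl_mem z
    rw [LinearPMap.mem_adjoint_domain_iff] at h ⊢
    refine (h.comp hcont).congr fun x => ?_
    change inner 𝕜 (incl z) (𝒮.generator (x' x)) =
      inner 𝕜 ((𝒮.S t).adjoint (incl z)) (𝒮.generator x)
    rw [hAx', ContinuousLinearMap.adjoint_inner_left]
  rw [LinearPMap.mem_graph_iff]
  refine ⟨⟨_, hdom⟩, rfl, ?_⟩
  rw [adj_eq]
  by_cases hd : Dense (𝒮.generator.domain : Set H)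
  · refine LinearPMap.adjoint_apply_eq hd _ fun x => ?_
    rw [ContinuousLinearMap.adjoint_inner_left, ContinuousLinearMap.adjoint_inner_left, ← hx',
      ← hAx']
    exact LinearPMap.adjoint_isFormalAdjoint hd ⟨incl z, incl_mem z⟩ (x' x)
  · rw [LinearPMap.adjoint_apply_of_not_dense hd, LinearPMap.adjoint_apply_of_not_dense hd,
      _root_.map_zero]

/-- The restriction of `S(t)*` to `D(A*)`. -/
def adjRestrict (𝒮 : C0Group 𝕜 H) (t : ℝ) (z : 𝒮.DAdj) : 𝒮.DAdj :=
  ⟨WithLp.toLp 2 ((𝒮.S t).adjoint (incl z), (𝒮.S t).adjoint (adj z)), 𝒮.adjoint_mem t z⟩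

/-! ### Unbounded control operators -/

/-- The adjoint `B* : D(A*) → U` of a control operator `B : U → D(A*)'`. -/
def adjControl {𝒮 : C0Group 𝕜 H} (B : U →L[𝕜] 𝒮.DAdjDual) (z : 𝒮.DAdj) : U :=
  (InnerProductSpace.toDual 𝕜 U).symm (B.flip z)

/-- `⟨u, B* z⟩ = (B u)(z)`. -/
theorem inner_adjControl {𝒮 : C0Group 𝕜 H} (B : U →L[𝕜] 𝒮.DAdjDual) (z : 𝒮.DAdj) (u : U) :
    inner 𝕜 (adjControl B z) u = B u z := by
  simp [adjControl]

/-- `B` is an admissible control operator for `(S t)_{t ≥ 0}`: for every `T > 0` and every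
`u ∈ L²((0, T); U)` the function `φ(t) = ∫₀ᵗ S(t - s) B u(s) ds` takes its values in `H` and belongs
to `C([0, T]; H)`. The integral is taken in `D(A*)'`, on which `S(r)` acts by duality through
`S(r)* : D(A*) → D(A*)`: for `ψ ∈ D(A*)`, `⟨φ(t), ψ⟩ = ∫₀ᵗ (B u(s)) (S(t - s)* ψ) ds`. -/
def Admissible (𝒮 : C0Group 𝕜 H) (B : U →L[𝕜] 𝒮.DAdjDual) : Prop :=
  ∀ T : ℝ, 0 < T → ∀ u : ℝ → U, MemLp u 2 (volume.restrict (Set.Ioo 0 T)) →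
    ∃ φ : ℝ → H, ContinuousOn φ (Set.Icc 0 T) ∧
      ∀ t ∈ Set.Icc 0 T, ∀ ψ : 𝒮.DAdj,
        inner 𝕜 (incl ψ) (φ t) = ∫ s in (0 : ℝ)..t, B (u s) (𝒮.adjRestrict (t - s) ψ)

/-! ### Weak solutions -/

/-- `d/dt f = h` in `(0, T)` in the sense of distributions. -/
def HasDistribDeriv (T : ℝ) (f h : ℝ → 𝕜) : Prop :=
  IntegrableOn f (Set.Ioo 0 T) ∧ IntegrableOn h (Set.Ioo 0 T) ∧
    ∀ η : ℝ → ℝ, ContDiff ℝ ∞ η → HasCompactSupport η → tsupport η ⊆ Set.Ioo 0 T →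
      ∫ t in Set.Ioo 0 T, deriv η t • f t = - ∫ t in Set.Ioo 0 T, η t • h t

/-- `y ∈ C([0, T]; H)` is a weak solution of `y' = A y + B u` in `(0, T)`: for every `φ ∈ D(A*)`,
`d/dt ⟨y, φ⟩ = ⟨y, A* φ⟩ + ⟨u, B* φ⟩` in the sense of distributions. -/
structure IsWeakSol (𝒮 : C0Group 𝕜 H) (B : U →L[𝕜] 𝒮.DAdjDual) (T : ℝ) (u : ℝ → U)
    (y : ℝ → H) : Prop where
  continuousOn : ContinuousOn y (Set.Icc 0 T)
  eqn : ∀ φ : 𝒮.DAdj, HasDistribDeriv T (fun t => inner 𝕜 (incl φ) (y t))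
    (fun t => inner 𝕜 (adj φ) (y t) + inner 𝕜 (adjControl B φ) (u t))

/-- `z ∈ C([0, T]; H)` is a weak solution of `z' = - A* z - g` in `(0, T)`: for every `φ` in the
domain `D(A)` of the adjoint of `A*`, `d/dt ⟨z, φ⟩ = - ⟨z, A φ⟩ - ⟨g, φ⟩` in the sense of
distributions. -/
structure IsWeakSolAdj (𝒮 : C0Group 𝕜 H) (T : ℝ) (g z : ℝ → H) : Prop where
  continuousOn : ContinuousOn z (Set.Icc 0 T)
  eqn : ∀ φ : 𝒮.generator.domain, HasDistribDeriv T (fun t => inner 𝕜 (φ : H) (z t))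
    (fun t => - inner 𝕜 (𝒮.generator φ) (z t) - inner 𝕜 (φ : H) (g t))

/-- `v = B* z` in `L²((0, T); U)`, for the weak solution `z` of `z' = - A* z - g`, `z(T) = z_T` with
`z_T ∈ H` and `g ∈ L¹((0, T); H)`. As `z` need not take values in `D(A*)`, `B* z` is understood by
density: it is the `L²`-limit of `B* ζₙ` for solutions `ζₙ ∈ C([0, T]; D(A*))` of
`ζₙ' = - A* ζₙ - γₙ` with `γₙ ∈ C([0, T]; D(A*))`, when `ζₙ(T) → z_T` in `H` and `γₙ → g` in
`L¹((0, T); H)`. -/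
structure IsAdjControlTrace (𝒮 : C0Group 𝕜 H) (B : U →L[𝕜] 𝒮.DAdjDual) (T : ℝ) (g z : ℝ → H)
    (v : ℝ → U) : Prop where
  memLp : MemLp v 2 (volume.restrict (Set.Ioo 0 T))
  approx : ∃ ζ γ : ℕ → ℝ → 𝒮.DAdj,
    (∀ n, ContinuousOn (ζ n) (Set.Icc 0 T)) ∧
    (∀ n, ContinuousOn (γ n) (Set.Icc 0 T)) ∧
    (∀ n, 𝒮.IsWeakSolAdj T (fun t => incl (γ n t)) (fun t => incl (ζ n t))) ∧
    Tendsto (fun n => incl (ζ n T)) atTop (𝓝 (z T)) ∧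
    Tendsto (fun n => eLpNorm (fun t => incl (γ n t) - g t) 1 (volume.restrict (Set.Ioo 0 T)))
      atTop (𝓝 0) ∧
    Tendsto (fun n => eLpNorm (fun t => adjControl B (ζ n t) - v t) 2
      (volume.restrict (Set.Ioo 0 T))) atTop (𝓝 0)

/-! ### The operator identity and the closed-loop system -/

/-- `A Q + Q A* - B W B* + Q R Q + 2 λ Q = 0`, in the weak sense on `D(A*)`. -/
def OperatorIdentity (𝒮 : C0Group 𝕜 H) (B : U →L[𝕜] 𝒮.DAdjDual) (lam : ℝ)
    (Q : H ≃L[𝕜] H) (R : H →L[𝕜] H) (W : U →L[𝕜] U) : Prop :=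
  ∀ x y : 𝒮.DAdj,
    inner 𝕜 (Q (incl x)) (adj y) + inner 𝕜 (adj x) (Q (incl y))
      - inner 𝕜 (W (adjControl B x)) (adjControl B y)
      + inner 𝕜 (R (Q (incl x))) (Q (incl y))
      + ((2 * lam : ℝ) : 𝕜) * inner 𝕜 (Q (incl x)) (incl y) = 0

/-- `(y, ỹ) ∈ C([0, T]; H)²` is a weak solution on `(0, T)` of
`y' = A y - B W B* ỹ`, `ỹ' = - A* ỹ - 2 λ ỹ - R Q ỹ`, `y(0) = y₀`, `ỹ(0) = Q⁻¹ y₀`,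
where `v` is (a representative of) `B* ỹ ∈ L²((0, T); U)`. -/
structure IsClosedLoopSol (𝒮 : C0Group 𝕜 H) (B : U →L[𝕜] 𝒮.DAdjDual) (lam : ℝ)
    (Q : H ≃L[𝕜] H) (R : H →L[𝕜] H) (W : U →L[𝕜] U) (y₀ : H) (T : ℝ)
    (y yt : ℝ → H) (v : ℝ → U) : Prop where
  state : 𝒮.IsWeakSol B T (fun s => - W (v s)) y
  costate : 𝒮.IsWeakSolAdj T (fun s => ((2 * lam : ℝ) : 𝕜) • yt s + R (Q (yt s))) yt
  trace : 𝒮.IsAdjControlTrace B T (fun s => ((2 * lam : ℝ) : 𝕜) • yt s + R (Q (yt s))) yt v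
  state_zero : y 0 = y₀
  costate_zero : yt 0 = Q.symm y₀

end C0Group

end

set_option linter.unusedSectionVars false
set_option linter.style.haveILetI false

noncomputable section

namespace C0Group

section DistribDeriv

variable {𝕜 : Type*} [RCLike 𝕜]

/-! ### Distributional derivatives -/

/-! The costate equation does not contain `y`: it is the adjoint equation perturbed by the bounded
operator `2 λ + R Q`, so it is solved first. The state is then taken to be `y = Q ỹ`. For smooth
`ỹ`, the operator identity says exactly that `Q ỹ` solves the state equation. The relation `ỹ = Q⁻¹
y` therefore follows from existence together with uniqueness.

Since `ỹ(t)` need not lie in `D(A*)`, everything is computed on the averages `ε⁻¹ ∫₀^ε S(s)* ỹ ds`.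
They take values in `D(A*)`, solve the same adjoint equation with averaged source, and converge to
`ỹ` (`hasDerivAt_incl_avg_costate`, `tendsto_incl_avg`). The unbounded term `B* ỹ` is controlled by
admissibility: by Banach–Steinhaus and duality, `‖B* ζ‖` in `L²` is at most a constant times
`‖ζ(T)‖` plus the `L¹` norm of the source (`Admissible.exists_eLpNorm_adjControl_le`). This estimate
makes the traces of the averages Cauchy in `L²` (`Admissible.exists_trace`) and makes their limit
unique (`IsAdjControlTrace.ae_eq`). Passing to the limit in the operator identity gives the state
equation (`isWeakSol_costate`). Used on the diagonal, it gives the balance of `⟨Q ỹ, ỹ⟩ = ‖Q^{-1/2}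
y‖²` (`energy_costate`), and decay follows from Gronwall.

Uniqueness goes in the same order. The costate is unique because weak solutions are mild and a
Gronwall argument applies, then its trace is unique, and then the state is unique as a weak solution
with a prescribed control. -/

theorem setIntegral_Ioo_smul_eq_integral {T : ℝ} {η : ℝ → ℝ} (f : ℝ → 𝕜)
    (hη : tsupport η ⊆ Set.Ioo 0 T) :
    ∫ t in Set.Ioo 0 T, η t • f t = ∫ t, η t • f t := by
  refine setIntegral_eq_integral_of_forall_compl_eq_zero fun t ht => ?_
  rw [image_eq_zero_of_notMem_tsupport fun h => ht (hη h), zero_smul]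

theorem hasDistribDeriv_of_hasDerivAt {T : ℝ} {f h : ℝ → 𝕜}
    (hf : ∀ t, HasDerivAt f (h t) t) (hh : Continuous h) : HasDistribDeriv T f h := by
  have hfc : Continuous f := continuous_iff_continuousAt.2 fun t => (hf t).continuousAt
  refine ⟨(hfc.integrableOn_Icc).mono_set Set.Ioo_subset_Icc_self,
    (hh.integrableOn_Icc).mono_set Set.Ioo_subset_Icc_self, fun η hη hc hs => ?_⟩
  have hη1 : ContDiff ℝ 1 η := hη.of_le (by simp)
  have hd : Continuous (deriv η) := hη1.continuous_deriv le_rfl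
  rw [setIntegral_Ioo_smul_eq_integral f ((tsupport_deriv_subset).trans hs),
    setIntegral_Ioo_smul_eq_integral h hs]
  have i1 : Integrable fun t => deriv η t • f t :=
    (hd.smul hfc).integrable_of_hasCompactSupport hc.deriv.smul_right
  have i2 : Integrable fun t => η t • h t :=
    (hη.continuous.smul hh).integrable_of_hasCompactSupport hc.smul_right
  have i3 : Integrable fun t => η t • f t :=
    (hη.continuous.smul hfc).integrable_of_hasCompactSupport hc.smul_right
  have := integral_eq_zero_of_hasDerivAt_of_integrable (f := fun t => η t • f t)
    (f' := fun t => η t • h t + deriv η t • f t)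
    (fun t => ((hη1.differentiable (by simp)) t).hasDerivAt.smul (hf t)) (i2.add i1) i3
  rw [integral_add i2 i1] at this
  exact eq_neg_of_add_eq_zero_right this

theorem tendsto_setIntegral_smul_of_tendsto_eLpNorm_one {s : Set ℝ} {η : ℝ → ℝ} {f : ℝ → 𝕜}
    {fn : ℕ → ℝ → 𝕜} (hη : Continuous η) (hc : HasCompactSupport η) (hf : IntegrableOn f s)
    (hfn : ∀ n, IntegrableOn (fn n) s)
    (hlim : Tendsto (fun n => eLpNorm (fun t => fn n t - f t) 1 (volume.restrict s)) atTop (𝓝 0)) :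
    Tendsto (fun n => ∫ t in s, η t • fn n t) atTop (𝓝 (∫ t in s, η t • f t)) := by
  obtain ⟨C, hC⟩ := hη.bounded_above_of_compact_support hc
  have hm : ∀ {g : ℝ → 𝕜}, IntegrableOn g s → IntegrableOn (fun t => η t • g t) s := fun hg =>
    hg.bdd_smul C hη.aestronglyMeasurable (ae_of_all _ hC)
  refine tendsto_integral_of_L1' _ (hm hf).1 (Eventually.of_forall fun n => hm (hfn n)) ?_
  refine tendsto_of_tendsto_of_tendsto_of_le_of_le tendsto_const_nhds
    (h := fun n => ENNReal.ofReal C * eLpNorm (fun t => fn n t - f t) 1 (volume.restrict s))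
    ?_ (fun _ => zero_le) fun n => ?_
  · simpa using ENNReal.Tendsto.const_mul hlim (Or.inr ENNReal.ofReal_ne_top)
  · refine eLpNorm_le_mul_eLpNorm_of_ae_le_mul (ae_of_all _ fun t => ?_) 1
    simp only [Pi.sub_apply, ← smul_sub, norm_smul]
    exact mul_le_mul_of_nonneg_right (hC t) (norm_nonneg _)

/-- A test function and its derivative are bounded, so both sides of the integration by parts
formula are continuous in `L¹`. This is how equations for regularised solutions pass to the limit.
-/
theorem hasDistribDeriv_of_tendsto {T : ℝ} {f h : ℝ → 𝕜} {fn hn : ℕ → ℝ → 𝕜}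
    (hd : ∀ n, HasDistribDeriv T (fn n) (hn n))
    (hf : IntegrableOn f (Set.Ioo 0 T)) (hh : IntegrableOn h (Set.Ioo 0 T))
    (hflim : Tendsto (fun n => eLpNorm (fun t => fn n t - f t) 1
      (volume.restrict (Set.Ioo 0 T))) atTop (𝓝 0))
    (hhlim : Tendsto (fun n => eLpNorm (fun t => hn n t - h t) 1
      (volume.restrict (Set.Ioo 0 T))) atTop (𝓝 0)) :
    HasDistribDeriv T f h := by
  refine ⟨hf, hh, fun η hη hc hs => ?_⟩
  have hη1 : ContDiff ℝ 1 η := hη.of_le (by simp)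
  refine tendsto_nhds_unique (tendsto_setIntegral_smul_of_tendsto_eLpNorm_one
    (hη1.continuous_deriv le_rfl) hc.deriv hf (fun n => (hd n).1) hflim) ?_
  refine (tendsto_setIntegral_smul_of_tendsto_eLpNorm_one
    hη.continuous hc hh (fun n => (hd n).2.1) hhlim).neg.congr fun n => ?_
  exact ((hd n).2.2 η hη hc hs).symm

theorem HasDistribDeriv.sub {T : ℝ} {f h f' h' : ℝ → 𝕜} (H : HasDistribDeriv T f h)
    (H' : HasDistribDeriv T f' h') :
    HasDistribDeriv T (fun t => f t - f' t) (fun t => h t - h' t) := by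
  refine ⟨H.1.sub H'.1, H.2.1.sub H'.2.1, fun η hη hc hs => ?_⟩
  have hη1 : ContDiff ℝ 1 η := hη.of_le (by simp)
  have key : ∀ {θ : ℝ → ℝ} {g : ℝ → 𝕜}, Continuous θ → HasCompactSupport θ →
      IntegrableOn g (Set.Ioo 0 T) → IntegrableOn (fun t => θ t • g t) (Set.Ioo 0 T) := by
    intro θ g hθ hcθ hg
    obtain ⟨C, hC⟩ := hθ.bounded_above_of_compact_support hcθ
    exact hg.bdd_smul C hθ.aestronglyMeasurable (ae_of_all _ hC)
  have hd := hη1.continuous_deriv le_rfl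
  simp only [smul_sub]
  rw [integral_sub (key hd hc.deriv H.1) (key hd hc.deriv H'.1),
    integral_sub (key hη.continuous hc H.2.1) (key hη.continuous hc H'.2.1),
    H.2.2 η hη hc hs, H'.2.2 η hη hc hs]
  ring

/-! ### Smooth steps and the fundamental theorem for distributional derivatives -/

theorem hasCompactSupport_deriv_smoothTransition :
    HasCompactSupport (deriv Real.smoothTransition) := by
  refine HasCompactSupport.intro (isCompact_Icc (a := (0 : ℝ)) (b := 1)) fun x hx => ?_
  rw [Set.mem_Icc, not_and_or, not_le, not_le] at hx
  rcases hx with hx | hx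
  · have : Real.smoothTransition =ᶠ[𝓝 x] fun _ => 0 := by
      filter_upwards [eventually_lt_nhds hx] with y hy
      exact Real.smoothTransition.zero_of_nonpos hy.le
    rw [this.deriv_eq, deriv_const]
  · have : Real.smoothTransition =ᶠ[𝓝 x] fun _ => 1 := by
      filter_upwards [eventually_gt_nhds hx] with y hy
      exact Real.smoothTransition.one_of_one_le hy.le
    rw [this.deriv_eq, deriv_const]

theorem continuous_deriv_smoothTransition : Continuous (deriv Real.smoothTransition) :=
  (Real.smoothTransition.contDiff (n := 1)).continuous_deriv le_rfl

theorem integral_deriv_smoothTransition : ∫ x, deriv Real.smoothTransition x = 1 := by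
  have h := integral_of_hasDerivAt_of_tendsto (f := Real.smoothTransition)
    (f' := deriv Real.smoothTransition) (m := 0) (n := 1)
    (fun x => ((Real.smoothTransition.contDiff (n := 1)).differentiable (by simp) x).hasDerivAt)
    (continuous_deriv_smoothTransition.integrable_of_hasCompactSupport
      hasCompactSupport_deriv_smoothTransition) ?_ ?_
  · simpa using h
  · refine tendsto_const_nhds.congr' ?_
    filter_upwards [eventually_le_atBot (0 : ℝ)] with y hy
    exact (Real.smoothTransition.zero_of_nonpos hy).symm
  · refine tendsto_const_nhds.congr' ?_
    filter_upwards [eventually_ge_atTop (1 : ℝ)] with y hy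
    exact (Real.smoothTransition.one_of_one_le hy).symm

/-- A smooth approximation, as `k → ∞`, of the Heaviside function with its jump at `a`. -/
def smoothStep (a k : ℝ) (x : ℝ) : ℝ := Real.smoothTransition (k * (x - a))

theorem smoothStep_contDiff (a k : ℝ) : ContDiff ℝ ∞ (smoothStep a k) :=
  Real.smoothTransition.contDiff.comp (contDiff_const.mul (contDiff_id.sub contDiff_const))

theorem deriv_smoothStep (a k x : ℝ) :
    deriv (smoothStep a k) x = k * deriv Real.smoothTransition (k * (x - a)) := by
  have h1 : HasDerivAt Real.smoothTransition (deriv Real.smoothTransition (k * (x - a)))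
      (k * (x - a)) :=
    ((Real.smoothTransition.contDiff (n := 1)).differentiable (by simp) _).hasDerivAt
  have h2 : HasDerivAt (fun x => k * (x - a)) (k * 1) x :=
    ((hasDerivAt_id x).sub_const a).const_mul k
  have := (h1.comp x h2).deriv
  rw [mul_one, mul_comm] at this
  exact this

theorem tendsto_smoothStep (a x : ℝ) :
    Tendsto (fun k : ℕ => smoothStep a k x) atTop (𝓝 (if a < x then 1 else 0)) := by
  split_ifs with h
  · refine tendsto_const_nhds.congr' ?_
    have : Tendsto (fun k : ℕ => (k : ℝ) * (x - a)) atTop atTop :=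
      tendsto_natCast_atTop_atTop.atTop_mul_const (sub_pos.2 h)
    filter_upwards [this.eventually_ge_atTop 1] with k hk
    exact (Real.smoothTransition.one_of_one_le hk).symm
  · refine tendsto_const_nhds.congr fun k => ?_
    refine (Real.smoothTransition.zero_of_nonpos ?_).symm
    exact mul_nonpos_of_nonneg_of_nonpos (Nat.cast_nonneg k) (by linarith)

/-- The derivative of the step is a bump of mass one rescaled to `[a, a + 1/k]`, hence an
approximate identity at `a`. The substitution `r = k (x - a)` moves the dependence on `k` into the
argument of `f`, where dominated convergence applies. -/
theorem tendsto_integral_deriv_smoothStep {f : ℝ → 𝕜} (hf : Continuous f) {C : ℝ}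
    (hC : ∀ x, ‖f x‖ ≤ C) (a : ℝ) :
    Tendsto (fun k : ℕ => ∫ x, deriv (smoothStep a k) x • f x) atTop (𝓝 (f a)) := by
  have h1 : ∀ᶠ k : ℕ in atTop, ∫ r, deriv Real.smoothTransition r • f (a + r / k) =
      ∫ x, deriv (smoothStep a k) x • f x := by
    filter_upwards [eventually_gt_atTop 0] with k hk
    have hk' : (0 : ℝ) < k := Nat.cast_pos.2 hk
    -- The unsimplified `k * r / k` exhibits the integrand as a function of `k * r`. A translation
    -- and a dilation can then be applied in turn, the prefactor `k` cancelling the Jacobian.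
    have e : ∀ x, deriv (smoothStep a k) x • f x = (k : ℝ) •
        (fun r => deriv Real.smoothTransition (k * r) • f (a + k * r / k)) (x - a) := by
      intro x
      simp only [deriv_smoothStep, smul_smul]
      congr 2
      field_simp
      ring
    simp_rw [e]
    rw [integral_smul, integral_sub_right_eq_self
      (fun r => deriv Real.smoothTransition (k * r) • f (a + k * r / k)),
      Measure.integral_comp_mul_left (fun r => deriv Real.smoothTransition r • f (a + r / k)),
      smul_smul, abs_of_pos (inv_pos.2 hk'), mul_inv_cancel₀ hk'.ne', one_smul]
  refine Tendsto.congr' h1 ?_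
  have h2 : f a = ∫ r, deriv Real.smoothTransition r • f a := by
    rw [integral_smul_const, integral_deriv_smoothTransition, one_smul]
  rw [h2]
  have hci := continuous_deriv_smoothTransition.integrable_of_hasCompactSupport
      hasCompactSupport_deriv_smoothTransition (μ := volume)
  refine tendsto_integral_of_dominated_convergence
    (fun r => ‖deriv Real.smoothTransition r‖ * C) ?_ (hci.norm.mul_const C) ?_ ?_
  · intro k
    refine Continuous.aestronglyMeasurable ?_
    have := continuous_deriv_smoothTransition
    fun_prop
  · intro k
    refine ae_of_all _ fun r => ?_
    rw [norm_smul]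
    exact mul_le_mul_of_nonneg_left (hC _) (norm_nonneg _)
  · refine ae_of_all _ fun r => ?_
    refine Tendsto.const_smul ?_ _
    refine (hf.tendsto a).comp ?_
    have : Tendsto (fun k : ℕ => a + r / (k : ℝ)) atTop (𝓝 (a + 0)) :=
      tendsto_const_nhds.add (tendsto_const_div_atTop_nhds_zero_nat r)
    simpa using this

/-- The test functions are differences of smooth steps at `a` and `b`. They converge boundedly to
the indicator of `(a, b]`, while their derivatives converge to point evaluation at `a` minus that at
`b`. Both points must be interior for the supports to stay inside `(0, T)`. -/
theorem HasDistribDeriv.sub_eq_integral_of_mem_Ioo {T : ℝ} {f h : ℝ → 𝕜}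
    (H : HasDistribDeriv T f h) (hf : ContinuousOn f (Set.Icc 0 T)) {a b : ℝ} (ha : 0 < a)
    (hab : a < b) (hb : b < T) : f b - f a = ∫ t in a..b, h t := by
  have hT : (0 : ℝ) ≤ T := by linarith
  set F : ℝ → 𝕜 := Set.IccExtend hT (Set.domRestrict (Set.Icc 0 T) f) with hF
  have hFc : Continuous F := (continuousOn_iff_continuous_domRestrict.1 hf).Icc_extend'
  have hFf : ∀ x ∈ Set.Icc 0 T, F x = f x := fun x hx => by
    rw [hF, Set.IccExtend_of_mem _ _ hx]; rfl
  obtain ⟨C, hC⟩ := (isCompact_Icc (a := (0 : ℝ)) (b := T)).exists_bound_of_continuousOn hf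
  have hFC : ∀ x, ‖F x‖ ≤ C := fun x => hC _ (Set.projIcc 0 T hT x).2
  let η : ℕ → ℝ → ℝ := fun k x => smoothStep a k x - smoothStep b k x
  have hηs : ∀ k, ContDiff ℝ ∞ (η k) := fun k =>
    (smoothStep_contDiff a k).sub (smoothStep_contDiff b k)
  have hηd : ∀ k x, deriv (η k) x = deriv (smoothStep a k) x - deriv (smoothStep b k) x := by
    intro k x
    exact deriv_fun_sub ((smoothStep_contDiff a k).differentiable (by simp) x)
      ((smoothStep_contDiff b k).differentiable (by simp) x)
  -- The step at `b` is complete only at `b + 1/k`, so some room `δ` is left before `T`.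
  obtain ⟨δ, hδ, hδT⟩ : ∃ δ > 0, b + δ < T := ⟨(T - b) / 2, by linarith, by linarith⟩
  have hsupp : ∀ᶠ k : ℕ in atTop, tsupport (η k) ⊆ Set.Icc a (b + δ) := by
    have : Tendsto (fun k : ℕ => (k : ℝ) * δ) atTop atTop :=
      tendsto_natCast_atTop_atTop.atTop_mul_const hδ
    filter_upwards [this.eventually_ge_atTop 1] with k hk
    refine closure_minimal (fun x hx => ?_) isClosed_Icc
    by_contra hx'
    rw [Set.mem_Icc, not_and_or, not_le, not_le] at hx'
    refine hx ?_
    have hk0 : (0 : ℝ) ≤ k := Nat.cast_nonneg k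
    rcases hx' with hx' | hx'
    · simp only [η, smoothStep]
      rw [Real.smoothTransition.zero_of_nonpos (mul_nonpos_of_nonneg_of_nonpos hk0 (by linarith)),
        Real.smoothTransition.zero_of_nonpos (mul_nonpos_of_nonneg_of_nonpos hk0 (by linarith)),
        sub_zero]
    · simp only [η, smoothStep]
      rw [Real.smoothTransition.one_of_one_le
        (hk.trans (mul_le_mul_of_nonneg_left (by linarith) hk0)),
        Real.smoothTransition.one_of_one_le
        (hk.trans (mul_le_mul_of_nonneg_left (by linarith) hk0)), sub_self]
  have L1 : Tendsto (fun k : ℕ => ∫ x, deriv (η k) x • F x) atTop (𝓝 (f a - f b)) := by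
    have := (tendsto_integral_deriv_smoothStep hFc hFC a).sub
      (tendsto_integral_deriv_smoothStep hFc hFC b)
    rw [hFf a ⟨ha.le, by linarith⟩, hFf b ⟨by linarith, hb.le⟩] at this
    refine this.congr' ?_
    filter_upwards [eventually_gt_atTop 0] with k hk
    have hint : ∀ c, Integrable fun x => deriv (smoothStep c k) x • F x := by
      intro c
      have hcs : HasCompactSupport (deriv (smoothStep c k)) := by
        refine HasCompactSupport.intro (isCompact_Icc (a := c) (b := c + 1)) fun x hx => ?_
        rw [deriv_smoothStep]
        have hk1 : (1 : ℝ) ≤ k := Nat.one_le_cast.2 hk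
        rw [Set.mem_Icc, not_and_or, not_le, not_le] at hx
        rcases hx with hx | hx
        · have : Real.smoothTransition =ᶠ[𝓝 (k * (x - c))] fun _ => 0 := by
            have : (k : ℝ) * (x - c) < 0 := mul_neg_of_pos_of_neg (by linarith) (by linarith)
            filter_upwards [eventually_lt_nhds this] with y hy
            exact Real.smoothTransition.zero_of_nonpos hy.le
          rw [this.deriv_eq, deriv_const, mul_zero]
        · have : Real.smoothTransition =ᶠ[𝓝 (k * (x - c))] fun _ => 1 := by
            have : 1 < (k : ℝ) * (x - c) := by nlinarith
            filter_upwards [eventually_gt_nhds this] with y hy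
            exact Real.smoothTransition.one_of_one_le hy.le
          rw [this.deriv_eq, deriv_const, mul_zero]
      exact ((((smoothStep_contDiff c k).of_le (m := 1) (by simp)).continuous_deriv le_rfl).smul
        hFc).integrable_of_hasCompactSupport hcs.smul_right
    rw [← integral_sub (hint a) (hint b)]
    simp only [hηd, sub_smul]
  have L2 : Tendsto (fun k : ℕ => ∫ x in Set.Ioo 0 T, η k x • h x) atTop
      (𝓝 (∫ x in Set.Ioo 0 T, (Set.Ioc a b).indicator h x)) := by
    refine tendsto_integral_of_dominated_convergence (fun x => ‖h x‖) ?_ H.2.1.norm ?_ ?_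
    · exact fun k => (hηs k).continuous.aestronglyMeasurable.smul H.2.1.1
    · refine fun k => ae_of_all _ fun x => ?_
      rw [norm_smul]
      refine mul_le_of_le_one_left (norm_nonneg _) ?_
      rw [Real.norm_eq_abs, abs_le]
      have := Real.smoothTransition.nonneg (k * (x - a))
      have := Real.smoothTransition.nonneg (k * (x - b))
      have := Real.smoothTransition.le_one (k * (x - a))
      have := Real.smoothTransition.le_one (k * (x - b))
      simp only [η, smoothStep]
      constructor <;> linarith
    · refine ae_of_all _ fun x => ?_
      have := ((tendsto_smoothStep a x).sub (tendsto_smoothStep b x)).smul_const (h x)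
      convert this using 2
      by_cases h1 : a < x <;> by_cases h2 : b < x
      · simp [Set.indicator, h1, h2]
      · simp [Set.indicator, h1, h2, not_lt.1 h2]
      · linarith
      · simp [Set.indicator, h1, h2]
  have L3 : ∀ᶠ k : ℕ in atTop, -∫ x in Set.Ioo 0 T, η k x • h x =
      ∫ x, deriv (η k) x • F x := by
    filter_upwards [hsupp] with k hk
    have hk' : tsupport (η k) ⊆ Set.Ioo 0 T :=
      hk.trans fun x hx => ⟨ha.trans_le hx.1, hx.2.trans_lt hδT⟩
    have hkc : HasCompactSupport (η k) := isCompact_Icc.of_isClosed_subset (isClosed_tsupport _) hk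
    rw [← H.2.2 (η k) (hηs k) hkc hk',
      ← setIntegral_Ioo_smul_eq_integral F ((tsupport_deriv_subset).trans hk')]
    refine setIntegral_congr_fun measurableSet_Ioo fun x hx => ?_
    simp only [hFf x (Set.Ioo_subset_Icc_self hx)]
  have L4 := tendsto_nhds_unique (L2.neg.congr' L3) L1
  have hsub : Set.Ioc a b ⊆ Set.Ioo 0 T := fun x hx => ⟨ha.trans hx.1, hx.2.trans_lt hb⟩
  rw [setIntegral_indicator measurableSet_Ioc, Set.inter_eq_self_of_subset_right hsub] at L4
  rw [intervalIntegral.integral_of_le hab.le, ← neg_sub (f a), ← L4, neg_neg]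

/-- The difference between `f` and the primitive of `h` is constant inside the interval and
continuous on its closure, so the formula extends to the endpoints. -/
theorem HasDistribDeriv.sub_eq_integral {T : ℝ} {f h : ℝ → 𝕜}
    (H : HasDistribDeriv T f h) (hf : ContinuousOn f (Set.Icc 0 T)) {t : ℝ}
    (ht : t ∈ Set.Icc 0 T) : f t - f 0 = ∫ s in (0 : ℝ)..t, h s := by
  rcases eq_or_lt_of_le (ht.1.trans ht.2) with hT | hT
  · have : t = 0 := le_antisymm (by linarith [ht.2]) ht.1
    simp [this]
  have hi : IntegrableOn h (Set.Icc 0 T) := (integrableOn_Icc_iff_integrableOn_Ioo (by simp) (by simp)).2 H.2.1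
  have hii : ∀ {a b}, a ∈ Set.Icc 0 T → b ∈ Set.Icc 0 T → IntervalIntegrable h volume a b := by
    intro a b ha hb
    exact (hi.mono_set ((Set.uIcc_subset_Icc ha hb))).intervalIntegrable
  set D : ℝ → 𝕜 := fun t => f t - ∫ s in (0 : ℝ)..t, h s with hD
  have h0 : (0 : ℝ) ∈ Set.Icc 0 T := ⟨le_rfl, hT.le⟩
  have hDc : ContinuousOn D (Set.Icc 0 T) := by
    refine hf.sub ?_
    have := intervalIntegral.continuousOn_primitive_interval (a := 0) (b := T) (f := h) (μ := volume)
    rw [Set.uIcc_of_le hT.le] at this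
    exact this hi
  have hm : T / 2 ∈ Set.Ioo 0 T := ⟨by linarith, by linarith⟩
  have hconst : ∀ {a b}, a ∈ Set.Ioo 0 T → b ∈ Set.Ioo 0 T → a < b → D b = D a := by
    intro a b ha hb hab
    have := H.sub_eq_integral_of_mem_Ioo hf ha.1 hab hb.2
    have e := intervalIntegral.integral_add_adjacent_intervals
      (hii h0 (Set.Ioo_subset_Icc_self ha))
      (hii (Set.Ioo_subset_Icc_self ha) (Set.Ioo_subset_Icc_self hb))
    simp only [hD]
    rw [← e, ← this]
    ring
  have hIoo : Set.EqOn D (fun _ => D (T / 2)) (Set.Ioo 0 T) := by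
    intro a ha
    rcases lt_trichotomy a (T / 2) with h | h | h
    · exact (hconst ha hm h).symm
    · rw [h]
    · exact hconst hm ha h
  have hIcc : Set.EqOn D (fun _ => D (T / 2)) (Set.Icc 0 T) := by
    have := hIoo.of_subset_closure hDc continuousOn_const Set.Ioo_subset_Icc_self
      (by rw [closure_Ioo hT.ne])
    exact this
  have := (hIcc ht).trans (hIcc h0).symm
  simp only [hD, intervalIntegral.integral_same, sub_zero] at this
  rw [← this]
  ring

end DistribDeriv

variable {𝕜 H U : Type*} [RCLike 𝕜]
  [NormedAddCommGroup H] [InnerProductSpace 𝕜 H] [CompleteSpace H]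
  [NormedAddCommGroup U] [InnerProductSpace 𝕜 U] [CompleteSpace U]

/-! ### Strongly continuous groups: continuity, bounds and integrals -/

theorem S_neg_apply_S (𝒮 : C0Group 𝕜 H) (t : ℝ) (x : H) : 𝒮.S (-t) (𝒮.S t x) = x := by
  rw [← ContinuousLinearMap.comp_apply, ← 𝒮.map_add, neg_add_cancel, 𝒮.map_zero]; rfl

theorem S_apply_S_neg (𝒮 : C0Group 𝕜 H) (t : ℝ) (x : H) : 𝒮.S t (𝒮.S (-t) x) = x := by
  rw [← ContinuousLinearMap.comp_apply, ← 𝒮.map_add, add_neg_cancel, 𝒮.map_zero]; rfl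

theorem S_add_apply (𝒮 : C0Group 𝕜 H) (t s : ℝ) (x : H) :
    𝒮.S (t + s) x = 𝒮.S t (𝒮.S s x) := by
  rw [𝒮.map_add]; rfl

theorem S_zero_apply (𝒮 : C0Group 𝕜 H) (x : H) : 𝒮.S 0 x = x := by
  rw [𝒮.map_zero]; rfl

theorem continuous_S_apply (𝒮 : C0Group 𝕜 H) (x : H) : Continuous fun t => 𝒮.S t x := by
  refine continuous_iff_continuousAt.2 fun t => ?_
  have h1 : Tendsto (fun s => s - t) (𝓝 t) (𝓝 0) := by
    simpa using (by fun_prop : Continuous fun s : ℝ => s - t).tendsto t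
  have h2 := ((𝒮.S t).continuous.tendsto x).comp ((𝒮.tendsto_zero x).comp h1)
  refine h2.congr fun s => ?_
  simp only [Function.comp]
  rw [← S_add_apply, add_sub_cancel]

/-- Orbits are continuous, hence bounded on compact time intervals, and Banach–Steinhaus makes the
bound uniform in the vector. -/
theorem exists_norm_S_le (𝒮 : C0Group 𝕜 H) (T : ℝ) :
    ∃ M : ℝ, 0 ≤ M ∧ ∀ t, |t| ≤ T → ‖𝒮.S t‖ ≤ M := by
  obtain ⟨M, hM⟩ := banach_steinhaus (g := fun t : Set.Icc (-T) T => 𝒮.S t) (fun x => by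
    obtain ⟨C, hC⟩ := (isCompact_Icc (a := -T) (b := T)).exists_bound_of_continuousOn
      (𝒮.continuous_S_apply x).continuousOn
    exact ⟨C, fun t => hC t t.2⟩)
  exact ⟨max M 0, le_max_right _ _, fun t ht => (hM ⟨t, abs_le.1 ht⟩).trans (le_max_left _ _)⟩

theorem continuous_S_uncurry (𝒮 : C0Group 𝕜 H) : Continuous fun p : ℝ × H => 𝒮.S p.1 p.2 := by
  refine continuous_iff_continuousAt.2 fun ⟨t, x⟩ => ?_
  obtain ⟨M, hM0, hM⟩ := 𝒮.exists_norm_S_le (|t| + 1)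
  rw [ContinuousAt, tendsto_iff_norm_sub_tendsto_zero]
  have h1 : Tendsto (fun p : ℝ × H => M * ‖p.2 - x‖ + ‖𝒮.S p.1 x - 𝒮.S t x‖) (𝓝 (t, x)) (𝓝 0) := by
    have : Continuous fun p : ℝ × H => M * ‖p.2 - x‖ + ‖𝒮.S p.1 x - 𝒮.S t x‖ := by
      have := (𝒮.continuous_S_apply x).comp (continuous_fst (X := ℝ) (Y := H))
      simp only [Function.comp_def] at this
      fun_prop
    simpa using this.tendsto (t, x)
  refine squeeze_zero' (Eventually.of_forall fun _ => norm_nonneg _) ?_ h1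
  have h2 : ∀ᶠ p : ℝ × H in 𝓝 (t, x), |p.1| < |t| + 1 :=
    (continuous_abs.comp continuous_fst).continuousAt.eventually_lt continuousAt_const (by simp)
  filter_upwards [h2] with p hp
  calc ‖𝒮.S p.1 p.2 - 𝒮.S t x‖ = ‖𝒮.S p.1 (p.2 - x) + (𝒮.S p.1 x - 𝒮.S t x)‖ := by
        simp only [_root_.map_sub]; abel_nf
    _ ≤ ‖𝒮.S p.1 (p.2 - x)‖ + ‖𝒮.S p.1 x - 𝒮.S t x‖ := norm_add_le _ _
    _ ≤ _ := by gcongr; exact (𝒮.S p.1).le_of_opNorm_le (hM _ hp.le) _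

theorem continuous_S {X : Type*} [TopologicalSpace X] (𝒮 : C0Group 𝕜 H) {f : X → ℝ} {g : X → H}
    (hf : Continuous f) (hg : Continuous g) : Continuous fun x => 𝒮.S (f x) (g x) :=
  𝒮.continuous_S_uncurry.comp (hf.prodMk hg)

section Real

variable [NormedSpace ℝ H] [IsScalarTower ℝ 𝕜 H]

theorem intervalIntegrable_S_apply (𝒮 : C0Group 𝕜 H) (x : H) (a b : ℝ) :
    IntervalIntegrable (fun s => 𝒮.S s x) volume a b :=
  (𝒮.continuous_S_apply x).intervalIntegrable a b

/-- The operator `x ↦ ∫₀ᵗ S(s) x ds`. -/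
def integ (𝒮 : C0Group 𝕜 H) (t : ℝ) : H →L[𝕜] H :=
  LinearMap.mkContinuousOfExistsBound
    { toFun x := ∫ s in (0 : ℝ)..t, 𝒮.S s x
      map_add' x y := by
        simp only [_root_.map_add]
        exact intervalIntegral.integral_add (𝒮.intervalIntegrable_S_apply x 0 t)
          (𝒮.intervalIntegrable_S_apply y 0 t)
      map_smul' c x := by
        simp only [map_smul, RingHom.id_apply]
        exact intervalIntegral.integral_smul _ _ } (by
    obtain ⟨M, hM0, hM⟩ := 𝒮.exists_norm_S_le |t|
    refine ⟨M * |t|, fun x => ?_⟩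
    have := intervalIntegral.norm_integral_le_of_norm_le_const (a := 0) (b := t)
      (f := fun s => 𝒮.S s x) (C := M * ‖x‖) (fun s hs => ?_)
    · refine this.trans (le_of_eq ?_)
      rw [sub_zero]; ring
    · refine (𝒮.S s).le_of_opNorm_le (hM s ?_) x
      rcases le_total 0 t with h | h
      · rw [Set.uIoc_of_le h] at hs
        rw [abs_of_pos hs.1, abs_of_nonneg h]; exact hs.2
      · rw [Set.uIoc_of_ge h] at hs
        rw [abs_of_nonpos hs.2, abs_of_nonpos h]; linarith [hs.1])

theorem integ_apply (𝒮 : C0Group 𝕜 H) (t : ℝ) (x : H) :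
    𝒮.integ t x = ∫ s in (0 : ℝ)..t, 𝒮.S s x := rfl

theorem hasDerivAt_integ (𝒮 : C0Group 𝕜 H) (t : ℝ) (x : H) :
    HasDerivAt (fun t => 𝒮.integ t x) (𝒮.S t x) t :=
  intervalIntegral.integral_hasDerivAt_right (𝒮.intervalIntegrable_S_apply x 0 t)
    ((𝒮.continuous_S_apply x).stronglyMeasurableAtFilter _ _) (𝒮.continuous_S_apply x).continuousAt

theorem integ_zero (𝒮 : C0Group 𝕜 H) (x : H) : 𝒮.integ 0 x = 0 := by
  simp [integ_apply]

theorem S_integ (𝒮 : C0Group 𝕜 H) (t ε : ℝ) (x : H) :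
    𝒮.S t (𝒮.integ ε x) = 𝒮.integ (t + ε) x - 𝒮.integ t x := by
  simp only [integ_apply]
  rw [intervalIntegral.integral_interval_sub_left (𝒮.intervalIntegrable_S_apply x 0 _)
    (𝒮.intervalIntegrable_S_apply x 0 _),
    ← (𝒮.S t).intervalIntegral_comp_comm (𝒮.intervalIntegrable_S_apply x 0 ε)]
  simp_rw [← S_add_apply]
  rw [intervalIntegral.integral_comp_add_left (fun s => 𝒮.S s x), add_zero]

theorem mem_generatorGraph_iff_hasDerivAt {𝒮 : C0Group 𝕜 H} {x z : H} :
    (x, z) ∈ 𝒮.generatorGraph ↔ HasDerivAt (fun t => 𝒮.S t x) z 0 := by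
  rw [mem_generatorGraph, hasDerivAt_iff_tendsto_slope_zero]
  refine iff_of_eq (congrArg (fun f => Tendsto f _ _) (funext fun t => ?_))
  rw [zero_add, S_zero_apply, RCLike.real_smul_eq_coe_smul (K := 𝕜)]

theorem hasDerivAt_S_apply {𝒮 : C0Group 𝕜 H} {x z : H} (h : (x, z) ∈ 𝒮.generatorGraph) (t : ℝ) :
    HasDerivAt (fun t => 𝒮.S t x) (𝒮.S t z) t := by
  rw [mem_generatorGraph_iff_hasDerivAt] at h
  have h1 : HasDerivAt (fun s => 𝒮.S (s - t) x) z t := by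
    have := HasDerivAt.scomp (h := fun s => s - t) t (by simpa using h)
      ((hasDerivAt_id t).sub_const t)
    simpa [Function.comp_def] using this
  rw [hasDerivAt_iff_tendsto_slope] at h1 ⊢
  refine (((𝒮.S t).continuous.tendsto z).comp h1).congr fun s => ?_
  simp only [Function.comp, slope, vsub_eq_sub, RCLike.real_smul_eq_coe_smul (K := 𝕜), map_smul,
    _root_.map_sub]
  rw [← S_add_apply, ← S_add_apply]
  simp

/-- By the group law, `S(t)` only shifts the interval of integration, so the orbit of an integral is
differentiable for every `x`. These integrals supply enough vectors of `D(A)`. -/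
theorem integ_mem_generatorGraph (𝒮 : C0Group 𝕜 H) (ε : ℝ) (x : H) :
    (𝒮.integ ε x, 𝒮.S ε x - x) ∈ 𝒮.generatorGraph := by
  rw [mem_generatorGraph_iff_hasDerivAt]
  have h1 : HasDerivAt (fun t => 𝒮.integ (t + ε) x) (𝒮.S ε x) 0 := by
    have := HasDerivAt.scomp (h := fun s => s + ε) 0 (by simpa using 𝒮.hasDerivAt_integ ε x)
      ((hasDerivAt_id (0 : ℝ)).add_const ε)
    simpa [Function.comp_def] using this
  have h2 := h1.sub (𝒮.hasDerivAt_integ 0 x)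
  rw [S_zero_apply] at h2
  refine h2.congr_of_eventuallyEq (Eventually.of_forall fun t => ?_)
  exact 𝒮.S_integ t ε x

theorem integ_eq_of_mem_generatorGraph {𝒮 : C0Group 𝕜 H} {x z : H}
    (h : (x, z) ∈ 𝒮.generatorGraph) (t : ℝ) : 𝒮.integ t z = 𝒮.S t x - x := by
  rw [integ_apply, intervalIntegral.integral_eq_sub_of_hasDerivAt
    (fun s _ => hasDerivAt_S_apply h s) (𝒮.intervalIntegrable_S_apply z 0 t), S_zero_apply]

theorem tendsto_inv_smul_integ (𝒮 : C0Group 𝕜 H) (x : H) :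
    Tendsto (fun ε : ℝ => (ε⁻¹ : ℝ) • 𝒮.integ ε x) (𝓝[≠] 0) (𝓝 x) := by
  have := 𝒮.hasDerivAt_integ 0 x
  rw [hasDerivAt_iff_tendsto_slope_zero, S_zero_apply] at this
  refine this.congr fun t => ?_
  rw [zero_add, integ_zero, sub_zero]

theorem dense_generator_domain (𝒮 : C0Group 𝕜 H) : Dense (𝒮.generator.domain : Set H) := by
  intro x
  refine mem_closure_of_tendsto (𝒮.tendsto_inv_smul_integ x) (Eventually.of_forall fun ε => ?_)
  rw [RCLike.real_smul_eq_coe_smul (K := 𝕜)]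
  refine Submodule.smul_mem _ _ ?_
  have := 𝒮.integ_mem_generatorGraph ε x
  rw [← generator_graph] at this
  exact LinearPMap.mem_domain_of_mem_graph this

/-! ### The adjoint group -/

theorem mem_adjoint_graph_iff {𝒮 : C0Group 𝕜 H} {z w : H} : (z, w) ∈ 𝒮.generator†.graph ↔
    ∀ x y : H, (x, y) ∈ 𝒮.generatorGraph → inner 𝕜 w x = inner 𝕜 z y := by
  have hd := 𝒮.dense_generator_domain
  constructor
  · intro h x y hxy
    rw [← generator_graph, LinearPMap.mem_graph_iff] at hxy
    rw [LinearPMap.mem_graph_iff] at h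
    obtain ⟨x', hx', hy'⟩ := hxy
    obtain ⟨z', hz', hw'⟩ := h
    simp only at hx' hy' hz' hw'
    rw [← hx', ← hy', ← hz', ← hw']
    exact LinearPMap.adjoint_isFormalAdjoint hd z' x'
  · intro h
    have h' : ∀ x : 𝒮.generator.domain, inner 𝕜 w (x : H) = inner 𝕜 z (𝒮.generator x) := by
      intro x
      refine h _ _ ?_
      rw [← generator_graph]
      exact LinearPMap.mem_graph _ x
    rw [LinearPMap.mem_graph_iff]
    exact ⟨⟨z, LinearPMap.mem_adjoint_domain_of_exists z ⟨w, h'⟩⟩, rfl,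
      LinearPMap.adjoint_apply_eq hd _ h'⟩

/-- The element of `D(A*)` given by a pair in the graph of `A*`. -/
def mkDAdj {𝒮 : C0Group 𝕜 H} (z w : H) (h : (z, w) ∈ 𝒮.generator†.graph) : 𝒮.DAdj :=
  ⟨WithLp.toLp 2 (z, w), h⟩

theorem inner_adj {𝒮 : C0Group 𝕜 H} (z : 𝒮.DAdj) {x y : H} (h : (x, y) ∈ 𝒮.generatorGraph) :
    inner 𝕜 (adj z) x = inner 𝕜 (incl z) y :=
  mem_adjoint_graph_iff.1 z.2 x y h

/-- This is dual to `∫₀^ε S(s) A x ds = S(ε) x - x`. The adjoint of the integral maps all of `H`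
into `D(A*)`, which is the source of every regularisation below. -/
theorem adjoint_integ_mem (𝒮 : C0Group 𝕜 H) (ε : ℝ) (z : H) :
    ((𝒮.integ ε).adjoint z, (𝒮.S ε).adjoint z - z) ∈ 𝒮.generator†.graph := by
  rw [mem_adjoint_graph_iff]
  intro x y h
  rw [ContinuousLinearMap.adjoint_inner_left, integ_eq_of_mem_generatorGraph h, inner_sub_left,
    inner_sub_right, ContinuousLinearMap.adjoint_inner_left]

theorem adjoint_integ_adj {𝒮 : C0Group 𝕜 H} (t : ℝ) (z : 𝒮.DAdj) :
    (𝒮.integ t).adjoint (adj z) = (𝒮.S t).adjoint (incl z) - incl z := by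
  refine ext_inner_right 𝕜 fun x => ?_
  rw [ContinuousLinearMap.adjoint_inner_left, inner_adj z (𝒮.integ_mem_generatorGraph t x),
    inner_sub_left, inner_sub_right, ContinuousLinearMap.adjoint_inner_left]

/-- The range of `D(A*)` in `H`. -/
def adjDomain (𝒮 : C0Group 𝕜 H) : Submodule 𝕜 H := 𝒮.generator†.domain

/-- A vector `z` orthogonal to `D(A*)` is orthogonal to each `∫₀^ε S(s) z ds`. Dividing by `ε` and
letting `ε → 0` gives `⟨z, z⟩ = 0`. -/
theorem dense_adjDomain (𝒮 : C0Group 𝕜 H) : Dense (𝒮.adjDomain : Set H) := by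
  rw [Submodule.dense_iff_topologicalClosure_eq_top, Submodule.topologicalClosure_eq_top_iff,
    Submodule.eq_bot_iff]
  intro z hz
  have h0 : ∀ ε, inner 𝕜 z (𝒮.integ ε z) = 0 := by
    intro ε
    rw [← ContinuousLinearMap.adjoint_inner_left]
    exact hz _ (LinearPMap.mem_domain_of_mem_graph (𝒮.adjoint_integ_mem ε z))
  have h1 := (Filter.Tendsto.inner (𝕜 := 𝕜) (tendsto_const_nhds (x := z))
    (𝒮.tendsto_inv_smul_integ z))
  have h2 : inner 𝕜 z z = 0 := by
    refine tendsto_nhds_unique h1 (tendsto_const_nhds.congr fun ε => ?_)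
    rw [RCLike.real_smul_eq_coe_smul (K := 𝕜), inner_smul_right, h0, mul_zero]
  exact inner_self_eq_zero.1 h2

theorem exists_incl_eq {𝒮 : C0Group 𝕜 H} {z : H} (hz : z ∈ 𝒮.adjDomain) :
    ∃ ζ : 𝒮.DAdj, incl ζ = z :=
  ⟨mkDAdj z _ (LinearPMap.mem_graph _ ⟨z, hz⟩), rfl⟩

theorem norm_S_le_of_norm_adjoint {𝒮 : C0Group 𝕜 H} {t M : ℝ} (h : ‖𝒮.S t‖ ≤ M) (x : H) :
    ‖(𝒮.S t).adjoint x‖ ≤ M * ‖x‖ :=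
  (𝒮.S t).adjoint.le_of_opNorm_le (by rwa [LinearIsometryEquiv.norm_map]) x

theorem norm_integ_le {𝒮 : C0Group 𝕜 H} {T M : ℝ} (hM0 : 0 ≤ M)
    (hM : ∀ t, |t| ≤ T → ‖𝒮.S t‖ ≤ M) {t : ℝ} (ht : |t| ≤ T) : ‖𝒮.integ t‖ ≤ M * |t| := by
  refine ContinuousLinearMap.opNorm_le_bound _ (by positivity) fun x => ?_
  have := intervalIntegral.norm_integral_le_of_norm_le_const (a := 0) (b := t)
      (f := fun s => 𝒮.S s x) (C := M * ‖x‖) (fun s hs => ?_)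
  · refine this.trans (le_of_eq ?_)
    rw [sub_zero]; ring
  · refine (𝒮.S s).le_of_opNorm_le (hM s (le_trans ?_ ht)) x
    rcases le_total 0 t with h | h
    · rw [Set.uIoc_of_le h] at hs
      rw [abs_of_pos hs.1, abs_of_nonneg h]; exact hs.2
    · rw [Set.uIoc_of_ge h] at hs
      rw [abs_of_nonpos hs.2, abs_of_nonpos h]; linarith [hs.1]

/-- On `D(A*)` the difference `S(t)* ζ - ζ` is the adjoint integral applied to `A* ζ`, hence of
order `t`. Density of `D(A*)` and the local bound on the norms extend the convergence to `H`. -/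
theorem tendsto_adjoint_S (𝒮 : C0Group 𝕜 H) (z : H) :
    Tendsto (fun t => (𝒮.S t).adjoint z) (𝓝 0) (𝓝 z) := by
  obtain ⟨M, hM0, hM⟩ := 𝒮.exists_norm_S_le 1
  rw [Metric.tendsto_nhds]
  intro δ hδ
  -- The approximation error enters once through `S(t)*` and once directly, with total factor `M +
  -- 1`; the radius makes this less than `δ / 2`.
  obtain ⟨w, hw, hzw⟩ := Metric.dense_iff.1 𝒮.dense_adjDomain z (δ / (2 * (M + 1))) (by positivity)
  obtain ⟨ζ, rfl⟩ := exists_incl_eq hzw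
  rw [Metric.mem_ball, dist_eq_norm, lt_div_iff₀ (by positivity)] at hw
  have h1 : ∀ᶠ t : ℝ in 𝓝 0, |t| < 1 :=
    continuous_abs.continuousAt.eventually_lt continuousAt_const (by simp)
  have h2 : ∀ᶠ t : ℝ in 𝓝 0, M * |t| * ‖adj ζ‖ < δ / 2 := by
    refine ContinuousAt.eventually_lt (by fun_prop) continuousAt_const ?_
    simpa using hδ
  filter_upwards [h1, h2] with t ht1 ht2
  rw [dist_eq_norm]
  have e : (𝒮.S t).adjoint z - z = (𝒮.S t).adjoint (z - incl ζ) + (𝒮.integ t).adjoint (adj ζ)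
      + (incl ζ - z) := by
    rw [adjoint_integ_adj, _root_.map_sub]; abel
  have b1 : ‖(𝒮.S t).adjoint (z - incl ζ)‖ ≤ M * ‖z - incl ζ‖ :=
    norm_S_le_of_norm_adjoint (hM t ht1.le) _
  have b2 : ‖(𝒮.integ t).adjoint (adj ζ)‖ ≤ M * |t| * ‖adj ζ‖ :=
    (𝒮.integ t).adjoint.le_of_opNorm_le
      (by rw [LinearIsometryEquiv.norm_map]; exact norm_integ_le hM0 hM ht1.le) _
  rw [norm_sub_rev z] at b1
  calc ‖(𝒮.S t).adjoint z - z‖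
      ≤ ‖(𝒮.S t).adjoint (z - incl ζ)‖ + ‖(𝒮.integ t).adjoint (adj ζ)‖ + ‖incl ζ - z‖ := by
        rw [e]; exact norm_add₃_le
    _ ≤ M * ‖incl ζ - z‖ + M * |t| * ‖adj ζ‖ + ‖incl ζ - z‖ := by gcongr
    _ < δ := by nlinarith

end Real

/-- The group `(S(-t)*)_{t ∈ ℝ}`. -/
def adjGroup (𝒮 : C0Group 𝕜 H) : C0Group 𝕜 H where
  S t := (𝒮.S (-t)).adjoint
  map_zero := by
    rw [neg_zero, 𝒮.map_zero]
    exact ContinuousLinearMap.adjoint_id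
  map_add t s := by
    rw [neg_add_rev, 𝒮.map_add, ContinuousLinearMap.adjoint_comp]
  tendsto_zero x := by
    letI : NormedSpace ℝ H := NormedSpace.restrictScalars ℝ 𝕜 H
    haveI : IsScalarTower ℝ 𝕜 H := IsScalarTower.restrictScalars ..
    have h : Tendsto (fun t : ℝ => -t) (𝓝 0) (𝓝 0) := by
      simpa using (continuous_neg (G := ℝ)).tendsto 0
    exact (𝒮.tendsto_adjoint_S x).comp h

theorem adjGroup_S (𝒮 : C0Group 𝕜 H) (t : ℝ) : 𝒮.adjGroup.S t = (𝒮.S (-t)).adjoint := rfl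

theorem adjoint_S (𝒮 : C0Group 𝕜 H) (t : ℝ) : (𝒮.S t).adjoint = 𝒮.adjGroup.S (-t) := by
  rw [adjGroup_S, neg_neg]

/-- The time reversal `(S(-t))_{t ∈ ℝ}`. -/
def reverse (𝒮 : C0Group 𝕜 H) : C0Group 𝕜 H where
  S t := 𝒮.S (-t)
  map_zero := by rw [neg_zero, 𝒮.map_zero]
  map_add t s := by rw [neg_add, 𝒮.map_add]
  tendsto_zero x := by
    have h : Tendsto (fun t : ℝ => -t) (𝓝 0) (𝓝 0) := by
      simpa using (continuous_neg (G := ℝ)).tendsto 0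
    exact (𝒮.tendsto_zero x).comp h

theorem reverse_S (𝒮 : C0Group 𝕜 H) (t : ℝ) : 𝒮.reverse.S t = 𝒮.S (-t) := rfl

/-! ### The Hilbert space `D(A*)` -/

section DAdj

variable {𝒮 : C0Group 𝕜 H}

theorem DAdj.isInducing : IsInducing fun z : 𝒮.DAdj => ((incl z, adj z) : H × H) :=
  (WithLp.homeomorphProd 2 H H).isInducing.comp IsInducing.subtypeVal

theorem continuous_incl : Continuous (incl : 𝒮.DAdj → H) :=
  continuous_fst.comp DAdj.isInducing.continuous

theorem continuous_adj : Continuous (adj : 𝒮.DAdj → H) :=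
  continuous_snd.comp DAdj.isInducing.continuous

theorem incl_injective : Function.Injective (incl : 𝒮.DAdj → H) := by
  intro z w h
  have : adj z = adj w := by
    rw [adj_eq, adj_eq]
    congr 1
    exact Subtype.ext h
  refine Subtype.ext (WithLp.ofLp_injective 2 (Prod.ext h this))

theorem incl_adjRestrict (t : ℝ) (z : 𝒮.DAdj) :
    incl (𝒮.adjRestrict t z) = 𝒮.adjGroup.S (-t) (incl z) := by
  rw [← adjoint_S]; rfl

theorem adj_adjRestrict (t : ℝ) (z : 𝒮.DAdj) :
    adj (𝒮.adjRestrict t z) = 𝒮.adjGroup.S (-t) (adj z) := by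
  rw [← adjoint_S]; rfl

theorem continuous_adjRestrict {X : Type*} [TopologicalSpace X] {f : X → ℝ} {g : X → 𝒮.DAdj}
    (hf : Continuous f) (hg : Continuous g) : Continuous fun x => 𝒮.adjRestrict (f x) (g x) := by
  rw [DAdj.isInducing.continuous_iff]
  simp only [Function.comp_def, incl_adjRestrict, adj_adjRestrict]
  exact (𝒮.adjGroup.continuous_S hf.neg (continuous_incl.comp hg)).prodMk
    (𝒮.adjGroup.continuous_S hf.neg (continuous_adj.comp hg))

/-- The inclusion `D(A*) ⊂ H` as a bounded operator. -/
def inclL (𝒮 : C0Group 𝕜 H) : 𝒮.DAdj →L[𝕜] H where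
  toFun := incl
  map_add' _ _ := rfl
  map_smul' _ _ := rfl
  cont := continuous_incl

theorem incl_sub (z w : 𝒮.DAdj) : incl (z - w) = incl z - incl w := _root_.map_sub 𝒮.inclL z w

/-- The adjoint `A*` is closed, so its graph is complete. Integrals of functions with values in
`D(A*)` rely on this. -/
instance : CompleteSpace 𝒮.DAdj := by
  letI : NormedSpace ℝ H := NormedSpace.restrictScalars ℝ 𝕜 H
  haveI : IsScalarTower ℝ 𝕜 H := IsScalarTower.restrictScalars ..
  have h : IsClosed (𝒮.adjGraph : Set (WithLp 2 (H × H))) := by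
    have := LinearPMap.adjoint_isClosed 𝒮.dense_generator_domain
    exact IsClosed.preimage (WithLp.homeomorphProd 2 H H).continuous this
  exact h.completeSpace_coe

/-- `B*` as a bounded operator. -/
def adjControlL (B : U →L[𝕜] 𝒮.DAdjDual) : 𝒮.DAdj →L[𝕜] U where
  toFun := adjControl B
  map_add' z w := by simp [adjControl]
  map_smul' c z := by
    rw [adjControl, adjControl, B.flip.map_smulₛₗ, LinearIsometryEquiv.map_smulₛₗ]
    simp
  cont := (InnerProductSpace.toDual 𝕜 U).symm.continuous.comp B.flip.continuous

theorem adjControlL_apply (B : U →L[𝕜] 𝒮.DAdjDual) (z : 𝒮.DAdj) :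
    adjControlL B z = adjControl B z := rfl

theorem continuous_adjControl (B : U →L[𝕜] 𝒮.DAdjDual) : Continuous (adjControl B) :=
  (adjControlL B).continuous

theorem adjControl_sub (B : U →L[𝕜] 𝒮.DAdjDual) (z w : 𝒮.DAdj) :
    adjControl B (z - w) = adjControl B z - adjControl B w := _root_.map_sub (adjControlL B) z w

end DAdj

/-! ### Regularisation by averages -/

section Real

variable [NormedSpace ℝ H] [IsScalarTower ℝ 𝕜 H] {𝒮 : C0Group 𝕜 H}

theorem adjoint_integ (t : ℝ) (z : H) :
    (𝒮.integ t).adjoint z = ∫ s in (0 : ℝ)..t, (𝒮.S s).adjoint z := by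
  have hc : Continuous fun s => (𝒮.S s).adjoint z := by
    simp only [adjoint_S]
    exact 𝒮.adjGroup.continuous_S continuous_neg continuous_const
  refine ext_inner_left 𝕜 fun x => ?_
  rw [ContinuousLinearMap.adjoint_inner_right, ← innerSL_apply_apply 𝕜 x,
    ← ContinuousLinearMap.intervalIntegral_comp_comm _ (hc.intervalIntegrable 0 t),
    ← inner_conj_symm, ← innerSL_apply_apply 𝕜 z, integ_apply,
    ← ContinuousLinearMap.intervalIntegral_comp_comm _ (𝒮.intervalIntegrable_S_apply x 0 t),
    ← RCLike.conjCLE_apply, ← ContinuousLinearEquiv.coe_coe,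
    ← ContinuousLinearMap.intervalIntegral_comp_comm]
  · refine intervalIntegral.integral_congr fun s _ => ?_
    simp [ContinuousLinearMap.adjoint_inner_right]
  · exact ((innerSL 𝕜 z).continuous.comp (𝒮.continuous_S_apply x)).intervalIntegrable 0 t

theorem hasDerivAt_adjoint_S_incl (z : 𝒮.DAdj) (t : ℝ) :
    HasDerivAt (fun t => (𝒮.S t).adjoint (incl z)) ((𝒮.S t).adjoint (adj z)) t := by
  have hc : Continuous fun s => (𝒮.S s).adjoint (adj z) := by
    simp only [adjoint_S]
    exact 𝒮.adjGroup.continuous_S continuous_neg continuous_const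
  have h1 : HasDerivAt (fun t => ∫ s in (0 : ℝ)..t, (𝒮.S s).adjoint (adj z))
      ((𝒮.S t).adjoint (adj z)) t :=
    intervalIntegral.integral_hasDerivAt_right (hc.intervalIntegrable 0 t)
      (hc.stronglyMeasurableAtFilter _ _) hc.continuousAt
  refine (h1.add_const (incl z)).congr_of_eventuallyEq (Eventually.of_forall fun s => ?_)
  simp only [← adjoint_integ, adjoint_integ_adj, sub_add_cancel]

/-- The average `ε⁻¹ ∫₀^ε S(s)* z ds` as an element of `D(A*)`. -/
def avg (𝒮 : C0Group 𝕜 H) (ε : ℝ) (z : H) : 𝒮.DAdj :=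
  ((ε⁻¹ : ℝ) : 𝕜) • mkDAdj _ _ (𝒮.adjoint_integ_mem ε z)

theorem incl_avg (ε : ℝ) (z : H) :
    incl (𝒮.avg ε z) = ((ε⁻¹ : ℝ) : 𝕜) • (𝒮.integ ε).adjoint z := rfl

theorem adj_avg (ε : ℝ) (z : H) :
    adj (𝒮.avg ε z) = ((ε⁻¹ : ℝ) : 𝕜) • ((𝒮.S ε).adjoint z - z) := rfl

/-- Continuity holds from `H` into the graph norm, because `A*` of the average is the bounded
expression `ε⁻¹ (S(ε)* z - z)`. -/
theorem continuous_avg (ε : ℝ) : Continuous (𝒮.avg ε) := by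
  rw [DAdj.isInducing.continuous_iff]
  simp only [Function.comp_def, incl_avg, adj_avg]
  fun_prop

theorem tendsto_incl_avg (z : H) :
    Tendsto (fun n : ℕ => incl (𝒮.avg ((n : ℝ) + 1)⁻¹ z)) atTop (𝓝 z) := by
  have h1 : Tendsto (fun n : ℕ => ((n : ℝ) + 1)⁻¹) atTop (𝓝[≠] 0) := by
    refine tendsto_nhdsWithin_iff.2 ⟨?_, Eventually.of_forall fun n => ?_⟩
    · simpa using tendsto_one_div_add_atTop_nhds_zero_nat (𝕜 := ℝ)
    · simp only [Set.mem_compl_iff, Set.mem_singleton_iff, inv_eq_zero]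
      positivity
  have hc : Continuous fun s => (𝒮.S s).adjoint z := by
    simp only [adjoint_S]
    exact 𝒮.adjGroup.continuous_S continuous_neg continuous_const
  have h2 : HasDerivAt (fun t => ∫ s in (0 : ℝ)..t, (𝒮.S s).adjoint z)
      ((𝒮.S 0).adjoint z) 0 :=
    intervalIntegral.integral_hasDerivAt_right (hc.intervalIntegrable 0 0)
      (hc.stronglyMeasurableAtFilter _ _) hc.continuousAt
  rw [hasDerivAt_iff_tendsto_slope_zero] at h2
  have h3 := h2.comp h1
  rw [adjoint_S, neg_zero, S_zero_apply] at h3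
  refine h3.congr fun n => ?_
  simp only [Function.comp, zero_add, intervalIntegral.integral_same, sub_zero, incl_avg,
    adjoint_integ, RCLike.real_smul_eq_coe_smul (K := 𝕜)]

theorem exists_norm_incl_avg_le (𝒮 : C0Group 𝕜 H) : ∃ M : ℝ, 0 ≤ M ∧ ∀ (n : ℕ) (z : H),
    ‖incl (𝒮.avg ((n : ℝ) + 1)⁻¹ z)‖ ≤ M * ‖z‖ := by
  obtain ⟨M, hM0, hM⟩ := 𝒮.exists_norm_S_le 1
  refine ⟨M, hM0, fun n z => ?_⟩
  have hn : (0 : ℝ) < ((n : ℝ) + 1)⁻¹ := by positivity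
  have hn1 : ((n : ℝ) + 1)⁻¹ ≤ 1 := inv_le_one_of_one_le₀ (by linarith [n.cast_nonneg (α := ℝ)])
  set ε := ((n : ℝ) + 1)⁻¹
  have h1 : ‖(𝒮.integ ε).adjoint z‖ ≤ M * |ε| * ‖z‖ :=
    (𝒮.integ ε).adjoint.le_of_opNorm_le
      (by rw [LinearIsometryEquiv.norm_map]
          exact norm_integ_le hM0 hM (by rwa [abs_of_pos hn])) _
  rw [incl_avg, norm_smul, RCLike.norm_ofReal, abs_of_pos (inv_pos.2 hn)]
  rw [abs_of_pos hn] at h1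
  calc ε⁻¹ * ‖(𝒮.integ ε).adjoint z‖ ≤ ε⁻¹ * (M * ε * ‖z‖) := by gcongr
    _ = M * ‖z‖ := by field_simp

end Real

theorem exists_continuous_eqOn_Icc {E : Type*} [TopologicalSpace E] {T : ℝ} (hT : 0 ≤ T)
    {f : ℝ → E} (hf : ContinuousOn f (Set.Icc 0 T)) :
    ∃ F : ℝ → E, Continuous F ∧ Set.EqOn F f (Set.Icc 0 T) := by
  refine ⟨Set.IccExtend hT (Set.domRestrict (Set.Icc 0 T) f),
    (continuousOn_iff_continuous_domRestrict.1 hf).Icc_extend', fun x hx => ?_⟩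
  rw [Set.IccExtend_of_mem _ _ hx]; rfl

section Real

variable [NormedSpace ℝ H] [IsScalarTower ℝ 𝕜 H]

/-! ### Uniqueness of weak solutions -/

/-- A weak solution `y` is differentiable only when tested against the domain, but its primitive `Y`
is differentiable in norm. Hence `⟨P(-t) p.1, Y(t)⟩` can be differentiated by the product rule; the
weak equation, applied to the transported pair in `Γ`, makes the derivative zero. So `Y` is
orthogonal to a dense set and vanishes, and the equation then gives `y = 0`. The form with `P` and
`Γ` covers both the state equation (graph of `A*`) and the costate equation (graph of `-A`). -/
theorem eq_zero_of_inner_eq_integral {P : C0Group 𝕜 H} {Γ : Set (H × H)}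
    (hΓ : Γ ⊆ P.generatorGraph) (hinv : ∀ t, ∀ p ∈ Γ, (P.S t p.1, P.S t p.2) ∈ Γ)
    (hd : Dense (Prod.fst '' Γ)) {T : ℝ} {y : ℝ → H} (hy : ContinuousOn y (Set.Icc 0 T))
    (h : ∀ p ∈ Γ, ∀ t ∈ Set.Icc 0 T, inner 𝕜 p.1 (y t) = ∫ s in (0 : ℝ)..t, inner 𝕜 p.2 (y s))
    {t : ℝ} (ht : t ∈ Set.Icc 0 T) : y t = 0 := by
  have hT : 0 ≤ T := ht.1.trans ht.2
  obtain ⟨ye, hyc, hye⟩ := exists_continuous_eqOn_Icc hT hy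
  let Y : ℝ → H := fun t => ∫ s in (0 : ℝ)..t, ye s
  have hYd : ∀ t, HasDerivAt Y (ye t) t := fun t =>
    intervalIntegral.integral_hasDerivAt_right (hyc.intervalIntegrable 0 t)
      (hyc.stronglyMeasurableAtFilter _ _) hyc.continuousAt
  have hpY : ∀ p ∈ Γ, ∀ t ∈ Set.Icc 0 T, inner 𝕜 p.1 (ye t) = inner 𝕜 p.2 (Y t) := by
    intro p hp t ht
    rw [hye ht, h p hp t ht, ← innerSL_apply_apply 𝕜 p.2 (Y t),
      ← ContinuousLinearMap.intervalIntegral_comp_comm _ (hyc.intervalIntegrable 0 t)]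
    refine intervalIntegral.integral_congr fun s hs => ?_
    rw [Set.uIcc_of_le ht.1] at hs
    simp only [innerSL_apply_apply, hye ⟨hs.1, hs.2.trans ht.2⟩]
  have hF : ∀ p ∈ Γ, ∀ t ∈ Set.Icc 0 T, inner 𝕜 (P.S (-t) p.1) (Y t) = 0 := by
    intro p hp
    have hd1 : ∀ t, HasDerivAt (fun t => P.S (-t) p.1) (-P.S (-t) p.2) t := fun t => by
      have := HasDerivAt.scomp (h := fun s : ℝ => -s) t (hasDerivAt_S_apply (hΓ hp) (-t))
        (hasDerivAt_neg t)
      simpa [Function.comp_def] using this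
    have hd2 : ∀ t, HasDerivAt (fun t => inner 𝕜 (P.S (-t) p.1) (Y t))
        (inner 𝕜 (P.S (-t) p.1) (ye t) + inner 𝕜 (-P.S (-t) p.2) (Y t)) t :=
      fun t => (hd1 t).inner 𝕜 (hYd t)
    intro t ht
    rw [constant_of_has_deriv_right_zero (a := 0) (b := T)
      (f := fun t => inner 𝕜 (P.S (-t) p.1) (Y t))
      (fun t _ => (hd2 t).continuousAt.continuousWithinAt) (fun t ht => ?_) t ht]
    · simp [Y]
    · have := hpY _ (hinv (-t) p hp) t (Set.Ico_subset_Icc_self ht)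
      have h2 := hd2 t
      simp only at this
      rw [this, inner_neg_left, add_neg_cancel] at h2
      exact h2.hasDerivWithinAt
  have hY0 : ∀ t ∈ Set.Icc 0 T, Y t = 0 := by
    intro t ht
    refine hd.eq_zero_of_inner_right 𝕜 ?_
    rintro _ ⟨p, hp, rfl⟩
    have := hF _ (hinv t p hp) t ht
    simpa only [S_neg_apply_S] using this
  rw [← hye ht]
  refine hd.eq_zero_of_inner_right 𝕜 ?_
  rintro _ ⟨p, hp, rfl⟩
  rw [hpY p hp t ht, hY0 t ht, inner_zero_right]

theorem IsWeakSol.eqOn {𝒮 : C0Group 𝕜 H} {B : U →L[𝕜] 𝒮.DAdjDual} {T : ℝ} {u u' : ℝ → U}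
    {y y' : ℝ → H} (hy : 𝒮.IsWeakSol B T u y) (hy' : 𝒮.IsWeakSol B T u' y')
    (hu : u =ᵐ[volume.restrict (Set.Ioo 0 T)] u') (h0 : y 0 = y' 0) :
    Set.EqOn y y' (Set.Icc 0 T) := by
  intro t ht
  rw [← sub_eq_zero]
  refine eq_zero_of_inner_eq_integral (P := 𝒮.adjGroup.reverse) (y := fun t => y t - y' t)
    (Γ := {p | p ∈ 𝒮.generator†.graph}) ?_ ?_ ?_ (hy.continuousOn.sub hy'.continuousOn) ?_ ht
  · rintro ⟨z, w⟩ hp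
    have := hasDerivAt_adjoint_S_incl (mkDAdj z w hp) 0
    refine mem_generatorGraph_iff_hasDerivAt.2 ?_
    simp only [adjoint_S, neg_zero, S_zero_apply] at this
    exact this
  · rintro t ⟨z, w⟩ hp
    rw [reverse_S, ← adjoint_S]
    exact 𝒮.adjoint_mem t (mkDAdj z w hp)
  · refine 𝒮.dense_adjDomain.mono fun z hz => ?_
    obtain ⟨ζ, rfl⟩ := exists_incl_eq hz
    exact ⟨(incl ζ, adj ζ), ζ.2, rfl⟩
  · rintro ⟨z, w⟩ hp t ht
    have h1 := (hy.eqn (mkDAdj z w hp)).sub_eq_integral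
      ((continuous_const.continuousOn (s := Set.Icc 0 T)).inner hy.continuousOn) ht
    have h2 := (hy'.eqn (mkDAdj z w hp)).sub_eq_integral
      ((continuous_const.continuousOn (s := Set.Icc 0 T)).inner hy'.continuousOn) ht
    have hi : ∀ {h : ℝ → 𝕜}, IntegrableOn h (Set.Ioo 0 T) → IntervalIntegrable h volume 0 t := by
      intro h hh
      rw [intervalIntegrable_iff_integrableOn_Ioo_of_le ht.1 (by simp) (by simp)]
      exact hh.mono_set (Set.Ioo_subset_Ioo_right ht.2)
    have hsub := congrArg₂ (· - ·) h1 h2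
    rw [← intervalIntegral.integral_sub (hi (hy.eqn _).2.1) (hi (hy'.eqn _).2.1), h0,
      sub_sub_sub_cancel_right, ← inner_sub_right] at hsub
    refine hsub.trans ?_
    rw [intervalIntegral.integral_of_le ht.1, intervalIntegral.integral_of_le ht.1,
      integral_Ioc_eq_integral_Ioo, integral_Ioc_eq_integral_Ioo]
    refine integral_congr_ae ?_
    filter_upwards [ae_restrict_of_ae_restrict_of_subset (Set.Ioo_subset_Ioo_right ht.2) hu]
      with s hs
    rw [hs, inner_sub_right]
    simp only [add_sub_add_right_eq_sub]
    rfl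

/-! ### Mild solutions of the adjoint equation -/

/-- The mild solution `S(-t)* (z₀ - ∫₀ᵗ S(s)* g(s) ds)` of `z' = - A* z - g`, `z(0) = z₀`. -/
def costate (𝒮 : C0Group 𝕜 H) (z₀ : H) (g : ℝ → H) (t : ℝ) : H :=
  𝒮.adjGroup.S t (z₀ - ∫ s in (0 : ℝ)..t, 𝒮.adjGroup.S (-s) (g s))

theorem costate_zero (𝒮 : C0Group 𝕜 H) (z₀ : H) (g : ℝ → H) : 𝒮.costate z₀ g 0 = z₀ := by
  simp [costate, S_zero_apply]

theorem hasDerivAt_costate_aux (𝒮 : C0Group 𝕜 H) (z₀ : H) {g : ℝ → H} (hg : Continuous g) (t : ℝ) :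
    HasDerivAt (fun t => z₀ - ∫ s in (0 : ℝ)..t, 𝒮.adjGroup.S (-s) (g s))
      (-𝒮.adjGroup.S (-t) (g t)) t := by
  have hc : Continuous fun s => 𝒮.adjGroup.S (-s) (g s) :=
    𝒮.adjGroup.continuous_S continuous_neg hg
  exact (intervalIntegral.integral_hasDerivAt_right (hc.intervalIntegrable 0 t)
    (hc.stronglyMeasurableAtFilter _ _) hc.continuousAt).const_sub z₀

theorem continuous_costate (𝒮 : C0Group 𝕜 H) (z₀ : H) {g : ℝ → H} (hg : Continuous g) :
    Continuous (𝒮.costate z₀ g) :=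
  𝒮.adjGroup.continuous_S continuous_id (continuous_iff_continuousAt.2 fun t =>
    (𝒮.hasDerivAt_costate_aux z₀ hg t).continuousAt)

theorem inner_adjGroup_S (𝒮 : C0Group 𝕜 H) (t : ℝ) (x z : H) :
    inner 𝕜 x (𝒮.adjGroup.S t z) = inner 𝕜 (𝒮.S (-t) x) z := by
  rw [adjGroup_S, ContinuousLinearMap.adjoint_inner_right]

/-- Moving the group onto the test vector leaves `⟨S(-t) x, w(t)⟩`, in which both factors are
differentiable since `x` lies in `D(A)`. -/
theorem hasDerivAt_inner_costate {𝒮 : C0Group 𝕜 H} (z₀ : H) {g : ℝ → H} (hg : Continuous g)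
    {x z : H} (h : (x, z) ∈ 𝒮.generatorGraph) (t : ℝ) :
    HasDerivAt (fun t => inner 𝕜 x (𝒮.costate z₀ g t))
      (-inner 𝕜 z (𝒮.costate z₀ g t) - inner 𝕜 x (g t)) t := by
  have hd1 : HasDerivAt (fun t => 𝒮.S (-t) x) (-𝒮.S (-t) z) t := by
    have := HasDerivAt.scomp (h := fun s : ℝ => -s) t (hasDerivAt_S_apply h (-t))
      (hasDerivAt_neg t)
    simpa [Function.comp_def] using this
  have := hd1.inner 𝕜 (𝒮.hasDerivAt_costate_aux z₀ hg t)
  simp only [costate, inner_adjGroup_S]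
  refine this.congr_deriv ?_
  rw [inner_neg_right, inner_neg_left, inner_adjGroup_S, neg_neg, S_apply_S_neg]
  ring

theorem mem_generatorGraph_of_domain {𝒮 : C0Group 𝕜 H} (φ : 𝒮.generator.domain) :
    ((φ : H), 𝒮.generator φ) ∈ 𝒮.generatorGraph := by
  rw [← generator_graph]
  exact LinearPMap.mem_graph _ φ

theorem isWeakSolAdj_costate (𝒮 : C0Group 𝕜 H) (T : ℝ) (z₀ : H) {g : ℝ → H} (hg : Continuous g) :
    𝒮.IsWeakSolAdj T g (𝒮.costate z₀ g) := by
  refine ⟨(𝒮.continuous_costate z₀ hg).continuousOn, fun φ => hasDistribDeriv_of_hasDerivAt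
    (hasDerivAt_inner_costate z₀ hg (mem_generatorGraph_of_domain φ)) ?_⟩
  have := 𝒮.continuous_costate z₀ hg
  fun_prop

/-- Weak solutions are mild. The continuous `g'` stands for an extension of `g` beyond `[0, T]`, so
that the mild formula is available on the whole line. -/
theorem IsWeakSolAdj.eq_costate {𝒮 : C0Group 𝕜 H} {T : ℝ} {g g' z : ℝ → H}
    (hz : 𝒮.IsWeakSolAdj T g z) (hg' : Continuous g') (hgg : Set.EqOn g g' (Set.Icc 0 T))
    {t : ℝ} (ht : t ∈ Set.Icc 0 T) : z t = 𝒮.costate (z 0) g' t := by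
  have hw := 𝒮.isWeakSolAdj_costate T (z 0) hg'
  rw [← sub_eq_zero]
  refine eq_zero_of_inner_eq_integral (P := 𝒮.reverse)
    (y := fun t => z t - 𝒮.costate (z 0) g' t)
    (Γ := {p | (p.1, -p.2) ∈ 𝒮.generatorGraph}) ?_ ?_ ?_ (hz.continuousOn.sub hw.continuousOn) ?_ ht
  · rintro ⟨x, w⟩ hp
    refine mem_generatorGraph_iff_hasDerivAt.2 ?_
    have := HasDerivAt.scomp (h := fun s : ℝ => -s) 0 (hasDerivAt_S_apply hp (-0))
      (hasDerivAt_neg 0)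
    simp only [neg_zero, S_zero_apply, Function.comp_def, smul_neg, neg_smul, one_smul,
      neg_neg] at this
    exact this
  · rintro t ⟨x, w⟩ hp
    rw [reverse_S]
    have hp' : (x, -w) ∈ 𝒮.generator.graph := by rw [generator_graph]; exact hp
    rw [LinearPMap.mem_graph_iff] at hp'
    obtain ⟨x', hx', hw'⟩ := hp'
    have := 𝒮.generator_comm (-t) x'
    simp only at hx' hw'
    rw [hx', hw', generator_graph, _root_.map_neg] at this
    exact this
  · refine 𝒮.dense_generator_domain.mono fun x hx => ?_
    refine ⟨(x, -𝒮.generator ⟨x, hx⟩), ?_, rfl⟩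
    simp only [Set.mem_ofPred_eq, neg_neg]
    exact mem_generatorGraph_of_domain ⟨x, hx⟩
  · rintro ⟨x, w⟩ hp t ht
    have hp' : (x, -w) ∈ 𝒮.generator.graph := by rw [generator_graph]; exact hp
    rw [LinearPMap.mem_graph_iff] at hp'
    obtain ⟨x', hx', hw'⟩ := hp'
    simp only at hx' hw'
    have h1 := ((hz.eqn x').sub (hw.eqn x')).sub_eq_integral
      (((continuous_const.continuousOn (s := Set.Icc 0 T)).inner hz.continuousOn).sub
      ((continuous_const.continuousOn (s := Set.Icc 0 T)).inner hw.continuousOn)) ht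
    rw [costate_zero, sub_self, sub_zero, ← inner_sub_right, hx'] at h1
    refine h1.trans (intervalIntegral.integral_congr fun s hs => ?_)
    rw [Set.uIcc_of_le ht.1] at hs
    simp only [hw', hgg ⟨hs.1, hs.2.trans ht.2⟩, inner_neg_left, inner_sub_right]
    ring

/-! ### Linear Volterra equations -/

section Volterra

variable {E : Type*} [NormedAddCommGroup E] [NormedSpace ℝ E] [CompleteSpace E]

/-- The Picard iterates `wₙ₊₁(t) = ∫₀ᵗ k(s) wₙ(s) ds`. -/
def volterraIter (k : ℝ → E → E) (w₀ : E) : ℕ → ℝ → E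
  | 0 => fun _ => w₀
  | n + 1 => fun t => ∫ s in (0 : ℝ)..t, k s (volterraIter k w₀ n s)

theorem continuous_volterraIter {k : ℝ → E → E} (hk : Continuous fun p : ℝ × E => k p.1 p.2)
    (w₀ : E) (n : ℕ) : Continuous (volterraIter k w₀ n) := by
  induction n with
  | zero => exact continuous_const
  | succ n ih =>
    have hc : Continuous fun s => k s (volterraIter k w₀ n s) :=
      hk.comp (continuous_id.prodMk ih)
    exact intervalIntegral.continuous_primitive (fun a b => hc.intervalIntegrable a b) 0

theorem norm_volterraIter_le {k : ℝ → E → E} (hk : Continuous fun p : ℝ × E => k p.1 p.2)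
    (w₀ : E) {T M : ℝ} (hM0 : 0 ≤ M) (hM : ∀ t x, |t| ≤ T → ‖k t x‖ ≤ M * ‖x‖) (n : ℕ) {t : ℝ}
    (ht : |t| ≤ T) : ‖volterraIter k w₀ n t‖ ≤ ‖w₀‖ * (M ^ n * |t| ^ n / n.factorial) := by
  induction n generalizing t with
  | zero => simp [volterraIter]
  | succ n ih =>
    have hc : Continuous fun s => k s (volterraIter k w₀ n s) :=
      hk.comp (continuous_id.prodMk (continuous_volterraIter hk w₀ n))
    have hsub : ∀ s ∈ Set.uIoc 0 t, |s| ≤ |t| := by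
      intro s hs
      rcases le_total 0 t with h | h
      · rw [Set.uIoc_of_le h] at hs
        rw [abs_of_pos hs.1, abs_of_nonneg h]; exact hs.2
      · rw [Set.uIoc_of_ge h] at hs
        rw [abs_of_nonpos hs.2, abs_of_nonpos h]; linarith [hs.1]
    calc ‖volterraIter k w₀ (n + 1) t‖
        ≤ ∫ s in Set.uIoc 0 t, ‖k s (volterraIter k w₀ n s)‖ :=
          intervalIntegral.norm_integral_le_integral_norm_uIoc
      _ ≤ ∫ s in Set.uIoc 0 t, (‖w₀‖ * M ^ (n + 1) / n.factorial) * |s - 0| ^ n := by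
          refine setIntegral_mono_on ?_ ?_ measurableSet_uIoc fun s hs => ?_
          · exact (hc.norm.intervalIntegrable 0 t).def'
          · exact ((by fun_prop : Continuous fun s : ℝ =>
              (‖w₀‖ * M ^ (n + 1) / n.factorial) * |s - 0| ^ n).intervalIntegrable 0 t).def'
          · have hs' := hsub s hs
            refine (hM s _ (hs'.trans ht)).trans ?_
            refine (mul_le_mul_of_nonneg_left (ih (hs'.trans ht)) hM0).trans (le_of_eq ?_)
            rw [sub_zero]; ring
      _ = ‖w₀‖ * (M ^ (n + 1) * |t| ^ (n + 1) / (n + 1).factorial) := by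
          rw [integral_const_mul, integral_pow_abs_sub_uIoc, sub_zero, Nat.factorial_succ]
          push_cast
          field_simp

/-- The iterates are the terms of the Neumann series, not its partial sums, so the solution is their
sum. The factorial bound gives locally uniform convergence and allows termwise integration. Joint
continuity of `(t, x) ↦ k t x` suffices, as strongly continuous groups are in general not norm
continuous. -/
theorem exists_volterra {k : ℝ → E →L[ℝ] E} (hk : Continuous fun p : ℝ × E => k p.1 p.2)
    (hb : ∀ T, ∃ M, 0 ≤ M ∧ ∀ t, |t| ≤ T → ‖k t‖ ≤ M) (w₀ : E) :
    ∃ w : ℝ → E, Continuous w ∧ ∀ t, w t = w₀ + ∫ s in (0 : ℝ)..t, k s (w s) := by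
  set f := volterraIter (fun t => k t) w₀ with hf
  have hbound : ∀ T, ∃ M, 0 ≤ M ∧ (∀ t x, |t| ≤ T → ‖k t x‖ ≤ M * ‖x‖) ∧
      ∀ n t, |t| ≤ T → ‖f n t‖ ≤ ‖w₀‖ * ((M * T) ^ n / n.factorial) := by
    intro T
    obtain ⟨M, hM0, hM⟩ := hb T
    have hM' : ∀ t x, |t| ≤ T → ‖k t x‖ ≤ M * ‖x‖ := fun t x ht => (k t).le_of_opNorm_le (hM t ht) x
    refine ⟨M, hM0, hM', fun n t ht => (norm_volterraIter_le hk w₀ hM0 hM' n ht).trans ?_⟩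
    rw [mul_pow]
    gcongr
  have hsum : ∀ c : ℝ, Summable fun n : ℕ => ‖w₀‖ * (c ^ n / n.factorial) := fun c =>
    (Real.summable_pow_div_factorial c).mul_left _
  have hfs : ∀ t, Summable fun n => f n t := by
    intro t
    obtain ⟨M, hM0, -, hM⟩ := hbound |t|
    exact Summable.of_norm_bounded (hsum _) fun n => hM n t le_rfl
  refine ⟨fun t => ∑' n, f n t, continuous_iff_continuousAt.2 fun t => ?_, fun t => ?_⟩
  · obtain ⟨M, hM0, -, hM⟩ := hbound (|t| + 1)
    have h1 : ContinuousOn (fun t => ∑' n, f n t) {s | |s| < |t| + 1} :=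
      continuousOn_tsum (fun n => (continuous_volterraIter hk w₀ n).continuousOn) (hsum _)
        fun n s hs => hM n s (le_of_lt hs)
    exact h1.continuousAt ((isOpen_lt continuous_abs continuous_const).mem_nhds (by simp))
  · beta_reduce
    rw [(hfs t).tsum_eq_zero_add]
    congr 1
    obtain ⟨M, hM0, hMk, hM⟩ := hbound |t|
    have hsub : ∀ s ∈ Set.uIoc 0 t, |s| ≤ |t| := by
      intro s hs
      rcases le_total 0 t with h | h
      · rw [Set.uIoc_of_le h] at hs
        rw [abs_of_pos hs.1, abs_of_nonneg h]; exact hs.2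
      · rw [Set.uIoc_of_ge h] at hs
        rw [abs_of_nonpos hs.2, abs_of_nonpos h]; linarith [hs.1]
    refine (intervalIntegral.hasSum_integral_of_dominated_convergence
      (F := fun n s => k s (f n s)) (fun n _ => M * (‖w₀‖ * ((M * |t|) ^ n / n.factorial)))
      (fun n => ?_) (fun n => ae_of_all _ fun s hs => ?_) (ae_of_all _ fun s _ => ?_) ?_
      (ae_of_all _ fun s _ => ?_)).tsum_eq
    · exact (hk.comp (continuous_id.prodMk
        (continuous_volterraIter hk w₀ n))).aestronglyMeasurable
    · exact (hMk s _ (hsub s hs)).trans (mul_le_mul_of_nonneg_left (hM n s (hsub s hs)) hM0)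
    · exact (hsum _).mul_left M
    · exact intervalIntegrable_const
    · exact (hfs s).hasSum.mapL (k s)

end Volterra

/-! ### The adjoint equation with a bounded perturbation -/

/-- In the unknown `w(t) = S(t)* z(t)` the group disappears from the principal part, leaving a
Volterra equation with kernel `-S(s)* K S(-s)*`. -/
theorem exists_costate_fixedPoint (𝒮 : C0Group 𝕜 H) (K : H →L[𝕜] H) (z₀ : H) :
    ∃ z : ℝ → H, Continuous z ∧ ∀ t, z t = 𝒮.costate z₀ (fun s => K (z s)) t := by
  let k : ℝ → H →L[ℝ] H := fun s =>
    -(((𝒮.adjGroup.S (-s)).comp (K.comp (𝒮.adjGroup.S s))).restrictScalars ℝ)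
  have hkc : Continuous fun p : ℝ × H => k p.1 p.2 :=
    (𝒮.adjGroup.continuous_S continuous_fst.neg
      (K.continuous.comp 𝒮.adjGroup.continuous_S_uncurry)).neg
  obtain ⟨w, hw, hwe⟩ := exists_volterra hkc (fun T => by
    obtain ⟨M, hM0, hM⟩ := 𝒮.adjGroup.exists_norm_S_le T
    refine ⟨M * (‖K‖ * M), by positivity, fun t ht => ?_⟩
    rw [norm_neg, ContinuousLinearMap.norm_restrictScalars]
    refine (ContinuousLinearMap.opNorm_comp_le _ _).trans ?_
    refine mul_le_mul (hM _ (by rwa [abs_neg])) ?_ (norm_nonneg _) hM0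
    refine (ContinuousLinearMap.opNorm_comp_le _ _).trans ?_
    exact mul_le_mul_of_nonneg_left (hM _ ht) (norm_nonneg _)) z₀
  refine ⟨fun t => 𝒮.adjGroup.S t (w t), 𝒮.adjGroup.continuous_S continuous_id hw, fun t => ?_⟩
  beta_reduce
  rw [costate, hwe t, sub_eq_add_neg, ← intervalIntegral.integral_neg]
  rfl

theorem IsWeakSolAdj.eqOn_of_fixedPoint {𝒮 : C0Group 𝕜 H} (K : H →L[𝕜] H) {T : ℝ} {z₀ : H}
    {z w : ℝ → H} (hwc : Continuous w) (hw : ∀ t, w t = 𝒮.costate z₀ (fun s => K (w s)) t)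
    (hz : 𝒮.IsWeakSolAdj T (fun s => K (z s)) z) (hz0 : z 0 = z₀) :
    Set.EqOn z w (Set.Icc 0 T) := by
  intro t ht
  have hT : 0 ≤ T := ht.1.trans ht.2
  obtain ⟨ze, hzc, hze⟩ := exists_continuous_eqOn_Icc hT hz.continuousOn
  have hg : Continuous fun s => K (ze s) := K.continuous.comp hzc
  have h1 : ∀ t ∈ Set.Icc 0 T, z t = 𝒮.costate z₀ (fun s => K (ze s)) t := fun t ht => by
    rw [← hz0]
    exact hz.eq_costate hg (fun s hs => by simp only [hze hs]) ht
  let d : ℝ → H := fun s => 𝒮.adjGroup.S (-s) (K (ze s - w s))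
  have hdc : Continuous d := 𝒮.adjGroup.continuous_S continuous_neg
    (K.continuous.comp (hzc.sub hwc))
  -- The difference `z - w` need not be differentiable. Its pullback by the group is `-e`, and `e`
  -- satisfies `‖e'‖ ≤ C ‖e‖` with `e(0) = 0`.
  let e : ℝ → H := fun t => ∫ s in (0 : ℝ)..t, d s
  have hed : ∀ t, HasDerivAt e (d t) t := fun t =>
    intervalIntegral.integral_hasDerivAt_right (hdc.intervalIntegrable 0 t)
      (hdc.stronglyMeasurableAtFilter _ _) hdc.continuousAt
  have h2 : ∀ t ∈ Set.Icc 0 T, z t - w t = -𝒮.adjGroup.S t (e t) := by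
    intro t ht
    have hc1 : Continuous fun s => 𝒮.adjGroup.S (-s) (K (ze s)) :=
      𝒮.adjGroup.continuous_S continuous_neg hg
    have hc2 : Continuous fun s => 𝒮.adjGroup.S (-s) (K (w s)) :=
      𝒮.adjGroup.continuous_S continuous_neg (K.continuous.comp hwc)
    have : e t = (∫ s in (0 : ℝ)..t, 𝒮.adjGroup.S (-s) (K (ze s))) -
        ∫ s in (0 : ℝ)..t, 𝒮.adjGroup.S (-s) (K (w s)) := by
      rw [← intervalIntegral.integral_sub (hc1.intervalIntegrable 0 t)
        (hc2.intervalIntegrable 0 t)]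
      simp only [e, d, _root_.map_sub]
    rw [h1 t ht, hw t, this, costate, costate, _root_.map_sub, _root_.map_sub, _root_.map_sub]
    abel
  obtain ⟨M, hM0, hM⟩ := 𝒮.adjGroup.exists_norm_S_le T
  have he0 : ∀ t ∈ Set.Icc 0 T, e t = 0 := by
    refine eq_zero_of_abs_deriv_le_mul_abs_self_of_eq_zero_right (K := M * (‖K‖ * M))
      (fun t _ => (hed t).continuousAt.continuousWithinAt)
      (fun t _ => (hed t).hasDerivWithinAt) (by simp [e]) fun t ht => ?_
    have htT : |t| ≤ T := by rw [abs_of_nonneg ht.1]; exact ht.2.le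
    have ht' := Set.Ico_subset_Icc_self ht
    simp only [d]
    rw [hze ht', h2 t ht']
    calc _ ≤ M * ‖K (-𝒮.adjGroup.S t (e t))‖ :=
          (𝒮.adjGroup.S (-t)).le_of_opNorm_le (hM _ (by rwa [abs_neg])) _
      _ ≤ M * (‖K‖ * (M * ‖e t‖)) := by
          refine mul_le_mul_of_nonneg_left ((K.le_opNorm _).trans ?_) hM0
          rw [norm_neg]
          exact mul_le_mul_of_nonneg_left ((𝒮.adjGroup.S t).le_of_opNorm_le (hM _ htT) _)
            (norm_nonneg _)
      _ = _ := by ring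
  have := h2 t ht
  rwa [he0 t ht, _root_.map_zero, neg_zero, sub_eq_zero] at this

end Real

/-! ### Facts on `L²(0, T)` -/

theorem memLp_of_continuous {E : Type*} [NormedAddCommGroup E] {f : ℝ → E} (hf : Continuous f)
    (p : ℝ≥0∞) (T : ℝ) : MemLp f p (volume.restrict (Set.Ioo 0 T)) := by
  obtain ⟨C, hC⟩ := (isCompact_Icc (a := (0 : ℝ)) (b := T)).exists_bound_of_continuousOn
    hf.continuousOn
  refine MemLp.of_bound hf.aestronglyMeasurable C ?_
  filter_upwards [ae_restrict_mem measurableSet_Ioo] with t ht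
  exact hC t (Set.Ioo_subset_Icc_self ht)

theorem ae_restrict_Ioo_of_eqOn_Icc {E : Type*} {f g : ℝ → E} {T : ℝ}
    (h : Set.EqOn f g (Set.Icc 0 T)) : f =ᵐ[volume.restrict (Set.Ioo 0 T)] g := by
  filter_upwards [ae_restrict_mem measurableSet_Ioo] with t ht
  exact h (Set.Ioo_subset_Icc_self ht)

theorem aestronglyMeasurable_restrict_Ioo {E : Type*} [NormedAddCommGroup E] {f : ℝ → E} {T : ℝ}
    (hf : ContinuousOn f (Set.Icc 0 T)) :
    AEStronglyMeasurable f (volume.restrict (Set.Ioo 0 T)) :=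
  (hf.mono Set.Ioo_subset_Icc_self).aestronglyMeasurable measurableSet_Ioo

theorem norm_integral_inner_le {α : Type*} [MeasurableSpace α] {ν : Measure α} {f g : α → U}
    (hf : MemLp f 2 ν) (hg : MemLp g 2 ν) :
    ‖∫ a, inner 𝕜 (f a) (g a) ∂ν‖ ≤ (eLpNorm f 2 ν).toReal * (eLpNorm g 2 ν).toReal := by
  have h : inner 𝕜 (hf.toLp f) (hg.toLp g) = ∫ a, inner 𝕜 (f a) (g a) ∂ν := by
    rw [L2.inner_def]
    refine integral_congr_ae ?_
    filter_upwards [hf.coeFn_toLp, hg.coeFn_toLp] with a h1 h2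
    rw [h1, h2]
  rw [← h, ← Lp.norm_toLp f hf, ← Lp.norm_toLp g hg]
  exact norm_inner_le_norm _ _

theorem integral_inner_self_eq {α : Type*} [MeasurableSpace α] {ν : Measure α} {f : α → U}
    (hf : MemLp f 2 ν) :
    RCLike.re (∫ a, inner 𝕜 (f a) (f a) ∂ν) = (eLpNorm f 2 ν).toReal ^ 2 := by
  have h : inner 𝕜 (hf.toLp f) (hf.toLp f) = ∫ a, inner 𝕜 (f a) (f a) ∂ν := by
    rw [L2.inner_def]
    refine integral_congr_ae ?_
    filter_upwards [hf.coeFn_toLp] with a h1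
    rw [h1]
  rw [← h, ← Lp.norm_toLp f hf]
  exact inner_self_eq_norm_sq _

theorem eLpNorm_comp_sub_left {E : Type*} [NormedAddCommGroup E] {f : ℝ → E} (hf : Continuous f)
    (p : ℝ≥0∞) (T : ℝ) : eLpNorm (fun s => f (T - s)) p (volume.restrict (Set.Ioo 0 T)) =
      eLpNorm f p (volume.restrict (Set.Ioo 0 T)) := by
  have h : MeasurePreserving (fun s : ℝ => T - s) (volume.restrict (Set.Ioo 0 T))
      (volume.restrict (Set.Ioo 0 T)) := by
    have h1 := (Measure.measurePreserving_sub_left volume T).restrict_preimage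
      (measurableSet_Ioo (a := (0 : ℝ)) (b := T))
    have h2 : (fun s : ℝ => T - s) ⁻¹' Set.Ioo 0 T = Set.Ioo 0 T := by
      ext s
      simp only [Set.mem_preimage, Set.mem_Ioo]
      constructor <;> rintro ⟨h1, h2⟩ <;> constructor <;> linarith
    rwa [h2] at h1
  exact eLpNorm_comp_measurePreserving hf.aestronglyMeasurable h

theorem integral_integral_triangle {E : Type*} [NormedAddCommGroup E] [NormedSpace ℝ E]
    {k : ℝ → ℝ → E} (hk : Continuous fun p : ℝ × ℝ => k p.1 p.2) {T : ℝ} (hT : 0 ≤ T) :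
    ∫ t in (0 : ℝ)..T, ∫ s in t..T, k t s = ∫ s in (0 : ℝ)..T, ∫ t in (0 : ℝ)..s, k t s := by
  set D : Set (ℝ × ℝ) := {p | p.1 < p.2} with hD
  have hDm : MeasurableSet D := measurableSet_lt measurable_fst measurable_snd
  set μ : Measure ℝ := volume.restrict (Set.Ioc 0 T) with hμ
  have hint : Integrable (D.indicator fun p => k p.1 p.2) (μ.prod μ) := by
    refine Integrable.indicator ?_ hDm
    rw [hμ, Measure.prod_restrict, ← Measure.volume_eq_prod]
    have := hk.continuousOn.integrableOn_compact
      ((isCompact_Icc (a := (0 : ℝ)) (b := T)).prod (isCompact_Icc (a := (0 : ℝ)) (b := T)))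
      (μ := volume)
    exact this.mono_set (Set.prod_mono Set.Ioc_subset_Icc_self Set.Ioc_subset_Icc_self)
  have hswap := integral_integral_swap (f := fun t s => D.indicator (fun p => k p.1 p.2) (t, s)) hint
  rw [intervalIntegral.integral_of_le hT, intervalIntegral.integral_of_le hT]
  have e1 : ∫ t, ∫ s, D.indicator (fun p => k p.1 p.2) (t, s) ∂μ ∂μ =
      ∫ t in Set.Ioc 0 T, ∫ s in t..T, k t s := by
    refine setIntegral_congr_fun measurableSet_Ioc fun t ht => ?_
    have : (fun s => D.indicator (fun p => k p.1 p.2) (t, s)) =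
        (Set.Ioi t).indicator fun s => k t s := by
      ext s; simp [Set.indicator, hD]
    simp only [this]
    rw [intervalIntegral.integral_of_le ht.2, hμ, setIntegral_indicator measurableSet_Ioi]
    congr 2
    ext s
    simp only [Set.mem_inter_iff, Set.mem_Ioc, Set.mem_Ioi]
    constructor
    · rintro ⟨⟨-, h2⟩, h3⟩; exact ⟨h3, h2⟩
    · rintro ⟨h1, h2⟩; exact ⟨⟨ht.1.trans h1, h2⟩, h1⟩
  have e2 : ∫ s, ∫ t, D.indicator (fun p => k p.1 p.2) (t, s) ∂μ ∂μ =
      ∫ s in Set.Ioc 0 T, ∫ t in (0 : ℝ)..s, k t s := by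
    refine setIntegral_congr_fun measurableSet_Ioc fun s hs => ?_
    have : (fun t => D.indicator (fun p => k p.1 p.2) (t, s)) =
        (Set.Iio s).indicator fun t => k t s := by
      ext t; simp [Set.indicator, hD]
    simp only [this]
    rw [intervalIntegral.integral_of_le hs.1.le, hμ, setIntegral_indicator measurableSet_Iio,
      integral_Ioc_eq_integral_Ioo]
    congr 2
    ext t
    simp only [Set.mem_inter_iff, Set.mem_Ioc, Set.mem_Iio, Set.mem_Ioo]
    constructor
    · rintro ⟨⟨h1, -⟩, h3⟩; exact ⟨h1, h3⟩
    · rintro ⟨h1, h2⟩; exact ⟨⟨h1, h2.le.trans hs.2⟩, h2⟩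
  rw [← e1, ← e2, hswap]

/-! ### Admissibility as a trace estimate -/

section

variable {𝒮 : C0Group 𝕜 H}

theorem adjRestrict_smul (t : ℝ) (c : 𝕜) (z : 𝒮.DAdj) :
    𝒮.adjRestrict t (c • z) = c • 𝒮.adjRestrict t z := by
  refine incl_injective ?_
  rw [incl_adjRestrict]
  change 𝒮.adjGroup.S (-t) (𝒮.inclL (c • z)) = 𝒮.inclL (c • 𝒮.adjRestrict t z)
  rw [map_smul, map_smul, map_smul]
  congr 1
  exact (incl_adjRestrict t z).symm

theorem continuous_adjControl_adjRestrict (B : U →L[𝕜] 𝒮.DAdjDual) (ψ : 𝒮.DAdj) :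
    Continuous fun r => adjControl B (𝒮.adjRestrict r ψ) :=
  (continuous_adjControl B).comp (continuous_adjRestrict continuous_id continuous_const)

/-- Admissibility gives, for each single `u`, a vector `φ(T)` of `H` with `∫ ⟨B* S(T - s)* ψ, u(s)⟩
ds = ⟨ψ, φ(T)⟩`. Thus the functionals on `L²` attached to the `ψ` of norm at most one in `H` are
pointwise bounded. Banach–Steinhaus bounds their norms uniformly, and homogeneity gives the estimate
for every `ψ`. -/
theorem Admissible.exists_eLpNorm_le {B : U →L[𝕜] 𝒮.DAdjDual} (hB : 𝒮.Admissible B) {T : ℝ}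
    (hT : 0 < T) : ∃ C : ℝ, 0 ≤ C ∧ ∀ ψ : 𝒮.DAdj,
      (eLpNorm (fun r => adjControl B (𝒮.adjRestrict r ψ)) 2
        (volume.restrict (Set.Ioo 0 T))).toReal ≤ C * ‖incl ψ‖ := by
  set μ : Measure ℝ := volume.restrict (Set.Ioo 0 T) with hμ
  let f : 𝒮.DAdj → ℝ → U := fun ψ s => adjControl B (𝒮.adjRestrict (T - s) ψ)
  have hfc : ∀ ψ, Continuous (f ψ) := fun ψ =>
    (continuous_adjControl_adjRestrict B ψ).comp (continuous_const.sub continuous_id)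
  have hf : ∀ ψ, MemLp (f ψ) 2 μ := fun ψ => memLp_of_continuous (hfc ψ) 2 T
  obtain ⟨C, hC⟩ := banach_steinhaus
    (g := fun ψ : {ψ : 𝒮.DAdj // ‖incl ψ‖ ≤ 1} => innerSL 𝕜 ((hf ψ).toLp (f ψ))) (fun u => by
      obtain ⟨φ, -, hφ⟩ := hB T hT u (Lp.memLp u)
      refine ⟨‖φ T‖, fun ψ => ?_⟩
      have h1 : inner 𝕜 ((hf ψ).toLp (f ψ)) u = inner 𝕜 (incl ψ.1) (φ T) := by
        rw [hφ T ⟨hT.le, le_rfl⟩ ψ, L2.inner_def, intervalIntegral.integral_of_le hT.le,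
          integral_Ioc_eq_integral_Ioo]
        refine integral_congr_ae ?_
        filter_upwards [(hf ψ).coeFn_toLp] with s hs
        rw [hs, inner_adjControl]
      rw [innerSL_apply_apply, h1]
      refine (norm_inner_le_norm _ _).trans ?_
      exact mul_le_of_le_one_left (norm_nonneg _) ψ.2)
  have hC' : ∀ ψ : 𝒮.DAdj, ‖incl ψ‖ ≤ 1 → (eLpNorm (f ψ) 2 μ).toReal ≤ C := by
    intro ψ hψ
    have := hC ⟨ψ, hψ⟩
    rwa [innerSL_apply_norm, Lp.norm_toLp] at this
  have hC0 : 0 ≤ C := ENNReal.toReal_nonneg.trans (hC' 0 (by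
    change ‖𝒮.inclL 0‖ ≤ 1
    simp))
  refine ⟨C, hC0, fun ψ => ?_⟩
  rw [← eLpNorm_comp_sub_left (continuous_adjControl_adjRestrict B ψ)]
  change (eLpNorm (f ψ) 2 μ).toReal ≤ _
  set n := ‖incl ψ‖ with hn
  -- If `n = 0` then `ψ = 0`, and the junk value `0⁻¹ = 0` does no harm.
  have hψ : ψ = (n : 𝕜) • ((n⁻¹ : ℝ) : 𝕜) • ψ := by
    rcases eq_or_ne n 0 with h0 | h0
    · have : ψ = 0 := incl_injective ((norm_eq_zero.1 h0).trans (_root_.map_zero 𝒮.inclL).symm)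
      simp [this]
    · rw [smul_smul, ← RCLike.ofReal_mul, mul_inv_cancel₀ h0, RCLike.ofReal_one, one_smul]
  have hle : ‖incl (((n⁻¹ : ℝ) : 𝕜) • ψ)‖ ≤ 1 := by
    change ‖𝒮.inclL (((n⁻¹ : ℝ) : 𝕜) • ψ)‖ ≤ 1
    rw [map_smul, norm_smul, RCLike.norm_ofReal, abs_of_nonneg (inv_nonneg.2 (norm_nonneg _))]
    exact inv_mul_le_one
  have hsm : f ψ = (n : 𝕜) • f (((n⁻¹ : ℝ) : 𝕜) • ψ) := by
    ext s
    conv_lhs => rw [hψ]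
    simp only [f, adjRestrict_smul, Pi.smul_apply]
    rw [← adjControlL_apply, map_smul, adjControlL_apply]
  rw [hsm, eLpNorm_const_smul, ENNReal.toReal_mul, mul_comm C, toReal_enorm, RCLike.norm_ofReal,
    abs_of_nonneg (norm_nonneg _)]
  exact mul_le_mul_of_nonneg_left (hC' _ hle) (norm_nonneg _)

theorem norm_integral_inner_adjControl_le {B : U →L[𝕜] 𝒮.DAdjDual} {T C : ℝ}
    (hC : ∀ ψ : 𝒮.DAdj, (eLpNorm (fun r => adjControl B (𝒮.adjRestrict r ψ)) 2
        (volume.restrict (Set.Ioo 0 T))).toReal ≤ C * ‖incl ψ‖) {u : ℝ → U} (hu : Continuous u)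
    {s : ℝ} (hs : s ∈ Set.Icc 0 T) (ψ : 𝒮.DAdj) :
    ‖∫ t in (0 : ℝ)..s, inner 𝕜 (u t) (adjControl B (𝒮.adjRestrict (s - t) ψ))‖ ≤
      (eLpNorm u 2 (volume.restrict (Set.Ioo 0 T))).toReal * (C * ‖incl ψ‖) := by
  have hb := continuous_adjControl_adjRestrict B ψ
  have hmono : volume.restrict (Set.Ioo 0 s) ≤ volume.restrict (Set.Ioo 0 T) :=
    Measure.restrict_mono (Set.Ioo_subset_Ioo_right hs.2) le_rfl
  rw [intervalIntegral.integral_of_le hs.1, integral_Ioc_eq_integral_Ioo]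
  refine (norm_integral_inner_le (memLp_of_continuous hu 2 s)
    (memLp_of_continuous (hb.comp (continuous_const.sub continuous_id)) 2 s)).trans ?_
  refine mul_le_mul ?_ ?_ ENNReal.toReal_nonneg ENNReal.toReal_nonneg
  · exact ENNReal.toReal_mono (memLp_of_continuous hu 2 T).2.ne (eLpNorm_mono_measure _ hmono)
  · change (eLpNorm (fun t => adjControl B (𝒮.adjRestrict (s - t) ψ)) 2 _).toReal ≤ _
    rw [eLpNorm_comp_sub_left hb 2 s]
    exact (ENNReal.toReal_mono (memLp_of_continuous hb 2 T).2.ne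
      (eLpNorm_mono_measure _ hmono)).trans (hC ψ)

/-! ### Trace estimates for the inhomogeneous adjoint equation -/

section Real

variable [NormedSpace ℝ H] [IsScalarTower ℝ 𝕜 H]

/-- This is Duhamel's formula run backwards from `T`. It is verified in `H` and holds in `D(A*)`
because the inclusion is injective. The integral being one in the graph norm, `B*` may be taken
inside. -/
theorem IsWeakSolAdj.eq_adjRestrict_add_integral {T : ℝ} {ζ γ : ℝ → 𝒮.DAdj}
    (hγ : Continuous γ)
    (hw : 𝒮.IsWeakSolAdj T (fun t => incl (γ t)) (fun t => incl (ζ t))) {t : ℝ}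
    (ht : t ∈ Set.Icc 0 T) :
    ζ t = 𝒮.adjRestrict (T - t) (ζ T) + ∫ s in t..T, 𝒮.adjRestrict (s - t) (γ s) := by
  have hT : (0 : ℝ) ≤ T := ht.1.trans ht.2
  have hg : Continuous fun t => incl (γ t) := continuous_incl.comp hγ
  have hc : Continuous fun s => 𝒮.adjGroup.S (-s) (incl (γ s)) :=
    𝒮.adjGroup.continuous_S continuous_neg hg
  have hc' : Continuous fun s => 𝒮.adjRestrict (s - t) (γ s) :=
    continuous_adjRestrict (continuous_id.sub continuous_const) hγ
  have h1 := hw.eq_costate hg (fun _ _ => rfl) ht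
  have h2 := hw.eq_costate hg (fun _ _ => rfl) (⟨hT, le_rfl⟩ : T ∈ Set.Icc 0 T)
  refine incl_injective ?_
  change _ = 𝒮.inclL (_ + _)
  rw [_root_.map_add, ← 𝒮.inclL.intervalIntegral_comp_comm (hc'.intervalIntegrable t T)]
  change _ = incl (𝒮.adjRestrict (T - t) (ζ T)) + ∫ s in t..T, incl (𝒮.adjRestrict (s - t) (γ s))
  simp only [incl_adjRestrict]
  rw [h1, h2, costate, costate, ← S_add_apply, neg_sub, sub_add_cancel]
  have e : ∀ s, 𝒮.adjGroup.S (-(s - t)) (incl (γ s)) =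
      𝒮.adjGroup.S t (𝒮.adjGroup.S (-s) (incl (γ s))) := by
    intro s
    rw [← S_add_apply]
    congr 2
    ring
  simp only [neg_sub] at e
  simp only [e, neg_sub]
  rw [(𝒮.adjGroup.S t).intervalIntegral_comp_comm (hc.intervalIntegrable t T), ← _root_.map_add]
  congr 1
  rw [← intervalIntegral.integral_add_adjacent_intervals (hc.intervalIntegrable 0 t)
    (hc.intervalIntegrable t T)]
  abel

/-- Let `u = B* ζ`, with `L²` norm `N`. In `N² = ∫ ⟨u, u⟩` the second factor is replaced by
Duhamel's formula. Exchanging the integrals over the triangle `t < s` leaves, for each `s`, a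
pairing of `u` with the trace of a homogeneous solution starting from `γ(s)`, bounded by `N C
‖γ(s)‖`. Dividing by `N` yields the estimate, in which `γ` enters only through its `L¹` norm in `H`.
-/
theorem eLpNorm_adjControl_le_of_continuous {B : U →L[𝕜] 𝒮.DAdjDual} {T C : ℝ} (hT : 0 ≤ T)
    (hC : ∀ ψ : 𝒮.DAdj, (eLpNorm (fun r => adjControl B (𝒮.adjRestrict r ψ)) 2
        (volume.restrict (Set.Ioo 0 T))).toReal ≤ C * ‖incl ψ‖) {ζ γ : ℝ → 𝒮.DAdj}
    (hζ : Continuous ζ) (hγ : Continuous γ)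
    (hw : 𝒮.IsWeakSolAdj T (fun t => incl (γ t)) (fun t => incl (ζ t))) :
    (eLpNorm (fun t => adjControl B (ζ t)) 2 (volume.restrict (Set.Ioo 0 T))).toReal ≤
      C * (‖incl (ζ T)‖ + ∫ s in (0 : ℝ)..T, ‖incl (γ s)‖) := by
  set u : ℝ → U := fun t => adjControl B (ζ t) with hu
  have huc : Continuous u := (continuous_adjControl B).comp hζ
  set N := (eLpNorm u 2 (volume.restrict (Set.Ioo 0 T))).toReal with hN
  have hN0 : 0 ≤ N := ENNReal.toReal_nonneg
  let k : ℝ → ℝ → 𝕜 := fun t s => inner 𝕜 (u t) (adjControl B (𝒮.adjRestrict (s - t) (γ s)))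
  have hk : Continuous fun p : ℝ × ℝ => k p.1 p.2 := by
    refine (huc.comp continuous_fst).inner ((continuous_adjControl B).comp
      (continuous_adjRestrict (continuous_snd.sub continuous_fst) (hγ.comp continuous_snd)))
  have hsplit : ∀ t ∈ Set.Icc 0 T, inner 𝕜 (u t) (u t) =
      inner 𝕜 (u t) (adjControl B (𝒮.adjRestrict (T - t) (ζ T))) + ∫ s in t..T, k t s := by
    intro t ht
    have hc' : Continuous fun s => 𝒮.adjRestrict (s - t) (γ s) :=
      continuous_adjRestrict (continuous_id.sub continuous_const) hγ
    have e1 : u t = adjControl B (𝒮.adjRestrict (T - t) (ζ T)) +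
        adjControlL B (∫ s in t..T, 𝒮.adjRestrict (s - t) (γ s)) := by
      conv_lhs => rw [hu]; simp only []; rw [hw.eq_adjRestrict_add_integral hγ ht]
      exact _root_.map_add (adjControlL B) _ _
    have e2 : inner 𝕜 (u t) (adjControlL B (∫ s in t..T, 𝒮.adjRestrict (s - t) (γ s))) =
        ∫ s in t..T, k t s :=
      (((innerSL 𝕜 (u t)).comp (adjControlL B)).intervalIntegral_comp_comm
        (hc'.intervalIntegrable t T)).symm
    rw [← e2, ← inner_add_right, ← e1]
  have hK : Continuous fun t => ∫ s in t..T, k t s := by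
    have h1 : ∀ t, ∫ s in t..T, k t s = -∫ s in T..t, k t s := fun t =>
      intervalIntegral.integral_symm _ _
    simp only [h1]
    exact (intervalIntegral.continuous_parametric_intervalIntegral_of_continuous hk
      continuous_id).neg
  have hmain : ∫ t in (0 : ℝ)..T, inner 𝕜 (u t) (u t) =
      (∫ t in (0 : ℝ)..T, inner 𝕜 (u t) (adjControl B (𝒮.adjRestrict (T - t) (ζ T)))) +
      ∫ s in (0 : ℝ)..T, ∫ t in (0 : ℝ)..s, k t s := by
    rw [← integral_integral_triangle hk hT, ← intervalIntegral.integral_add]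
    · refine intervalIntegral.integral_congr fun t ht => ?_
      rw [Set.uIcc_of_le hT] at ht
      exact hsplit t ht
    · refine Continuous.intervalIntegrable (huc.inner ?_) 0 T
      exact (continuous_adjControl_adjRestrict B _).comp (continuous_const.sub continuous_id)
    · exact hK.intervalIntegrable 0 T
  have hγn : Continuous fun s => ‖incl (γ s)‖ := (continuous_incl.comp hγ).norm
  have b1 := norm_integral_inner_adjControl_le hC huc (⟨hT, le_rfl⟩ : T ∈ Set.Icc 0 T) (ζ T)
  have b2 : ‖∫ s in (0 : ℝ)..T, ∫ t in (0 : ℝ)..s, k t s‖ ≤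
      ∫ s in (0 : ℝ)..T, N * (C * ‖incl (γ s)‖) := by
    refine intervalIntegral.norm_integral_le_of_norm_le hT (ae_of_all _ fun s hs => ?_)
      (((hγn.const_mul C).const_mul N).intervalIntegrable 0 T)
    exact norm_integral_inner_adjControl_le hC huc (Set.Ioc_subset_Icc_self hs) (γ s)
  have h3 : N ^ 2 ≤ N * (C * (‖incl (ζ T)‖ + ∫ s in (0 : ℝ)..T, ‖incl (γ s)‖)) := by
    rw [hN, ← integral_inner_self_eq (𝕜 := 𝕜) (memLp_of_continuous huc 2 T),
      ← integral_Ioc_eq_integral_Ioo, ← intervalIntegral.integral_of_le hT]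
    refine (RCLike.re_le_norm _).trans ?_
    rw [hmain]
    refine (norm_add_le _ _).trans ((add_le_add b1 b2).trans (le_of_eq ?_))
    rw [intervalIntegral.integral_const_mul, intervalIntegral.integral_const_mul]
    ring
  -- When `N = 0` the right side must be seen to be non-negative. The sign of `C` is not given, but
  -- each `C * ‖incl ψ‖` dominates a norm.
  rcases hN0.eq_or_lt with h | h
  · rw [← h]
    have hC0 : 0 ≤ C * ‖incl (ζ T)‖ := ENNReal.toReal_nonneg.trans (hC (ζ T))
    have hC1 : 0 ≤ C * ∫ s in (0 : ℝ)..T, ‖incl (γ s)‖ := by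
      rw [← intervalIntegral.integral_const_mul]
      exact intervalIntegral.integral_nonneg hT fun s _ => ENNReal.toReal_nonneg.trans (hC (γ s))
    rw [mul_add]
    exact add_nonneg hC0 hC1
  · rw [pow_two] at h3
    exact le_of_mul_le_mul_left h3 h

theorem Admissible.exists_eLpNorm_adjControl_le {B : U →L[𝕜] 𝒮.DAdjDual} (hB : 𝒮.Admissible B)
    {T : ℝ} (hT : 0 < T) : ∃ C : ℝ, ∀ ζ γ : ℝ → 𝒮.DAdj, ContinuousOn ζ (Set.Icc 0 T) →
      ContinuousOn γ (Set.Icc 0 T) →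
      𝒮.IsWeakSolAdj T (fun t => incl (γ t)) (fun t => incl (ζ t)) →
      eLpNorm (fun t => adjControl B (ζ t)) 2 (volume.restrict (Set.Ioo 0 T)) ≤
        ENNReal.ofReal C * (‖incl (ζ T)‖ₑ +
          eLpNorm (fun t => incl (γ t)) 1 (volume.restrict (Set.Ioo 0 T))) := by
  obtain ⟨C, hC0, hC⟩ := hB.exists_eLpNorm_le hT
  refine ⟨C, fun ζ γ hζ hγ hw => ?_⟩
  obtain ⟨ζe, hζc, hζe⟩ := exists_continuous_eqOn_Icc hT.le hζ
  obtain ⟨γe, hγc, hγe⟩ := exists_continuous_eqOn_Icc hT.le hγ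
  have hw' : 𝒮.IsWeakSolAdj T (fun t => incl (γe t)) (fun t => incl (ζe t)) := by
    refine ⟨(continuous_incl.comp hζc).continuousOn, fun φ => ?_⟩
    obtain ⟨h1, h2, h3⟩ := hw.eqn φ
    refine ⟨h1.congr_fun (fun t ht => ?_) measurableSet_Ioo,
      h2.congr_fun (fun t ht => ?_) measurableSet_Ioo, fun η hη hc hs => ?_⟩
    · simp only [hζe (Set.Ioo_subset_Icc_self ht)]
    · simp only [hζe (Set.Ioo_subset_Icc_self ht), hγe (Set.Ioo_subset_Icc_self ht)]
    · rw [setIntegral_congr_fun measurableSet_Ioo (g := fun t => deriv η t • inner 𝕜 (φ : H)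
        (incl (ζ t))) (fun t ht => by simp only [hζe (Set.Ioo_subset_Icc_self ht)]), h3 η hη hc hs]
      congr 1
      refine setIntegral_congr_fun measurableSet_Ioo fun t ht => ?_
      simp only [hζe (Set.Ioo_subset_Icc_self ht), hγe (Set.Ioo_subset_Icc_self ht)]
  have hest := eLpNorm_adjControl_le_of_continuous hT.le hC hζc hγc hw'
  have hζB := memLp_of_continuous ((continuous_adjControl B).comp hζc) 2 T
  have hγ1 := memLp_of_continuous (continuous_incl.comp hγc) 1 T
  rw [eLpNorm_congr_ae (ae_restrict_Ioo_of_eqOn_Icc fun t ht => by simp only [hζe ht] :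
      (fun t => adjControl B (ζ t)) =ᵐ[volume.restrict (Set.Ioo 0 T)] fun t => adjControl B (ζe t)),
    eLpNorm_congr_ae (ae_restrict_Ioo_of_eqOn_Icc fun t ht => by simp only [hγe ht] :
      (fun t => incl (γ t)) =ᵐ[volume.restrict (Set.Ioo 0 T)] fun t => incl (γe t)),
    ← hζe (⟨hT.le, le_rfl⟩ : T ∈ Set.Icc 0 T)]
  refine (ENNReal.ofReal_toReal hζB.2.ne).symm.le.trans ?_
  refine (ENNReal.ofReal_le_ofReal hest).trans (le_of_eq ?_)
  rw [ENNReal.ofReal_mul hC0, ENNReal.ofReal_add (norm_nonneg _)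
    (intervalIntegral.integral_nonneg hT.le fun _ _ => norm_nonneg _), ofReal_norm,
    intervalIntegral.integral_of_le hT.le, integral_Ioc_eq_integral_Ioo,
    eLpNorm_one_eq_lintegral_enorm, ofReal_integral_norm_eq_lintegral_enorm]
  exact memLp_one_iff_integrable.1 hγ1

/-! ### Uniqueness of the trace -/

theorem IsWeakSolAdj.sub {T : ℝ} {g g' z z' : ℝ → H} (h : 𝒮.IsWeakSolAdj T g z)
    (h' : 𝒮.IsWeakSolAdj T g' z') :
    𝒮.IsWeakSolAdj T (fun t => g t - g' t) (fun t => z t - z' t) := by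
  refine ⟨h.continuousOn.sub h'.continuousOn, fun φ => ?_⟩
  have := (h.eqn φ).sub (h'.eqn φ)
  simp only [inner_sub_right]
  convert this using 2
  ring

/-- The differences of two approximating sequences solve the adjoint equation with final values
tending to zero in `H` and sources tending to zero in `L¹`. By the trace estimate their images under
`B*` tend to zero in `L²`, so the two limits agree. -/
theorem IsAdjControlTrace.ae_eq {B : U →L[𝕜] 𝒮.DAdjDual} (hB : 𝒮.Admissible B) {T : ℝ}
    (hT : 0 < T) {g g' z z' : ℝ → H} {v v' : ℝ → U}
    (hg : AEStronglyMeasurable g (volume.restrict (Set.Ioo 0 T)))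
    (h : 𝒮.IsAdjControlTrace B T g z v) (h' : 𝒮.IsAdjControlTrace B T g' z' v')
    (hz : z T = z' T) (hgg : g =ᵐ[volume.restrict (Set.Ioo 0 T)] g') :
    v =ᵐ[volume.restrict (Set.Ioo 0 T)] v' := by
  set μ : Measure ℝ := volume.restrict (Set.Ioo 0 T) with hμ
  obtain ⟨C, hC⟩ := hB.exists_eLpNorm_adjControl_le hT
  obtain ⟨ζ, γ, hζ, hγ, hw, hζT, hγg, hv⟩ := h.approx
  obtain ⟨ζ', γ', hζ', hγ', hw', hζT', hγg', hv'⟩ := h'.approx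
  have hmγ := fun n => aestronglyMeasurable_restrict_Ioo (continuous_incl.comp_continuousOn (hγ n))
  have hmγ' := fun n => aestronglyMeasurable_restrict_Ioo (continuous_incl.comp_continuousOn (hγ' n))
  have hmζ := fun n => aestronglyMeasurable_restrict_Ioo ((continuous_adjControl B).comp_continuousOn (hζ n))
  have hmζ' := fun n => aestronglyMeasurable_restrict_Ioo ((continuous_adjControl B).comp_continuousOn (hζ' n))
  have hγlim : Tendsto (fun n => eLpNorm (fun t => incl (γ n t) - incl (γ' n t)) 1 μ) atTop
      (𝓝 0) := by
    have := hγg.add hγg'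
    rw [add_zero] at this
    refine tendsto_of_tendsto_of_tendsto_of_le_of_le tendsto_const_nhds this
      (fun _ => zero_le) fun n => ?_
    have e : (fun t => incl (γ n t) - incl (γ' n t)) =ᵐ[μ]
        (fun t => incl (γ n t) - g t) - fun t => incl (γ' n t) - g' t := by
      filter_upwards [hgg] with t ht
      simp [ht]
    rw [eLpNorm_congr_ae e]
    exact eLpNorm_sub_le ((hmγ n).sub hg) ((hmγ' n).sub (hg.congr hgg)) le_rfl
  have hζlim : Tendsto (fun n => ‖incl (ζ n T) - incl (ζ' n T)‖ₑ) atTop (𝓝 0) := by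
    have := (hζT.sub hζT').enorm
    rwa [hz, sub_self, enorm_zero] at this
  have hBlim : Tendsto (fun n => eLpNorm (fun t => adjControl B (ζ n t) - adjControl B (ζ' n t))
      2 μ) atTop (𝓝 0) := by
    have := ENNReal.Tendsto.const_mul (a := ENNReal.ofReal C) (hζlim.add hγlim)
      (Or.inr ENNReal.ofReal_ne_top)
    rw [add_zero, mul_zero] at this
    refine tendsto_of_tendsto_of_tendsto_of_le_of_le tendsto_const_nhds this
      (fun _ => zero_le) fun n => ?_
    have := hC (fun t => ζ n t - ζ' n t) (fun t => γ n t - γ' n t) ((hζ n).sub (hζ' n))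
      ((hγ n).sub (hγ' n)) (by simp only [incl_sub]; exact (hw n).sub (hw' n))
    simpa only [adjControl_sub, incl_sub] using this
  have hfin : eLpNorm (v - v') 2 μ ≤ 0 := by
    have h3 := (hv.add hBlim).add hv'
    rw [add_zero, add_zero] at h3
    refine ge_of_tendsto h3 (Eventually.of_forall fun n => ?_)
    have e : v - v' = (fun t => adjControl B (ζ n t) - adjControl B (ζ' n t)) -
        (fun t => adjControl B (ζ n t) - v t) + fun t => adjControl B (ζ' n t) - v' t := by
      ext t; simp
    rw [e, add_comm (eLpNorm (fun t => adjControl B (ζ n t) - v t) 2 μ)]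
    have m1 := (hmζ n).sub h.memLp.1
    have m2 := (hmζ n).sub (hmζ' n)
    have m3 := (hmζ' n).sub h'.memLp.1
    exact (eLpNorm_add_le (m2.sub m1) m3 (by norm_num)).trans
      (add_le_add_left (eLpNorm_sub_le m2 m1 (by norm_num)) _)
  have := (eLpNorm_eq_zero_iff (h.memLp.1.sub h'.memLp.1) (by norm_num)).1 (le_antisymm hfin zero_le)
  filter_upwards [this] with t ht
  exact sub_eq_zero.1 ht

end Real

end

/-! ### Convergence in `Lᵖ` -/

section LpTendsto

variable {α E F : Type*} [MeasurableSpace α] [NormedAddCommGroup E] [NormedAddCommGroup F]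
  [NormedSpace 𝕜 E] [NormedSpace 𝕜 F] {p : ℝ≥0∞} {ν : Measure α}

/-- Convergence `fₙ → f` in the `Lᵖ` seminorm, with measurable differences `fₙ - f`. -/
structure LpTendsto (p : ℝ≥0∞) (ν : Measure α) (fn : ℕ → α → E) (f : α → E) : Prop where
  aestronglyMeasurable : ∀ n, AEStronglyMeasurable (fun t => fn n t - f t) ν
  tendsto : Tendsto (fun n => eLpNorm (fun t => fn n t - f t) p ν) atTop (𝓝 0)

theorem LpTendsto.add (hp : 1 ≤ p) {fn gn : ℕ → α → E} {f g : α → E} (hf : LpTendsto p ν fn f)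
    (hg : LpTendsto p ν gn g) :
    LpTendsto p ν (fun n t => fn n t + gn n t) (fun t => f t + g t) := by
  have e : ∀ n, (fun t => fn n t + gn n t - (f t + g t)) =
      (fun t => fn n t - f t) + fun t => gn n t - g t := fun n => by
    ext t; simp only [Pi.add_apply]; abel
  refine ⟨fun n => ?_, ?_⟩
  · rw [e]; exact (hf.1 n).add (hg.1 n)
  · have := hf.2.add hg.2
    rw [add_zero] at this
    refine tendsto_of_tendsto_of_tendsto_of_le_of_le tendsto_const_nhds this
      (fun _ => zero_le) fun n => ?_
    rw [e]
    exact eLpNorm_add_le (hf.1 n) (hg.1 n) hp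

theorem LpTendsto.clm {fn : ℕ → α → E} {f : α → E} (hf : LpTendsto p ν fn f) (L : E →L[𝕜] F) :
    LpTendsto p ν (fun n t => L (fn n t)) (fun t => L (f t)) := by
  refine ⟨fun n => ?_, ?_⟩
  · simp only [← _root_.map_sub]
    exact L.continuous.comp_aestronglyMeasurable (hf.1 n)
  · have := ENNReal.Tendsto.const_mul (a := ENNReal.ofReal ‖L‖) hf.2
      (Or.inr ENNReal.ofReal_ne_top)
    rw [mul_zero] at this
    refine tendsto_of_tendsto_of_tendsto_of_le_of_le tendsto_const_nhds this
      (fun _ => zero_le) fun n => ?_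
    refine eLpNorm_le_mul_eLpNorm_of_ae_le_mul (ae_of_all _ fun t => ?_) p
    rw [← _root_.map_sub]
    exact L.le_opNorm _

theorem LpTendsto.mono_measure {fn : ℕ → α → E} {f : α → E} (hf : LpTendsto p ν fn f)
    {ν' : Measure α} (h : ν' ≤ ν) : LpTendsto p ν' fn f :=
  ⟨fun n => (hf.1 n).mono_measure h,
    tendsto_of_tendsto_of_tendsto_of_le_of_le tendsto_const_nhds hf.2 (fun _ => zero_le)
      fun _ => eLpNorm_mono_measure _ h⟩

theorem LpTendsto.one_of_two [IsFiniteMeasure ν] {fn : ℕ → α → E} {f : α → E}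
    (hf : LpTendsto 2 ν fn f) : LpTendsto 1 ν fn f := by
  refine ⟨hf.1, ?_⟩
  have h := ENNReal.Tendsto.mul_const hf.2 (b := ν Set.univ ^ (1 / (1 : ℝ≥0∞).toReal -
    1 / (2 : ℝ≥0∞).toReal)) (Or.inr (ENNReal.rpow_ne_top_of_nonneg (by norm_num)
    (measure_ne_top _ _)))
  rw [zero_mul] at h
  exact tendsto_of_tendsto_of_tendsto_of_le_of_le tendsto_const_nhds h (fun _ => zero_le)
    fun n => eLpNorm_le_eLpNorm_mul_rpow_measure_univ (by norm_num) (hf.1 n)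

theorem LpTendsto.congr_lim {fn : ℕ → α → E} {f g : α → E} (hf : LpTendsto p ν fn f)
    (h : f =ᵐ[ν] g) : LpTendsto p ν fn g := by
  have e : ∀ n, (fun t => fn n t - f t) =ᵐ[ν] fun t => fn n t - g t := fun n => by
    filter_upwards [h] with t ht
    rw [ht]
  refine ⟨fun n => (hf.1 n).congr (e n), hf.2.congr fun n => eLpNorm_congr_ae (e n)⟩

theorem LpTendsto.ae_eq (hp : 1 ≤ p) {fn : ℕ → α → E} {f g : α → E} (hf : LpTendsto p ν fn f)
    (hg : LpTendsto p ν fn g) (hfg : AEStronglyMeasurable (f - g) ν) : f =ᵐ[ν] g := by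
  have h0 : eLpNorm (f - g) p ν ≤ 0 := by
    have h := hg.2.add hf.2
    rw [add_zero] at h
    refine ge_of_tendsto h (Eventually.of_forall fun n => ?_)
    have e : f - g = (fun t => fn n t - g t) - fun t => fn n t - f t := by
      ext t; simp
    rw [e]
    exact eLpNorm_sub_le (hg.1 n) (hf.1 n) hp
  have := (eLpNorm_eq_zero_iff hfg (by positivity)).1 (le_antisymm h0 zero_le)
  filter_upwards [this] with t ht
  exact sub_eq_zero.1 ht

/-- The double sequence of mutual distances of an `Lᵖ`-convergent sequence tends to zero. -/
theorem LpTendsto.cauchy (hp : 1 ≤ p) {fn : ℕ → α → E} {f : α → E} (hf : LpTendsto p ν fn f) :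
    Tendsto (fun q : ℕ × ℕ => eLpNorm (fun t => fn q.1 t - fn q.2 t) p ν) atTop (𝓝 0) := by
  have h1 : Tendsto (fun q : ℕ × ℕ => q.1) atTop atTop := by
    rw [← prod_atTop_atTop_eq]; exact tendsto_fst
  have h2 : Tendsto (fun q : ℕ × ℕ => q.2) atTop atTop := by
    rw [← prod_atTop_atTop_eq]; exact tendsto_snd
  have h := (hf.2.comp h1).add (hf.2.comp h2)
  rw [add_zero] at h
  refine tendsto_of_tendsto_of_tendsto_of_le_of_le tendsto_const_nhds h
    (fun _ => zero_le) fun q => ?_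
  have e : (fun t => fn q.1 t - fn q.2 t) =
      (fun t => fn q.1 t - f t) - fun t => fn q.2 t - f t := by
    ext t; simp
  rw [e]
  exact eLpNorm_sub_le (hf.1 _) (hf.1 _) hp

theorem lpTendsto_one_of_bounded [IsFiniteMeasure ν] {fn : ℕ → α → E} {f : α → E} (C : ℝ)
    (hm : ∀ n, AEStronglyMeasurable (fn n) ν) (hfm : AEStronglyMeasurable f ν)
    (hb : ∀ n, ∀ᵐ t ∂ν, ‖fn n t‖ ≤ C) (hlim : ∀ᵐ t ∂ν, Tendsto (fun n => fn n t) atTop (𝓝 (f t))) :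
    LpTendsto 1 ν fn f := by
  refine ⟨fun n => (hm n).sub hfm, ?_⟩
  have := tendsto_lintegral_norm_of_dominated_convergence (bound := fun _ => C) hm
    (integrable_const C).2 hb hlim
  refine this.congr fun n => ?_
  rw [eLpNorm_one_eq_lintegral_enorm]
  simp only [ofReal_norm]

theorem LpTendsto.tendsto_toReal_eLpNorm [Fact (1 ≤ p)] {fn : ℕ → α → E} {f : α → E}
    (h : LpTendsto p ν fn f) (hfn : ∀ n, MemLp (fn n) p ν) (hf : MemLp f p ν) :
    Tendsto (fun n => (eLpNorm (fn n) p ν).toReal) atTop (𝓝 (eLpNorm f p ν).toReal) := by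
  have := ((Lp.tendsto_Lp_iff_tendsto_eLpNorm'' fn hfn f hf).2 h.2).norm
  simpa only [Lp.norm_toLp] using this

theorem toReal_eLpNorm_two_sq {f : α → E} (hf : MemLp f 2 ν) :
    (eLpNorm f 2 ν).toReal ^ 2 = ∫ t, ‖f t‖ ^ 2 ∂ν := by
  have h := hf.eLpNorm_eq_integral_rpow_norm (by norm_num) (by norm_num)
  have h0 : 0 ≤ ∫ t, ‖f t‖ ^ 2 ∂ν := integral_nonneg fun t => by positivity
  simp only [ENNReal.toReal_ofNat, Real.rpow_ofNat] at h
  rw [h, ENNReal.toReal_ofReal (by positivity), ← Real.rpow_natCast, ← Real.rpow_mul h0]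
  norm_num

theorem LpTendsto.tendsto_integral_norm_sq {fn : ℕ → α → E} {f : α → E}
    (h : LpTendsto 2 ν fn f) (hfn : ∀ n, MemLp (fn n) 2 ν) (hf : MemLp f 2 ν) :
    Tendsto (fun n => ∫ t, ‖fn n t‖ ^ 2 ∂ν) atTop (𝓝 (∫ t, ‖f t‖ ^ 2 ∂ν)) := by
  have := (h.tendsto_toReal_eLpNorm hfn hf).pow 2
  simpa only [toReal_eLpNorm_two_sq hf, fun n => toReal_eLpNorm_two_sq (hfn n)] using this

theorem exists_lpTendsto_of_cauchy [CompleteSpace E] [Fact (1 ≤ p)] {fn : ℕ → α → E}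
    (hfn : ∀ n, MemLp (fn n) p ν)
    (hc : Tendsto (fun q : ℕ × ℕ => eLpNorm (fun t => fn q.1 t - fn q.2 t) p ν) atTop (𝓝 0)) :
    ∃ f, MemLp f p ν ∧ LpTendsto p ν fn f := by
  have h1 : CauchySeq fun n => (hfn n).toLp (fn n) := by
    rw [Lp.cauchySeq_Lp_iff_cauchySeq_eLpNorm]
    refine hc.congr fun q => eLpNorm_congr_ae ?_
    exact ((hfn q.1).coeFn_toLp.sub (hfn q.2).coeFn_toLp).symm
  obtain ⟨f, hf⟩ := cauchySeq_tendsto_of_complete h1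
  refine ⟨f, Lp.memLp f, fun n => (hfn n).1.sub (Lp.memLp f).1, ?_⟩
  rw [Lp.tendsto_Lp_iff_tendsto_eLpNorm'] at hf
  refine hf.congr fun n => eLpNorm_congr_ae ?_
  exact (hfn n).coeFn_toLp.sub EventuallyEq.rfl

end LpTendsto

/-- The limits on `(0, N + 1)` agree almost everywhere on overlaps and glue to one function on the
half-line, since a global solution carries a single `v` for all `T`. -/
theorem exists_lpTendsto_two_of_cauchy {E : Type*} [NormedAddCommGroup E] [CompleteSpace E]
    {b : ℕ → ℝ → E} (hb : ∀ n, Continuous (b n))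
    (hc : ∀ T : ℝ, 0 < T → Tendsto (fun q : ℕ × ℕ => eLpNorm (fun t => b q.1 t - b q.2 t) 2
      (volume.restrict (Set.Ioo 0 T))) atTop (𝓝 0)) :
    ∃ v : ℝ → E, ∀ T : ℝ, 0 < T → MemLp v 2 (volume.restrict (Set.Ioo 0 T)) ∧
      LpTendsto 2 (volume.restrict (Set.Ioo 0 T)) b v := by
  have hN : ∀ N : ℕ, (0 : ℝ) < N + 1 := fun N => by positivity
  choose w hw hbw using fun N : ℕ => exists_lpTendsto_of_cauchy
    (fun n => memLp_of_continuous (hb n) 2 ((N : ℝ) + 1)) (hc _ (hN N))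
  have hmono : ∀ {S T : ℝ}, S ≤ T →
      volume.restrict (Set.Ioo 0 S) ≤ volume.restrict (Set.Ioo 0 T) := fun h =>
    Measure.restrict_mono (Set.Ioo_subset_Ioo_right h) le_rfl
  -- As `t < ⌊t⌋₊ + 1`, the chosen piece is a limit on an interval containing `t`; for `t` in `(0, N
  -- + 1)` its index is at most `N`.
  let v : ℝ → E := fun t => w ⌊t⌋₊ t
  have hv : ∀ N : ℕ, w N =ᵐ[volume.restrict (Set.Ioo 0 ((N : ℝ) + 1))] v := by
    intro N
    have h1 : ∀ M : ℕ, M ≤ N →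
        ∀ᵐ t ∂volume.restrict (Set.Ioo 0 ((N : ℝ) + 1)), t < (M : ℝ) + 1 → w N t = w M t := by
      intro M hMN
      have hle : (M : ℝ) + 1 ≤ N + 1 := by
        have : (M : ℝ) ≤ N := Nat.cast_le.2 hMN
        linarith
      have h2 : w N =ᵐ[volume.restrict (Set.Ioo 0 ((M : ℝ) + 1))] w M :=
        ((hbw N).mono_measure (hmono hle)).ae_eq (by norm_num) (hbw M)
          (((hw N).1.mono_measure (hmono hle)).sub (hw M).1)
      rw [EventuallyEq, ae_restrict_iff' measurableSet_Ioo] at h2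
      rw [ae_restrict_iff' measurableSet_Ioo]
      filter_upwards [h2] with t ht h3 h4
      exact ht ⟨h3.1, h4⟩
    have h2 : ∀ᵐ t ∂volume.restrict (Set.Ioo 0 ((N : ℝ) + 1)), ∀ M : ℕ, M ≤ N →
        t < (M : ℝ) + 1 → w N t = w M t := by
      rw [ae_all_iff]
      intro M
      by_cases hM : M ≤ N
      · filter_upwards [h1 M hM] with t ht _
        exact ht
      · exact ae_of_all _ fun t h => absurd h hM
    filter_upwards [h2, ae_restrict_mem measurableSet_Ioo] with t ht ht'
    refine ht _ ?_ (Nat.lt_floor_add_one t)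
    have : ⌊t⌋₊ < N + 1 := (Nat.floor_lt ht'.1.le).2 (by push_cast; exact ht'.2)
    omega
  refine ⟨v, fun T hT => ?_⟩
  obtain ⟨N, hTN⟩ := exists_nat_ge T
  have hle : T ≤ (N : ℝ) + 1 := by linarith
  exact ⟨((hw N).ae_eq (hv N)).mono_measure (hmono hle),
    ((hbw N).congr_lim (hv N)).mono_measure (hmono hle)⟩

/-! ### Regularisation of mild solutions -/

section Real

variable [NormedSpace ℝ H] [IsScalarTower ℝ 𝕜 H] {𝒮 : C0Group 𝕜 H}

/-- By duality, averaging the solution amounts to averaging the test vector. The averaged test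
vector lies in `D(A)`, so the weak equation holds against every `φ` in `H`. -/
theorem hasDerivAt_inner_incl_avg_costate (ε : ℝ) (z₀ : H) {g : ℝ → H} (hg : Continuous g)
    (φ : H) (t : ℝ) :
    HasDerivAt (fun t => inner 𝕜 φ (incl (𝒮.avg ε (𝒮.costate z₀ g t))))
      (inner 𝕜 φ (-adj (𝒮.avg ε (𝒮.costate z₀ g t)) - incl (𝒮.avg ε (g t)))) t := by
  have h := (hasDerivAt_inner_costate z₀ hg (𝒮.integ_mem_generatorGraph ε φ) t).const_mul
    ((ε⁻¹ : ℝ) : 𝕜)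
  simp only [incl_avg, adj_avg, inner_smul_right, ContinuousLinearMap.adjoint_inner_right,
    inner_sub_right, inner_neg_right]
  refine h.congr_deriv ?_
  rw [inner_sub_left]
  ring

/-- A weak derivative that is continuous in norm is a strong one: `Z` equals the integral of `D` up
to a constant, as pairing with every `φ` shows. -/
theorem hasDerivAt_of_inner {Z D : ℝ → H} (hD : Continuous D)
    (h : ∀ φ t, HasDerivAt (fun t => inner 𝕜 φ (Z t)) (inner 𝕜 φ (D t)) t) (t : ℝ) :
    HasDerivAt Z (D t) t := by
  have h1 : ∀ t, Z t = Z 0 + ∫ s in (0 : ℝ)..t, D s := by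
    intro t
    rw [← sub_eq_iff_eq_add']
    refine ext_inner_left 𝕜 fun φ => ?_
    have hc : Continuous fun s => inner 𝕜 φ (D s) := by fun_prop
    rw [inner_sub_right, ← intervalIntegral.integral_eq_sub_of_hasDerivAt (fun s _ => h φ s)
      (hc.intervalIntegrable 0 t)]
    exact (innerSL 𝕜 φ).intervalIntegral_comp_comm (hD.intervalIntegrable 0 t)
  have h2 : HasDerivAt (fun t => Z 0 + ∫ s in (0 : ℝ)..t, D s) (D t) t :=
    (intervalIntegral.integral_hasDerivAt_right (hD.intervalIntegrable 0 t)
      (hD.stronglyMeasurableAtFilter _ _) hD.continuousAt).const_add (Z 0)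
  exact h2.congr_of_eventuallyEq (Eventually.of_forall h1)

theorem hasDerivAt_incl_avg_costate (ε : ℝ) (z₀ : H) {g : ℝ → H} (hg : Continuous g) (t : ℝ) :
    HasDerivAt (fun t => incl (𝒮.avg ε (𝒮.costate z₀ g t)))
      (-adj (𝒮.avg ε (𝒮.costate z₀ g t)) - incl (𝒮.avg ε (g t))) t := by
  have hc := 𝒮.continuous_costate z₀ hg
  refine hasDerivAt_of_inner (𝕜 := 𝕜) ?_ (hasDerivAt_inner_incl_avg_costate ε z₀ hg) t
  exact (continuous_adj.comp ((continuous_avg ε).comp hc)).neg.sub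
    (continuous_incl.comp ((continuous_avg ε).comp hg))

theorem inner_generator_incl (φ : 𝒮.generator.domain) (z : 𝒮.DAdj) :
    inner 𝕜 (𝒮.generator φ) (incl z) = inner 𝕜 (φ : H) (adj z) := by
  have := inner_adj z (mem_generatorGraph_of_domain φ)
  rw [← inner_conj_symm, ← this, inner_conj_symm]

theorem isWeakSolAdj_avg_costate (ε : ℝ) (z₀ : H) {g : ℝ → H} (hg : Continuous g) (T : ℝ) :
    𝒮.IsWeakSolAdj T (fun t => incl (𝒮.avg ε (g t)))
      (fun t => incl (𝒮.avg ε (𝒮.costate z₀ g t))) := by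
  have hc := 𝒮.continuous_costate z₀ hg
  have h1 := continuous_incl.comp ((continuous_avg (𝒮 := 𝒮) ε).comp hc)
  have h2 := continuous_incl.comp ((continuous_avg (𝒮 := 𝒮) ε).comp hg)
  have h3 := continuous_adj.comp ((continuous_avg (𝒮 := 𝒮) ε).comp hc)
  simp only [Function.comp_def] at h1 h2 h3
  refine ⟨h1.continuousOn, fun φ => hasDistribDeriv_of_hasDerivAt (fun t => ?_) ?_⟩
  · refine (hasDerivAt_inner_incl_avg_costate ε z₀ hg (φ : H) t).congr_deriv ?_
    rw [inner_sub_right, inner_neg_right, inner_generator_incl]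
  · fun_prop

theorem lpTendsto_incl_avg {g : ℝ → H} (hg : Continuous g) (T : ℝ) :
    LpTendsto 1 (volume.restrict (Set.Ioo 0 T))
      (fun n : ℕ => fun t => incl (𝒮.avg ((n : ℝ) + 1)⁻¹ (g t))) g := by
  obtain ⟨M, hM0, hM⟩ := 𝒮.exists_norm_incl_avg_le
  obtain ⟨C, hC⟩ := (isCompact_Icc (a := (0 : ℝ)) (b := T)).exists_bound_of_continuousOn
    hg.continuousOn
  refine lpTendsto_one_of_bounded (M * C) (fun n => ?_) hg.aestronglyMeasurable (fun n => ?_)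
    (ae_of_all _ fun t => tendsto_incl_avg (g t))
  · exact (continuous_incl.comp ((continuous_avg _).comp hg)).aestronglyMeasurable
  · filter_upwards [ae_restrict_mem measurableSet_Ioo] with t ht
    exact (hM n _).trans (mul_le_mul_of_nonneg_left (hC t (Set.Ioo_subset_Icc_self ht)) hM0)

/-- The difference of two averages is again a regular solution of the adjoint equation, so the trace
estimate turns convergence of final values and sources into the Cauchy property of the traces. The
averaging sequence does not depend on `T`, so one limit serves all horizons. -/
theorem Admissible.exists_trace {B : U →L[𝕜] 𝒮.DAdjDual} (hB : 𝒮.Admissible B) (z₀ : H)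
    {g : ℝ → H} (hg : Continuous g) : ∃ v : ℝ → U, ∀ T : ℝ, 0 < T →
      MemLp v 2 (volume.restrict (Set.Ioo 0 T)) ∧
      LpTendsto 2 (volume.restrict (Set.Ioo 0 T))
        (fun n : ℕ => fun t => adjControl B (𝒮.avg ((n : ℝ) + 1)⁻¹ (𝒮.costate z₀ g t))) v := by
  have hz := 𝒮.continuous_costate z₀ hg
  refine exists_lpTendsto_two_of_cauchy
    (fun n => (continuous_adjControl B).comp ((continuous_avg _).comp hz)) fun T hT => ?_
  obtain ⟨C, hC⟩ := hB.exists_eLpNorm_adjControl_le hT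
  have h1 : Tendsto (fun q : ℕ × ℕ => q.1) atTop atTop := by
    rw [← prod_atTop_atTop_eq]; exact tendsto_fst
  have h2 : Tendsto (fun q : ℕ × ℕ => q.2) atTop atTop := by
    rw [← prod_atTop_atTop_eq]; exact tendsto_snd
  have hγ := (lpTendsto_incl_avg (𝒮 := 𝒮) hg T).cauchy le_rfl
  have hζ : Tendsto (fun q : ℕ × ℕ => ‖incl (𝒮.avg ((q.1 : ℝ) + 1)⁻¹ (𝒮.costate z₀ g T)) -
      incl (𝒮.avg ((q.2 : ℝ) + 1)⁻¹ (𝒮.costate z₀ g T))‖ₑ) atTop (𝓝 0) := by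
    have h := tendsto_incl_avg (𝒮 := 𝒮) (𝒮.costate z₀ g T)
    have := ((h.comp h1).sub (h.comp h2)).enorm
    rwa [sub_self, enorm_zero] at this
  have h := ENNReal.Tendsto.const_mul (a := ENNReal.ofReal C) (hζ.add hγ)
    (Or.inr ENNReal.ofReal_ne_top)
  rw [add_zero, mul_zero] at h
  refine tendsto_of_tendsto_of_tendsto_of_le_of_le tendsto_const_nhds h
    (fun _ => zero_le) fun q => ?_
  have hcζ : ∀ n : ℕ, ContinuousOn (fun t => 𝒮.avg ((n : ℝ) + 1)⁻¹ (𝒮.costate z₀ g t))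
    (Set.Icc 0 T) := fun n => ((continuous_avg _).comp hz).continuousOn
  have hcγ : ∀ n : ℕ, ContinuousOn (fun t => 𝒮.avg ((n : ℝ) + 1)⁻¹ (g t))
    (Set.Icc 0 T) := fun n => ((continuous_avg _).comp hg).continuousOn
  have := hC (fun t => 𝒮.avg ((q.1 : ℝ) + 1)⁻¹ (𝒮.costate z₀ g t) -
      𝒮.avg ((q.2 : ℝ) + 1)⁻¹ (𝒮.costate z₀ g t))
    (fun t => 𝒮.avg ((q.1 : ℝ) + 1)⁻¹ (g t) - 𝒮.avg ((q.2 : ℝ) + 1)⁻¹ (g t)) ((hcζ q.1).sub (hcζ q.2)) ((hcγ q.1).sub (hcγ q.2)) (by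
    simp only [incl_sub]
    exact (isWeakSolAdj_avg_costate _ z₀ hg T).sub (isWeakSolAdj_avg_costate _ z₀ hg T))
  simpa only [adjControl_sub, incl_sub] using this

theorem isAdjControlTrace_costate {B : U →L[𝕜] 𝒮.DAdjDual} (z₀ : H)
    {g : ℝ → H} (hg : Continuous g) {v : ℝ → U} {T : ℝ}
    (hv : MemLp v 2 (volume.restrict (Set.Ioo 0 T)))
    (hlim : LpTendsto 2 (volume.restrict (Set.Ioo 0 T))
        (fun n : ℕ => fun t => adjControl B (𝒮.avg ((n : ℝ) + 1)⁻¹ (𝒮.costate z₀ g t))) v) :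
    𝒮.IsAdjControlTrace B T g (𝒮.costate z₀ g) v := by
  have hz := 𝒮.continuous_costate z₀ hg
  exact ⟨hv, fun n t => 𝒮.avg ((n : ℝ) + 1)⁻¹ (𝒮.costate z₀ g t),
    fun n t => 𝒮.avg ((n : ℝ) + 1)⁻¹ (g t),
    fun n => ((continuous_avg _).comp hz).continuousOn,
    fun n => ((continuous_avg _).comp hg).continuousOn,
    fun n => isWeakSolAdj_avg_costate _ z₀ hg T, tendsto_incl_avg _,
    (lpTendsto_incl_avg hg T).2, hlim.2⟩

end Real

/-! ### Square roots, the feedback operator and a Gronwall inequality -/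

theorem norm_opSqrt_sq {E : Type*} [NormedAddCommGroup E] [InnerProductSpace 𝕜 E]
    [CompleteSpace E] {T : E →L[𝕜] E} (hT : T.IsPositive) (x : E) :
    ‖opSqrt T x‖ ^ 2 = RCLike.re (inner 𝕜 (T x) x) := by
  rw [← inner_self_eq_norm_sq (𝕜 := 𝕜), ← (opSqrt_isPositive hT).inner_left_eq_inner_right]
  conv_rhs => rw [← opSqrt_mul_self hT]
  rfl

theorem isPositive_symm {Q : H ≃L[𝕜] H} (hQ : (Q : H →L[𝕜] H).IsSymmetric)
    (hQpos : ∀ x : H, 0 ≤ RCLike.re (inner 𝕜 (Q x) x)) :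
    (Q.symm : H →L[𝕜] H).IsPositive := by
  rw [ContinuousLinearMap.isPositive_def]
  refine ⟨fun x y => ?_, fun x => ?_⟩
  · have := hQ (Q.symm x) (Q.symm y)
    simp only [ContinuousLinearMap.coe_coe, ContinuousLinearEquiv.coe_coe,
      ContinuousLinearEquiv.apply_symm_apply] at this ⊢
    exact this.symm
  · rw [ContinuousLinearMap.reApplyInnerSelf_apply]
    have := hQpos (Q.symm x)
    rw [ContinuousLinearEquiv.apply_symm_apply] at this
    rwa [← inner_conj_symm, RCLike.conj_re]

/-- The zeroth order operator `2 λ + R Q` of the equation for the costate. -/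
def feedback (lam : ℝ) (Q : H ≃L[𝕜] H) (R : H →L[𝕜] H) : H →L[𝕜] H :=
  ((2 * lam : ℝ) : 𝕜) • ContinuousLinearMap.id 𝕜 H + R.comp (Q : H →L[𝕜] H)

theorem feedback_apply (lam : ℝ) (Q : H ≃L[𝕜] H) (R : H →L[𝕜] H) (x : H) :
    feedback lam Q R x = ((2 * lam : ℝ) : 𝕜) • x + R (Q x) := rfl

/-- The number `a` may be negative, so the integral inequality from time `0` alone would not
suffice. Holding from every `τ`, it bounds the right difference quotients of `E` by those of a
primitive of `a * E`, and the differential form of Gronwall applies. -/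
theorem le_exp_mul_of_sub_le {E : ℝ → ℝ} (hE : Continuous E) (a : ℝ)
    (h : ∀ τ t, 0 ≤ τ → τ ≤ t → E t - E τ ≤ a * ∫ s in τ..t, E s) {t : ℝ} (ht : 0 ≤ t) :
    E t ≤ E 0 * Real.exp (a * t) := by
  have := le_gronwallBound_of_liminf_deriv_right_le (f := E) (f' := fun x => a * E x)
    (δ := E 0) (K := a) (ε := 0) (a := 0) (b := t) hE.continuousOn (fun x hx r hr => ?_) le_rfl
    (fun x _ => by simp) t ⟨ht, le_rfl⟩
  · rwa [gronwallBound_ε0, sub_zero] at this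
  · have hd : HasDerivAt (fun z => a * ∫ s in x..z, E s) (a * E x) x :=
      (intervalIntegral.integral_hasDerivAt_right (hE.intervalIntegrable x x)
        (hE.stronglyMeasurableAtFilter _ _) hE.continuousAt).const_mul a
    have hs := (hasDerivAt_iff_tendsto_slope.1 hd).mono_left
      (nhdsWithin_mono x (fun z (hz : x < z) => ne_of_gt hz) : 𝓝[>] x ≤ 𝓝[≠] x)
    refine Eventually.frequently ?_
    filter_upwards [hs.eventually_lt_const hr, self_mem_nhdsWithin] with z hz hxz
    have hxz' : x < z := hxz
    refine lt_of_le_of_lt ?_ hz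
    rw [slope_def_field, intervalIntegral.integral_same, mul_zero, sub_zero, div_eq_inv_mul]
    exact mul_le_mul_of_nonneg_left (h x z hx.1 hxz'.le) (inv_nonneg.2 (sub_nonneg.2 hxz'.le))

section Real

variable [NormedSpace ℝ H] [IsScalarTower ℝ 𝕜 H] {𝒮 : C0Group 𝕜 H} {B : U →L[𝕜] 𝒮.DAdjDual}
  {lam : ℝ} {Q : H ≃L[𝕜] H} {R : H →L[𝕜] H} {W : U →L[𝕜] U}

/-! ### The state equation -/

/-- For a regular solution of `ζ' = - A* ζ - γ` the left side is `d/dt ⟨Q φ, ζ⟩`. The right side is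
the weak state equation for `Q ζ`, plus an error measuring how far `γ` is from the feedback of `ζ`.
Averaging does not commute with the feedback, so the error vanishes only in the limit. -/
theorem OperatorIdentity.inner_eq (hR : R.IsPositive) (hW : W.IsPositive)
    (hId : 𝒮.OperatorIdentity B lam Q R W) (φ ζ γ : 𝒮.DAdj) :
    inner 𝕜 (Q (incl φ)) (-adj ζ - incl γ) =
      inner 𝕜 (adj φ) (Q (incl ζ)) + inner 𝕜 (adjControl B φ) (-W (adjControl B ζ)) +
      inner 𝕜 (Q (incl φ)) (feedback lam Q R (incl ζ) - incl γ) := by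
  have h := hId φ ζ
  rw [hR.inner_left_eq_inner_right, hW.inner_left_eq_inner_right] at h
  rw [feedback_apply]
  simp only [inner_sub_right, inner_neg_right, inner_add_right, inner_smul_right]
  linear_combination -h

/-- The preceding identity is applied to the averages and passed to the limit in `L¹`. The control
term converges because the traces converge in `L²` on a bounded interval, and symmetry of `Q` turns
`⟨Q φ, z⟩` into `⟨φ, Q z⟩`. -/
theorem isWeakSol_costate (hQ : (Q : H →L[𝕜] H).IsSymmetric) (hR : R.IsPositive)
    (hW : W.IsPositive) (hId : 𝒮.OperatorIdentity B lam Q R W) {z₀ : H} {z : ℝ → H}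
    (hz : Continuous z) (hfix : ∀ t, z t = 𝒮.costate z₀ (fun s => feedback lam Q R (z s)) t)
    {v : ℝ → U} {T : ℝ} (hv : MemLp v 2 (volume.restrict (Set.Ioo 0 T)))
    (hlim : LpTendsto 2 (volume.restrict (Set.Ioo 0 T))
        (fun n : ℕ => fun t => adjControl B (𝒮.avg ((n : ℝ) + 1)⁻¹ (z t))) v) :
    𝒮.IsWeakSol B T (fun s => -W (v s)) (fun t => Q (z t)) := by
  set g : ℝ → H := fun s => feedback lam Q R (z s) with hg_def
  have hg : Continuous g := (feedback lam Q R).continuous.comp hz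
  have hfix' : z = 𝒮.costate z₀ g := funext hfix
  have hvi : IntegrableOn v (Set.Ioo 0 T) := memLp_one_iff_integrable.1 (hv.mono_exponent (by norm_num))
  refine ⟨(Q.continuous.comp hz).continuousOn, fun φ => ?_⟩
  set ζ : ℕ → ℝ → 𝒮.DAdj := fun n t => 𝒮.avg ((n : ℝ) + 1)⁻¹ (z t) with hζ_def
  set γ : ℕ → ℝ → 𝒮.DAdj := fun n t => 𝒮.avg ((n : ℝ) + 1)⁻¹ (g t) with hγ_def
  have hζc : ∀ n, Continuous (ζ n) := fun n => (continuous_avg _).comp hz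
  have hγc : ∀ n, Continuous (γ n) := fun n => (continuous_avg _).comp hg
  have hζlim : LpTendsto 1 (volume.restrict (Set.Ioo 0 T)) (fun n t => incl (ζ n t)) z :=
    lpTendsto_incl_avg hz T
  have hγlim : LpTendsto 1 (volume.restrict (Set.Ioo 0 T)) (fun n t => incl (γ n t)) g :=
    lpTendsto_incl_avg hg T
  have hder : ∀ n t, HasDerivAt (fun t => inner 𝕜 (Q (incl φ)) (incl (ζ n t)))
      (inner 𝕜 (Q (incl φ)) (-adj (ζ n t) - incl (γ n t))) t := by
    intro n t
    have := hasDerivAt_inner_incl_avg_costate (𝒮 := 𝒮) ((n : ℝ) + 1)⁻¹ z₀ hg (Q (incl φ)) t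
    rw [← hfix'] at this
    exact this
  have hdd : ∀ n, HasDistribDeriv T (fun t => inner 𝕜 (Q (incl φ)) (incl (ζ n t)))
      (fun t => inner 𝕜 (Q (incl φ)) (-adj (ζ n t) - incl (γ n t))) := by
    intro n
    refine hasDistribDeriv_of_hasDerivAt (hder n) ?_
    exact continuous_const.inner ((continuous_adj.comp (hζc n)).neg.sub
      (continuous_incl.comp (hγc n)))
  have hQsym : ∀ x, inner 𝕜 (Q (incl φ)) x = inner 𝕜 (incl φ) (Q x) := fun x => hQ (incl φ) x
  have hderlim : LpTendsto 1 (volume.restrict (Set.Ioo 0 T))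
      (fun n t => inner 𝕜 (Q (incl φ)) (-adj (ζ n t) - incl (γ n t)))
      (fun t => inner 𝕜 (adj φ) (Q (z t)) + inner 𝕜 (adjControl B φ) (-W (v t))) := by
    have hlim' : LpTendsto 2 (volume.restrict (Set.Ioo 0 T))
      (fun n t => adjControl B (ζ n t)) v := hlim
    have L1 := (hζlim.clm ((innerSL 𝕜 (adj φ)).comp (Q : H →L[𝕜] H))).add le_rfl
      (hlim'.one_of_two.clm (-((innerSL 𝕜 (adjControl B φ)).comp W)))
    -- The error term: both the feedback of the averages and the averages of the feedback tend to
    -- `g`, so their difference tends to zero.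
    have L2 := (hζlim.clm ((innerSL 𝕜 (Q (incl φ))).comp (feedback lam Q R))).add le_rfl
      (hγlim.clm (-innerSL 𝕜 (Q (incl φ))))
    have L3 := L1.add le_rfl L2
    refine ⟨fun n => ?_, ?_⟩
    · refine (L3.1 n).congr (ae_of_all _ fun t => ?_)
      simp only [hId.inner_eq hR hW]
      simp [inner_add_right, inner_neg_right, hg_def, sub_eq_add_neg]
    · refine L3.2.congr fun n => eLpNorm_congr_ae (ae_of_all _ fun t => ?_)
      simp only [hId.inner_eq hR hW]
      simp [inner_add_right, inner_neg_right, hg_def, sub_eq_add_neg]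
  have hflim := hζlim.clm (innerSL 𝕜 (Q (incl φ)))
  have hres := hasDistribDeriv_of_tendsto hdd
    (f := fun t => inner 𝕜 (Q (incl φ)) (z t)) ?_ ?_ hflim.2 hderlim.2
  · simpa only [hQsym] using hres
  · exact ((continuous_const.inner hz : Continuous fun t =>
      inner 𝕜 (Q (incl φ)) (z t)).integrableOn_Icc).mono_set Set.Ioo_subset_Icc_self
  · refine Integrable.add (μ := volume.restrict (Set.Ioo 0 T)) ?_ ?_
    · exact ((continuous_const.inner (Q.continuous.comp hz) : Continuous fun t =>
        inner 𝕜 (adj φ) (Q (z t))).integrableOn_Icc).mono_set Set.Ioo_subset_Icc_self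
    · exact ((innerSL 𝕜 (adjControl B φ)).comp (-W)).integrable_comp hvi

/-! ### The energy identity -/

/-- The operator identity on the diagonal. For `ζ' = - A* ζ - x` the left side is the derivative of
`⟨Q ζ, ζ⟩`. On the right, the term in `B* ζ` is isolated because the rest is continuous for the norm
of `H`. -/
theorem OperatorIdentity.re_inner_eq (hR : R.IsPositive) (hW : W.IsPositive)
    (hId : 𝒮.OperatorIdentity B lam Q R W) (ζ : 𝒮.DAdj) (x : H) :
    2 * RCLike.re (inner 𝕜 (-adj ζ - x) (Q (incl ζ))) =
      -‖opSqrt W (adjControl B ζ)‖ ^ 2 + (‖opSqrt R (Q (incl ζ))‖ ^ 2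
        + 2 * lam * RCLike.re (inner 𝕜 (Q (incl ζ)) (incl ζ))
        - 2 * RCLike.re (inner 𝕜 x (Q (incl ζ)))) := by
  have h := congrArg RCLike.re (hId ζ ζ)
  simp only [_root_.map_add, _root_.map_sub, RCLike.re_ofReal_mul, _root_.map_zero] at h
  rw [norm_opSqrt_sq hW, norm_opSqrt_sq hR, inner_sub_left, inner_neg_left, _root_.map_sub,
    _root_.map_neg]
  have hs : RCLike.re (inner 𝕜 (Q (incl ζ)) (adj ζ)) = RCLike.re (inner 𝕜 (adj ζ) (Q (incl ζ))) :=
    inner_re_symm _ _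
  rw [hs] at h
  linarith

/-- The source contributes twice the terms of the identity with opposite sign, which reverses the
signs of both the `λ` and the `R` terms. -/
theorem re_inner_feedback (hR : R.IsPositive) (x : H) :
    ‖opSqrt R (Q x)‖ ^ 2 + 2 * lam * RCLike.re (inner 𝕜 (Q x) x)
        - 2 * RCLike.re (inner 𝕜 (feedback lam Q R x) (Q x)) =
      -2 * lam * RCLike.re (inner 𝕜 (Q x) x) - ‖opSqrt R (Q x)‖ ^ 2 := by
  rw [feedback_apply, inner_add_left, _root_.map_add, inner_smul_left, RCLike.conj_ofReal,
    RCLike.re_ofReal_mul, ← norm_opSqrt_sq hR, inner_re_symm x]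
  ring

variable (lam Q R) in
/-- The part of the energy balance of `z' = - A* z - γ` that does not involve `B* z`. -/
def energyRate (x y : H) : ℝ :=
  ‖opSqrt R (Q x)‖ ^ 2 + 2 * lam * RCLike.re (inner 𝕜 (Q x) x) - 2 * RCLike.re (inner 𝕜 y (Q x))

variable (lam Q R) in
theorem continuous_energyRate : Continuous fun q : H × H => energyRate lam Q R q.1 q.2 := by
  have h1 : Continuous fun q : H × H => Q q.1 := Q.continuous.comp continuous_fst
  have h2 : Continuous fun q : H × H => opSqrt R (Q q.1) := (opSqrt R).continuous.comp h1
  have h3 : Continuous fun q : H × H => RCLike.re (inner 𝕜 (Q q.1) q.1) :=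
    RCLike.continuous_re.comp (h1.inner continuous_fst)
  have h4 : Continuous fun q : H × H => RCLike.re (inner 𝕜 q.2 (Q q.1)) :=
    RCLike.continuous_re.comp (continuous_snd.inner h1)
  exact (((h2.norm.pow 2).add (h3.const_mul _)).sub (h4.const_mul _))

variable (lam Q R) in
theorem exists_norm_energyRate_le (r : ℝ) :
    ∃ C : ℝ, ∀ x y : H, ‖x‖ ≤ r → ‖y‖ ≤ r → ‖energyRate lam Q R x y‖ ≤ C := by
  set q := ‖(Q : H →L[𝕜] H)‖ * r
  refine ⟨(‖opSqrt R‖ * q) ^ 2 + |2 * lam| * (q * r) + 2 * (r * q), fun x y hx hy => ?_⟩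
  have hr : 0 ≤ r := (norm_nonneg x).trans hx
  have hq : 0 ≤ q := mul_nonneg (norm_nonneg _) hr
  have hQx : ‖Q x‖ ≤ q := ((Q : H →L[𝕜] H).le_opNorm x).trans
    (mul_le_mul_of_nonneg_left hx (norm_nonneg _))
  have b1 : ‖opSqrt R (Q x)‖ ≤ ‖opSqrt R‖ * q :=
    ((opSqrt R).le_opNorm _).trans (mul_le_mul_of_nonneg_left hQx (norm_nonneg _))
  have b2 : |RCLike.re (inner 𝕜 (Q x) x)| ≤ q * r :=
    (RCLike.abs_re_le_norm _).trans ((norm_inner_le_norm _ _).trans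
      (mul_le_mul hQx hx (norm_nonneg _) hq))
  have b3 : |RCLike.re (inner 𝕜 y (Q x))| ≤ r * q :=
    (RCLike.abs_re_le_norm _).trans ((norm_inner_le_norm _ _).trans
      (mul_le_mul hy hQx (norm_nonneg _) hr))
  refine (norm_sub_le _ _).trans (add_le_add ((norm_add_le _ _).trans (add_le_add ?_ ?_)) ?_)
  · rw [norm_pow, norm_norm]
    exact pow_le_pow_left₀ (norm_nonneg _) b1 2
  · rw [norm_mul]
    exact mul_le_mul_of_nonneg_left b2 (abs_nonneg _)
  · rw [norm_mul, Real.norm_ofNat]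
    exact mul_le_mul_of_nonneg_left b3 (by norm_num)

/-- The balance is integrated for the averages. In the limit the `W` term converges by `L²`
convergence of the traces, and the remaining rate by dominated convergence, the averages being
bounded uniformly on `[τ, t]`. The strict inequality `t < T` places `(τ, t]` inside `(0, T)`. -/
theorem energy_costate (hQ : (Q : H →L[𝕜] H).IsSymmetric) (hR : R.IsPositive)
    (hW : W.IsPositive) (hId : 𝒮.OperatorIdentity B lam Q R W) {z₀ : H} {z : ℝ → H}
    (hz : Continuous z) (hfix : ∀ t, z t = 𝒮.costate z₀ (fun s => feedback lam Q R (z s)) t)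
    {v : ℝ → U} {T : ℝ} (hv : MemLp v 2 (volume.restrict (Set.Ioo 0 T)))
    (hlim : LpTendsto 2 (volume.restrict (Set.Ioo 0 T))
        (fun n : ℕ => fun t => adjControl B (𝒮.avg ((n : ℝ) + 1)⁻¹ (z t))) v)
    {τ t : ℝ} (hτ : 0 ≤ τ) (hτt : τ ≤ t) (htT : t < T) :
    RCLike.re (inner 𝕜 (Q (z t)) (z t)) - RCLike.re (inner 𝕜 (Q (z τ)) (z τ)) =
      -2 * lam * (∫ s in τ..t, RCLike.re (inner 𝕜 (Q (z s)) (z s))) -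
        ∫ s in τ..t, (‖opSqrt W (v s)‖ ^ 2 + ‖opSqrt R (Q (z s))‖ ^ 2) := by
  set g : ℝ → H := fun s => feedback lam Q R (z s) with hg_def
  have hg : Continuous g := (feedback lam Q R).continuous.comp hz
  have hfix' : z = 𝒮.costate z₀ g := funext hfix
  set ζ : ℕ → ℝ → 𝒮.DAdj := fun n t => 𝒮.avg ((n : ℝ) + 1)⁻¹ (z t) with hζ_def
  set γ : ℕ → ℝ → 𝒮.DAdj := fun n t => 𝒮.avg ((n : ℝ) + 1)⁻¹ (g t) with hγ_def
  have hζc : ∀ n, Continuous (ζ n) := fun n => (continuous_avg _).comp hz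
  have hγc : ∀ n, Continuous (γ n) := fun n => (continuous_avg _).comp hg
  have hZc : ∀ n, Continuous fun t => incl (ζ n t) := fun n => continuous_incl.comp (hζc n)
  have hGc : ∀ n, Continuous fun t => incl (γ n t) := fun n => continuous_incl.comp (hγc n)
  have hbc : ∀ n, Continuous fun t => adjControl B (ζ n t) := fun n =>
    (continuous_adjControl B).comp (hζc n)
  have hZlim : ∀ t, Tendsto (fun n => incl (ζ n t)) atTop (𝓝 (z t)) := fun t => tendsto_incl_avg _
  have hGlim : ∀ t, Tendsto (fun n => incl (γ n t)) atTop (𝓝 (g t)) := fun t => tendsto_incl_avg _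
  have hQc : Continuous Q := Q.continuous
  have hρ := continuous_energyRate lam Q R
  have hder : ∀ n t, HasDerivAt (fun t => RCLike.re (inner 𝕜 (Q (incl (ζ n t))) (incl (ζ n t))))
      (-‖opSqrt W (adjControl B (ζ n t))‖ ^ 2 + energyRate lam Q R (incl (ζ n t)) (incl (γ n t))) t := by
    intro n t
    have h1 : HasDerivAt (fun t => incl (ζ n t)) (-adj (ζ n t) - incl (γ n t)) t := by
      have := hasDerivAt_incl_avg_costate (𝒮 := 𝒮) ((n : ℝ) + 1)⁻¹ z₀ hg t
      rw [← hfix'] at this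
      exact this
    have h2 : HasDerivAt (fun t => Q (incl (ζ n t))) (Q (-adj (ζ n t) - incl (γ n t))) t :=
      (((Q : H →L[𝕜] H).restrictScalars ℝ).hasFDerivAt.comp_hasDerivAt t h1)
    have h3 := (RCLike.reCLM (K := 𝕜)).hasFDerivAt.comp_hasDerivAt t (h2.inner 𝕜 h1)
    refine h3.congr_deriv ?_
    rw [energyRate, ← hId.re_inner_eq hR hW (ζ n t) (incl (γ n t))]
    have h4 : inner 𝕜 (Q (-adj (ζ n t) - incl (γ n t))) (incl (ζ n t)) =
      inner 𝕜 (-adj (ζ n t) - incl (γ n t)) (Q (incl (ζ n t))) := hQ _ _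
    rw [h4, RCLike.reCLM_apply, _root_.map_add, inner_re_symm, two_mul]
  have hsub : volume.restrict (Set.Ioc τ t) ≤ volume.restrict (Set.Ioo 0 T) :=
    Measure.restrict_mono (show Set.Ioc τ t ⊆ Set.Ioo 0 T from
      fun s hs => ⟨hτ.trans_lt hs.1, hs.2.trans_lt htT⟩) le_rfl
  have hWv : MemLp (fun s => opSqrt W (v s)) 2 (volume.restrict (Set.Ioo 0 T)) :=
    (opSqrt W).comp_memLp' hv
  have hWlim := (hlim.clm (opSqrt W)).mono_measure hsub
  have l1 : Tendsto (fun n => ∫ s in τ..t, ‖opSqrt W (adjControl B (ζ n s))‖ ^ 2) atTop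
      (𝓝 (∫ s in τ..t, ‖opSqrt W (v s)‖ ^ 2)) := by
    simp only [intervalIntegral.integral_of_le hτt]
    refine hWlim.tendsto_integral_norm_sq (fun n => ?_) (hWv.mono_measure hsub)
    exact ((opSqrt W).comp_memLp' (memLp_of_continuous (hbc n) 2 T)).mono_measure hsub
  obtain ⟨M, hM0, hM⟩ := 𝒮.exists_norm_incl_avg_le
  have l2 : Tendsto (fun n => ∫ s in τ..t, energyRate lam Q R (incl (ζ n s)) (incl (γ n s))) atTop
      (𝓝 (∫ s in τ..t, energyRate lam Q R (z s) (g s))) := by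
    obtain ⟨C, hC⟩ := (isCompact_Icc (a := τ) (b := t)).exists_bound_of_continuousOn
      hz.continuousOn
    obtain ⟨D, hD⟩ := (isCompact_Icc (a := τ) (b := t)).exists_bound_of_continuousOn
      hg.continuousOn
    obtain ⟨K, hK⟩ := exists_norm_energyRate_le lam Q R (max (M * C) (M * D))
    refine intervalIntegral.tendsto_integral_filter_of_dominated_convergence (fun _ => K)
      (Eventually.of_forall fun n => ?_) (Eventually.of_forall fun n => ae_of_all _ fun s hs => ?_)
      intervalIntegrable_const (ae_of_all _ fun s _ => ?_)
    · exact (hρ.comp ((hZc n).prodMk (hGc n))).aestronglyMeasurable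
    · rw [Set.uIoc_of_le hτt] at hs
      have c1 : ‖incl (ζ n s)‖ ≤ M * C := (hM n _).trans
        (mul_le_mul_of_nonneg_left (hC s (Set.Ioc_subset_Icc_self hs)) hM0)
      have c2 : ‖incl (γ n s)‖ ≤ M * D := (hM n _).trans
        (mul_le_mul_of_nonneg_left (hD s (Set.Ioc_subset_Icc_self hs)) hM0)
      exact hK _ _ (c1.trans (le_max_left _ _)) (c2.trans (le_max_right _ _))
    · exact (hρ.tendsto (z s, g s)).comp ((hZlim s).prodMk_nhds (hGlim s))
  have hEc : Continuous fun x : H => RCLike.re (inner 𝕜 (Q x) x) :=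
    RCLike.continuous_re.comp (hQc.inner continuous_id)
  have hint : ∀ n, RCLike.re (inner 𝕜 (Q (incl (ζ n t))) (incl (ζ n t))) -
      RCLike.re (inner 𝕜 (Q (incl (ζ n τ))) (incl (ζ n τ))) =
      -(∫ s in τ..t, ‖opSqrt W (adjControl B (ζ n s))‖ ^ 2) +
        ∫ s in τ..t, energyRate lam Q R (incl (ζ n s)) (incl (γ n s)) := by
    intro n
    have c1 : Continuous fun s => ‖opSqrt W (adjControl B (ζ n s))‖ ^ 2 :=
      ((opSqrt W).continuous.comp (hbc n)).norm.pow 2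
    have c2 : Continuous fun s => energyRate lam Q R (incl (ζ n s)) (incl (γ n s)) :=
      hρ.comp ((hZc n).prodMk (hGc n))
    have c1' : Continuous fun s => -‖opSqrt W (adjControl B (ζ n s))‖ ^ 2 := c1.neg
    rw [← intervalIntegral.integral_eq_sub_of_hasDerivAt (fun s _ => hder n s)
      ((c1'.add c2).intervalIntegrable τ t), intervalIntegral.integral_add
      (c1'.intervalIntegrable τ t) (c2.intervalIntegrable τ t), intervalIntegral.integral_neg]
  have hl := tendsto_nhds_unique
    (((hEc.tendsto _).comp (hZlim t)).sub ((hEc.tendsto _).comp (hZlim τ)))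
    ((l1.neg.add l2).congr fun n => (hint n).symm)
  refine hl.trans ?_
  have e : ∀ s, energyRate lam Q R (z s) (g s) = -2 * lam * RCLike.re (inner 𝕜 (Q (z s)) (z s)) -
      ‖opSqrt R (Q (z s))‖ ^ 2 := fun s => re_inner_feedback hR (z s)
  have c3 : Continuous fun s => RCLike.re (inner 𝕜 (Q (z s)) (z s)) := hEc.comp hz
  have c4 : Continuous fun s => ‖opSqrt R (Q (z s))‖ ^ 2 :=
    ((opSqrt R).continuous.comp (hQc.comp hz)).norm.pow 2
  have c5 : IntervalIntegrable (fun s => ‖opSqrt W (v s)‖ ^ 2) volume τ t := by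
    rw [intervalIntegrable_iff_integrableOn_Ioc_of_le hτt]
    exact (hWv.mono_measure hsub).integrable_norm_pow (by norm_num)
  simp only [e]
  rw [intervalIntegral.integral_sub ((c3.const_mul _).intervalIntegrable τ t)
    (c4.intervalIntegrable τ t), intervalIntegral.integral_const_mul,
    intervalIntegral.integral_add c5 (c4.intervalIntegrable τ t)]
  ring

/-! ### The closed-loop system -/

/-- Every statement is phrased through one continuous costate `z` with state `Q z`. A competing
solution is identified with it in three stages, each using the one before: the costate from its
closed equation, the trace from the costate, the state from the trace. -/
theorem exists_isClosedLoopSol (hB : 𝒮.Admissible B) (hQ : (Q : H →L[𝕜] H).IsSymmetric)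
    (hR : R.IsPositive) (hW : W.IsPositive) (hId : 𝒮.OperatorIdentity B lam Q R W) (y₀ : H) :
    ∃ (z : ℝ → H) (v : ℝ → U), Continuous z ∧
      (∀ T : ℝ, 0 < T → 𝒮.IsClosedLoopSol B lam Q R W y₀ T (fun t => Q (z t)) z v) ∧
      (∀ T : ℝ, 0 < T → ∀ (y' z' : ℝ → H) (v' : ℝ → U),
        𝒮.IsClosedLoopSol B lam Q R W y₀ T y' z' v' →
        Set.EqOn y' (fun t => Q (z t)) (Set.Icc 0 T) ∧ Set.EqOn z' z (Set.Icc 0 T) ∧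
          v' =ᵐ[volume.restrict (Set.Ioo 0 T)] v) ∧
      ∀ τ t : ℝ, 0 ≤ τ → τ ≤ t →
        RCLike.re (inner 𝕜 (Q (z t)) (z t)) - RCLike.re (inner 𝕜 (Q (z τ)) (z τ)) =
        -2 * lam * (∫ s in τ..t, RCLike.re (inner 𝕜 (Q (z s)) (z s))) -
          ∫ s in τ..t, (‖opSqrt W (v s)‖ ^ 2 + ‖opSqrt R (Q (z s))‖ ^ 2) := by
  obtain ⟨z, hz, hfix⟩ := 𝒮.exists_costate_fixedPoint (feedback lam Q R) (Q.symm y₀)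
  have hg : Continuous fun s => feedback lam Q R (z s) := (feedback lam Q R).continuous.comp hz
  have hfix' : z = 𝒮.costate (Q.symm y₀) (fun s => feedback lam Q R (z s)) := funext hfix
  obtain ⟨v, hv⟩ := hB.exists_trace (Q.symm y₀) hg
  have hz0 : z 0 = Q.symm y₀ := by rw [hfix, costate_zero]
  have hsol : ∀ T : ℝ, 0 < T →
      𝒮.IsClosedLoopSol B lam Q R W y₀ T (fun t => Q (z t)) z v := by
    intro T hT
    obtain ⟨hv1, hv2⟩ := hv T hT
    have htr := isAdjControlTrace_costate (Q.symm y₀) hg hv1 hv2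
    have hco := 𝒮.isWeakSolAdj_costate T (Q.symm y₀) hg
    rw [← hfix'] at hv2 htr hco
    exact ⟨isWeakSol_costate hQ hR hW hId hz hfix hv1 hv2, hco, htr, by simp [hz0], hz0⟩
  refine ⟨z, v, hz, hsol, fun T hT y' z' v' h => ?_, fun τ t hτ hτt => ?_⟩
  · have hs := hsol T hT
    have hzz : Set.EqOn z' z (Set.Icc 0 T) :=
      IsWeakSolAdj.eqOn_of_fixedPoint (feedback lam Q R) hz hfix h.costate h.costate_zero
    have hvv : v =ᵐ[volume.restrict (Set.Ioo 0 T)] v' := by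
      refine hs.trace.ae_eq hB hT hg.aestronglyMeasurable h.trace (hzz ⟨hT.le, le_rfl⟩).symm ?_
      exact ae_restrict_Ioo_of_eqOn_Icc fun t ht => by simp only [hzz ht, feedback_apply]
    refine ⟨h.state.eqOn hs.state ?_ ?_, hzz, hvv.symm⟩
    · filter_upwards [hvv] with t ht
      rw [ht]
    · rw [h.state_zero, hs.state_zero]
  · obtain ⟨hv1, hv2⟩ := hv (t + 1) (by linarith)
    rw [← hfix'] at hv2
    exact energy_costate hQ hR hW hId hz hfix hv1 hv2 hτ hτt (by linarith)

end Real

end C0Group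

end

/-! ### The main theorem -/

theorem mainTheorem1 {𝕜 H U : Type*} [RCLike 𝕜]
    [NormedAddCommGroup H] [InnerProductSpace 𝕜 H] [CompleteSpace H]
    [NormedAddCommGroup U] [InnerProductSpace 𝕜 U] [CompleteSpace U]
    (𝒮 : C0Group 𝕜 H) (B : U →L[𝕜] 𝒮.DAdjDual) (hB : 𝒮.Admissible B)
    (lam : ℝ) (Q : H ≃L[𝕜] H) (R : H →L[𝕜] H) (W : U →L[𝕜] U)
    (hQ : (Q : H →L[𝕜] H).IsSymmetric)
    (hQpos : ∃ C : ℝ, 0 < C ∧ ∀ x : H, C * ‖x‖ ^ 2 ≤ RCLike.re (inner 𝕜 (Q x) x))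
    (hR : R.IsPositive) (hW : W.IsPositive)
    (hId : 𝒮.OperatorIdentity B lam Q R W) (y₀ : H) :
    -- existence of a global weak solution
    (∃ (y yt : ℝ → H) (v : ℝ → U),
      ∀ T : ℝ, 0 < T → 𝒮.IsClosedLoopSol B lam Q R W y₀ T y yt v) ∧
    -- uniqueness on every bounded time interval
    (∀ T : ℝ, 0 < T → ∀ (y yt y' yt' : ℝ → H) (v v' : ℝ → U),
      𝒮.IsClosedLoopSol B lam Q R W y₀ T y yt v →
      𝒮.IsClosedLoopSol B lam Q R W y₀ T y' yt' v' →
      Set.EqOn y y' (Set.Icc 0 T) ∧ Set.EqOn yt yt' (Set.Icc 0 T) ∧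
        v =ᵐ[volume.restrict (Set.Ioo 0 T)] v') ∧
    -- properties of the weak solution
    (∀ (y yt : ℝ → H) (v : ℝ → U),
      (∀ T : ℝ, 0 < T → 𝒮.IsClosedLoopSol B lam Q R W y₀ T y yt v) →
      (∀ t : ℝ, 0 ≤ t → yt t = Q.symm (y t)) ∧
      (∀ τ t : ℝ, 0 ≤ τ → τ ≤ t →
        ‖opSqrt (Q.symm : H →L[𝕜] H) (y t)‖ ^ 2 - ‖opSqrt (Q.symm : H →L[𝕜] H) (y τ)‖ ^ 2
          = - 2 * lam * (∫ s in τ..t, ‖opSqrt (Q.symm : H →L[𝕜] H) (y s)‖ ^ 2)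
            - ∫ s in τ..t, (‖opSqrt W (v s)‖ ^ 2 + ‖opSqrt R (y s)‖ ^ 2)) ∧
      (∀ t : ℝ, 0 ≤ t →
        ‖opSqrt (Q.symm : H →L[𝕜] H) (y t)‖
          ≤ Real.exp (- lam * t) * ‖opSqrt (Q.symm : H →L[𝕜] H) (y 0)‖)) := by
  -- The integrals in `H` used above need a real structure compatible with `𝕜`, which restriction of
  -- scalars provides.
  let _ : NormedSpace ℝ H := NormedSpace.restrictScalars ℝ 𝕜 H
  have _ : IsScalarTower ℝ 𝕜 H := IsScalarTower.restrictScalars ..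
  obtain ⟨z, w, hz, hsol, huniq, henergy⟩ :=
    C0Group.exists_isClosedLoopSol hB hQ hR hW hId y₀
  refine ⟨⟨_, z, w, hsol⟩, fun T hT y yt y' yt' v v' h h' => ?_, fun y yt v h => ?_⟩
  · obtain ⟨h1, h2, h3⟩ := huniq T hT y yt v h
    obtain ⟨h1', h2', h3'⟩ := huniq T hT y' yt' v' h'
    exact ⟨h1.trans h1'.symm, h2.trans h2'.symm, h3.trans h3'.symm⟩
  have hpos : (Q.symm : H →L[𝕜] H).IsPositive := by
    obtain ⟨C, hC, hCQ⟩ := hQpos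
    exact C0Group.isPositive_symm hQ fun x => le_trans (by positivity) (hCQ x)
  -- The horizon `t + 1` is an arbitrary positive one beyond `t`, which also covers `t = 0`.
  have hy : ∀ t, 0 ≤ t → y t = Q (z t) := fun t ht =>
    (huniq (t + 1) (by linarith) y yt v (h _ (by linarith))).1 ⟨ht, by linarith⟩
  have hyt : ∀ t, 0 ≤ t → yt t = z t := fun t ht =>
    (huniq (t + 1) (by linarith) y yt v (h _ (by linarith))).2.1 ⟨ht, by linarith⟩
  have hE : ∀ t, 0 ≤ t →
      ‖opSqrt (Q.symm : H →L[𝕜] H) (y t)‖ ^ 2 = RCLike.re (inner 𝕜 (Q (z t)) (z t)) := by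
    intro t ht
    rw [C0Group.norm_opSqrt_sq hpos, hy t ht, ContinuousLinearEquiv.coe_coe,
      ContinuousLinearEquiv.symm_apply_apply, inner_re_symm]
  refine ⟨fun t ht => by rw [hyt t ht, hy t ht, Q.symm_apply_apply], fun τ t hτ hτt => ?_,
    fun t ht => ?_⟩
  · have hv := (huniq (t + 1) (by linarith) y yt v (h _ (by linarith))).2.2
    rw [hE t (hτ.trans hτt), hE τ hτ, henergy τ t hτ hτt]
    congr 1
    · congr 1
      refine intervalIntegral.integral_congr fun s hs => ?_
      rw [Set.uIcc_of_le hτt] at hs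
      exact (hE s (hτ.trans hs.1)).symm
    · rw [intervalIntegral.integral_of_le hτt, intervalIntegral.integral_of_le hτt]
      refine integral_congr_ae ?_
      have hsub : Set.Ioc τ t ⊆ Set.Ioo 0 (t + 1) := fun s hs =>
        ⟨hτ.trans_lt hs.1, by linarith [hs.2]⟩
      filter_upwards [ae_restrict_of_ae_restrict_of_subset hsub hv,
        ae_restrict_mem measurableSet_Ioc] with s hs hs'
      rw [hs, hy s (hτ.trans hs'.1.le)]
  · have hc : Continuous fun s => RCLike.re (inner 𝕜 (Q (z s)) (z s)) :=
      RCLike.continuous_re.comp ((Q.continuous.comp hz).inner hz)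
    -- The dissipation integral is non-negative and is dropped. Gronwall at rate `-2 λ` bounds the
    -- squared norm, and the square root halves the rate.
    have hle := C0Group.le_exp_mul_of_sub_le hc (-2 * lam) (fun τ t hτ hτt => by
      rw [henergy τ t hτ hτt]
      refine sub_le_self _ (intervalIntegral.integral_nonneg hτt fun s _ => ?_)
      positivity) ht
    rw [← hE t ht, ← hE 0 le_rfl] at hle
    refine (sq_le_sq₀ (norm_nonneg _) (by positivity)).1 (hle.trans (le_of_eq ?_))
    rw [mul_pow, ← Real.exp_nat_mul, mul_comm]
    congr 2
    push_cast
    ring
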